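/- Let $k\ge 0$ and $n_1,\dots,n_k\ge 1$ be integers. A *permutation set* $\theta$ for $(n_1,\dots,n_k)$ consists of a permutation $\theta_{ij}$ of $\{1,\dots,n_i\}\times\{1,\dots,n_j\}$ for all $1\le i<j\le k$. Let $\mathbb F^+_\theta$ be the unital semigroup with generators $e_{ip}$ ($1\le i\le k$, $1\le p\le n_i$) and relations $e_{ip}e_{jq}=e_{jq'}e_{ip'}$ whenever $i<j$ and $\theta_{ij}(p,q)=(p',q')$; $\theta$ is *cancelative* if $\mathbb F^+_\theta$ is left and right cancelative. In that case let $L_v\xi_w=\xi_{vw}$ be the left shifts on $\mathcal H_\theta=\ell^2(\mathbb F_\theta^+)$ (with orthonormal basis $\{\xi_w\}$), and let $\mathcal A_\theta$ and $\mathfrak L_\theta$ be the norm closed and the weak operator topology closed algebras of operators generated by $\{L_w : w\in\mathbb F^+_\theta\}$. The *Gelfand space* of $\mathcal A_\theta$ is the set of points $(\rho(L_{e_{ip}}))_{i,p}\in\mathbb C^{n_1}\times\dots\times\mathbb C^{n_k}$, where $\rho$ runs through the characters of $\mathcal A_\theta$. It is *of minimal type* if it equals $$\Big(\bigcup_{j=1}^k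 \overline{\mathbb B}_{n_j}\times\{0\}\Big)\cup\Big((\overline{\mathbb B}_{n_1}\cap E_{n_1})\times\dots\times(\overline{\mathbb B}_{n_k}\cap E_{n_k})\Big),$$ where $\overline{\mathbb B}_{n}$ is the closed Euclidean unit ball of $\mathbb C^{n}$, $E_n=\{z\in\mathbb C^n: z_1=\dots=z_n\}$, and $\overline{\mathbb B}_{n_j}\times\{0\}$ is the set of points whose $j$-th component lies in $\overline{\mathbb B}_{n_j}$ and whose other components vanish. For a permutation $\sigma$ of a finite set let $\pi(\sigma)$ be the permutation matrix with $\pi(\sigma)e_y=e_{\sigma(y)}$. For $j<i$ let $\tau_{ij}$ denote $\tau_{ji}^{-1}$ conjugated by the flip of coordinates, so that $e_{ip}e_{jq}=e_{jq'}e_{ip'}$ in $\mathbb F^+_\tau$ whenever $i\ne j$ and $\tau_{ij}(p,q)=(p',q')$. For a permutation $s$ of $\{1,\dots,k\}$ with $n_{s(i)}=n_i$ for all $i$, and unitary matrices $A_i\in M_{n_i}(\mathbb C)$, say that $(s,A)$ *intertwines* $\theta$ and $\tau$ if $$\pi(\theta_{ij})(A_i\otimes A_j)=(A_i\otimes A_j)\pi(\tau_{s(i)s(j)})\qquad\text{for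 all } 1\le i<j\le k .$$ Call $\theta$ and $\tau$ *product unitarily equivalent* (up to relabelling of the $k$ sets of generators) if some $(s,A)$ intertwines them. Let $U_{s,A}$ denote the unitary operator on $\mathcal H_\theta$, if it exists, such that, for every word $x_1\cdots x_m$ in the generators $e_{ip}$ whose first indices $i$ are nondecreasing, $$U_{s,A}\,\xi_{x_1\cdots x_m}=T_{x_1}\cdots T_{x_m}\xi_1,\qquad\text{where } T_{e_{ip}}=\sum_{q}(A_i)_{pq}L_{e_{s(i)q}};$$ it is then unique, and for $s=\mathrm{id}$ it is the operator $U_{A_1,\dots,A_k}=\sum_{p\in\mathbb Z_+^k}A_1^{\otimes p_1}\otimes\dots\otimes A_k^{\otimes p_k}$. **Theorem 7.3.** Let $\theta,\tau$ be cancelative permutation sets for $(n_1,\dots,n_k)$. 1. If every $\theta_{ij}$ is a single cycle of length $n_in_j$, then the Gelfand space of $\mathcal A_\theta$ is of minimal type. 2. If the Gelfand spaces of $\mathcal A_\theta$ and $\mathcal A_\tau$ are of minimal type, then the following are equivalent: (i) $\mathcal A_\theta$ and $\mathcal A_\tau$ are isometrically isomorphic (as complex algebras); (ii) $\mathfrak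 L_\theta$ and $\mathfrak L_\tau$ are isometrically isomorphic; (iii) $\theta$ and $\tau$ are product unitarily equivalent (up to relabelling). 3. If the Gelfand space of $\mathcal A_\theta$ is of minimal type and $n_i\ge 2$ for at least two indices $i$, then every automorphism of $\mathcal A_\theta$ of the form $X\mapsto WXW^*$ with $W$ a unitary operator is of the form $X\mapsto U_{s,A}XU_{s,A}^*$ for some $(s,A)$ that intertwines $\theta$ with itself (when the $n_i$ are pairwise distinct, $s=\mathrm{id}$ and this says that each $A_i\otimes A_j$, $i<j$, commutes with $\pi(\theta_{ij})$). 4. Conversely, whenever $(s,A)$ intertwines $\theta$ with itself, the unitary $U_{s,A}$ exists and $X\mapsto U_{s,A}XU_{s,A}^*$ is an automorphism of $\mathcal A_\theta$. -/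

import Mathlib

open scoped Matrix Kronecker

noncomputable section

/-! ### Fock space and analytic Toeplitz algebras of a cancellative monoid -/

section Monoid

variable (S : Type)

/-- The Fock space `ℓ²(S)`. -/
abbrev FockSpace : Type := lp (fun _ : S => ℂ) 2

variable {S}

open Classical in
/-- The basis vector `ξ_w` of the Fock space. -/
def fockVec (w : S) : FockSpace S := lp.single 2 w (1 : ℂ)

theorem orthonormal_fockVec : Orthonormal ℂ (fockVec : S → FockSpace S) := by
  classical
  rw [orthonormal_iff_ite]
  intro i j
  simp only [fockVec, lp.inner_single_left, lp.single_apply, Pi.single_apply]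
  by_cases h : i = j <;> simp [h]

variable [Monoid S] [IsCancelMul S]

theorem orthonormal_fockVec_mul (v : S) :
    Orthonormal ℂ (fun w : S => fockVec (v * w)) :=
  orthonormal_fockVec.comp (fun w => v * w) (mul_right_injective v)

/-- The left shift `L_v`: the isometry of `ℓ²(S)` with `L_v ξ_w = ξ_{vw}`
(see `leftShift_fockVec`). -/
def leftShift (v : S) : FockSpace S →L[ℂ] FockSpace S :=
  (orthonormal_fockVec_mul v).orthogonalFamily.linearIsometry.toContinuousLinearMap

theorem leftShift_fockVec (v w : S) : leftShift v (fockVec w) = fockVec (v * w) := by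
  classical
  have h := (orthonormal_fockVec_mul v).orthogonalFamily.linearIsometry_apply_single
    (i := w) (1 : ℂ)
  simpa only [leftShift, fockVec, LinearIsometry.coe_toContinuousLinearMap,
    LinearIsometry.toSpanSingleton_apply, one_smul] using h

variable (S)

/-- The algebra generated by all left shifts. -/
def shiftAlgebra : Subalgebra ℂ (FockSpace S →L[ℂ] FockSpace S) :=
  Algebra.adjoin ℂ (Set.range (leftShift : S → FockSpace S →L[ℂ] FockSpace S))

/-- The norm closed algebra `𝒜_S` generated by the left shifts. -/
def normToeplitz : Subalgebra ℂ (FockSpace S →L[ℂ] FockSpace S) :=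
  (shiftAlgebra S).topologicalClosure

/-- The algebra `𝔏_S` generated by the left shifts and closed in the weak operator topology
(the closure is taken in the type synonym `H →WOT[ℂ] H` and transported back to `H →L[ℂ] H`,
which carries the operator norm). -/
def weakToeplitz : Subalgebra ℂ (FockSpace S →L[ℂ] FockSpace S) :=
  let φ : (FockSpace S →WOT[ℂ] FockSpace S) ≃ₐ[ℂ] (FockSpace S →L[ℂ] FockSpace S) :=
    ContinuousLinearMapWOT.algEquiv ℂ
  (((shiftAlgebra S).comap φ.toAlgHom).topologicalClosure).map φ.toAlgHom

theorem leftShift_mem_normToeplitz (v : S) : leftShift v ∈ normToeplitz S :=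
  Subalgebra.le_topologicalClosure _ (Algebra.subset_adjoin ⟨v, rfl⟩)

end Monoid

/-! ### Permutation sets and their semigroups -/

/-- A permutation set for `n = (n_1, …, n_k)`: for `i < j` a permutation `θ_{ij}` of the formal
products `e_{ip} e_{jq}`, that is, of the index pairs `(p, q)`. -/
abbrev PermSet {k : ℕ} (n : Fin k → ℕ) : Type :=
  ∀ i j : Fin k, i < j → Equiv.Perm (Fin (n i) × Fin (n j))

namespace PermSet

variable {k : ℕ} {n : Fin k → ℕ}

/-- The generators `e_{ip}`. -/
abbrev Gen (n : Fin k → ℕ) : Type := Σ i : Fin k, Fin (n i)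

/-- The commutation relations `e_{ip} e_{jq} = e_{jq'} e_{ip'}` for `θ_{ij}(p,q) = (p',q')`. -/
inductive Rel (θ : PermSet n) : FreeMonoid (Gen n) → FreeMonoid (Gen n) → Prop
  | comm (i j : Fin k) (h : i < j) (p : Fin (n i)) (q : Fin (n j)) :
      Rel θ (FreeMonoid.of ⟨i, p⟩ * FreeMonoid.of ⟨j, q⟩)
        (FreeMonoid.of ⟨j, (θ i j h (p, q)).2⟩ * FreeMonoid.of ⟨i, (θ i j h (p, q)).1⟩)

/-- The unital semigroup `𝔽⁺_θ`; `θ` is called cancellative when this monoid satisfies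
`IsCancelMul`. -/
abbrev Semigp (θ : PermSet n) : Type := PresentedMonoid (Rel θ)

/-- The generator `e_{ip}` as an element of `𝔽⁺_θ`. -/
def gen (θ : PermSet n) (x : Gen n) : Semigp θ := PresentedMonoid.of (Rel θ) x

/-- The permutation of index pairs `(p, q)` describing how a letter of block `i` followed by a
letter of block `j` is commuted, for any two distinct blocks (in either order):
if it maps `(p, q)` to `(p', q')`, then `e_{ip} e_{jq} = e_{jq'} e_{ip'}`. For `i < j` this is
`θ_{ij}`; for `j < i` it is the inverse of `θ_{ji}` conjugated by the coordinate flip. -/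
def perm (θ : PermSet n) (i j : Fin k) (h : i ≠ j) : Equiv.Perm (Fin (n i) × Fin (n j)) :=
  if hij : i < j then θ i j hij
  else (Equiv.prodComm _ _).trans
    ((θ j i (lt_of_le_of_ne (not_lt.mp hij) h.symm)).symm.trans (Equiv.prodComm _ _))

/-- Every `θ_{ij}` is a single cycle running through all `n_i n_j` pairs. -/
def IsPurelyCyclic (θ : PermSet n) : Prop :=
  ∀ (i j : Fin k) (h : i < j), (θ i j h).IsCycleOn Set.univ

/-! ### The Gelfand space -/

/-- The Gelfand space of `𝒜_θ` in its canonical coordinates: the set of all points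
`(ρ(L_{e_{ip}}))_{i,p}`, where `ρ` runs through the characters of `𝒜_θ`. -/
def gelfandSpace (θ : PermSet n) [IsCancelMul (Semigp θ)] : Set (∀ i : Fin k, Fin (n i) → ℂ) :=
  Set.range fun (ρ : WeakDual.characterSpace ℂ (normToeplitz (Semigp θ))) i p =>
    ρ ⟨leftShift (gen θ ⟨i, p⟩), leftShift_mem_normToeplitz _ _⟩

/-- The minimal Gelfand space: the union of the closed unit balls of the coordinate subspaces
`ℂ^{n_j}` and of the product of the diagonals `E_{n_i}` intersected with the closed unit balls. -/
def minimalSpace (n : Fin k → ℕ) : Set (∀ i : Fin k, Fin (n i) → ℂ) :=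
  {z | (∀ i, ∑ p, ‖z i p‖ ^ 2 ≤ 1) ∧
    ((∃ j, ∀ i, i ≠ j → z i = 0) ∨ ∀ i p q, z i p = z i q)}

/-- The Gelfand space of `𝒜_θ` is of minimal type. -/
def IsMinimalType (θ : PermSet n) [IsCancelMul (Semigp θ)] : Prop :=
  gelfandSpace θ = minimalSpace n

/-! ### Product unitary equivalence and the unitaries `U_{A_1,…,A_k}` -/

/-- The permutation matrix `π(σ)`, with `π(σ) e_y = e_{σ y}`. -/
def permMat {ι : Type} [DecidableEq ι] (σ : Equiv.Perm ι) : Matrix ι ι ℂ :=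
  Matrix.of fun x y => if x = σ y then 1 else 0

/-- `A_1, …, A_k` are unitary matrices which, after the relabelling `s` of the blocks, intertwine
`θ` and `τ`: `π(θ_{ij}) (A_i ⊗ A_j) = (A_i ⊗ A_j) π(τ_{s(i) s(j)})` for all `i < j`. The rows of
`A_i` are indexed by block `i` of `θ`, its columns by block `s(i)` of `τ`; unitarity forces
`n_i = n_{s(i)}`. For `s = 1` these are square unitary matrices with
`π(θ_{ij}) (A_i ⊗ A_j) = (A_i ⊗ A_j) π(τ_{ij})`. -/
def Intertwines (θ τ : PermSet n) (s : Equiv.Perm (Fin k))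
    (A : ∀ i : Fin k, Matrix (Fin (n i)) (Fin (n (s i))) ℂ) : Prop :=
  (∀ i, A i * (A i)ᴴ = 1 ∧ (A i)ᴴ * A i = 1) ∧
  ∀ (i j : Fin k) (h : i < j),
    permMat (θ i j h) * (A i ⊗ₖ A j) =
      (A i ⊗ₖ A j) * permMat (τ.perm (s i) (s j) (s.injective.ne h.ne))

/-- `θ` and `τ` are product unitarily equivalent, up to a relabelling of the blocks of generators
(blocks can only be exchanged when they have the same multiplicity). -/
def ProductUnitarilyEquivalent (θ τ : PermSet n) : Prop :=
  ∃ (s : Equiv.Perm (Fin k)) (A : ∀ i : Fin k, Matrix (Fin (n i)) (Fin (n (s i))) ℂ),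
    Intertwines θ τ s A

/-- The operator `L_{A e_{ip}} = ∑_q (A_i)_{pq} L_{e_{s(i) q}}`. -/
def letterOp (θ : PermSet n) [IsCancelMul (Semigp θ)] (s : Equiv.Perm (Fin k))
    (A : ∀ i : Fin k, Matrix (Fin (n i)) (Fin (n (s i))) ℂ) (x : Gen n) :
    FockSpace (Semigp θ) →L[ℂ] FockSpace (Semigp θ) :=
  ∑ q : Fin (n (s x.1)), A x.1 x.2 q • leftShift (gen θ ⟨s x.1, q⟩)

/-- The unitary `W` of the Fock space is `U_{A_1,…,A_k} = ∑_p A_1^{⊗ p_1} ⊗ ⋯ ⊗ A_k^{⊗ p_k}`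
(composed with the relabelling `s` of the blocks): a basis vector `ξ_w`, where `w = x_1 ⋯ x_m` is
in standard form (letters of block 1 first, then those of block 2, and so on), that is, the
elementary tensor `x_1 ⊗ ⋯ ⊗ x_m`, is sent to `A x_1 ⊗ ⋯ ⊗ A x_m`, that is, to
`L_{A x_1} ⋯ L_{A x_m} ξ_1 = ∑_y A_{x_1 y_1} ⋯ A_{x_m y_m} ξ_{y_1 ⋯ y_m}`. As every element of
the semigroup has a standard form, this determines `W`. -/
def IsProductUnitary (θ : PermSet n) [IsCancelMul (Semigp θ)] (s : Equiv.Perm (Fin k))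
    (A : ∀ i : Fin k, Matrix (Fin (n i)) (Fin (n (s i))) ℂ)
    (W : FockSpace (Semigp θ) ≃ₗᵢ[ℂ] FockSpace (Semigp θ)) : Prop :=
  ∀ l : List (Gen n), l.Pairwise (fun x y => x.1 ≤ y.1) →
    W (fockVec (l.map (gen θ)).prod) = (l.map (letterOp θ s A)).prod (fockVec 1)

/-- The automorphism `Φ` of `𝒜_θ` is implemented by the unitary `W`: `Φ(X) = W X W*`. -/
def Implements (θ : PermSet n) [IsCancelMul (Semigp θ)]
    (W : FockSpace (Semigp θ) ≃ₗᵢ[ℂ] FockSpace (Semigp θ))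
    (Φ : normToeplitz (Semigp θ) ≃ₐ[ℂ] normToeplitz (Semigp θ)) : Prop :=
  ∀ (X : normToeplitz (Semigp θ)) (f : FockSpace (Semigp θ)),
    (Φ X : FockSpace (Semigp θ) →L[ℂ] FockSpace (Semigp θ)) f =
      W ((X : FockSpace (Semigp θ) →L[ℂ] FockSpace (Semigp θ)) (W.symm f))

end PermSet

end

/-!
The proof compares three descriptions of `θ`: the characters of `𝒜_θ`, the low order Fourier
coefficients of the operators in `𝒜_θ` and `𝔏_θ`, and the combinatorics of `𝔽⁺_θ`.

*Semigroup.* Cancellation has a consequence that is not formal: `e_{ip} u = e_{iq} v` forces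
`p = q` (`PermSet.gen_mul_inj`). Hence the generators of one block act as isometries with
orthogonal ranges, and an element of degree `(1,1)` in two blocks has exactly two factorizations
into generators (`PermSet.gen_mul_gen_eq_iff`).

*Operators.* The elements of `𝔏_θ` are the analytic Toeplitz operators, determined by their
Fourier coefficients `c_w(T) = (T ξ_1)(w)`, which multiply by convolution. Conversely, Fejér means
show that every analytic Toeplitz operator belongs to `𝔏_θ`
(`PermSet.mem_weakToeplitz_iff_isToeplitz`).

*Gelfand space.* The characters are the points of the closed polyball that satisfy the relations
`z_{ip} z_{jq} = z_{jq'} z_{ip'}` (`PermSet.gelfandSpace_eq`). So the minimal type means that the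
cone of solutions is as small as possible, and for a full cycle the relation forces
`z_{ip} z_{jq}` to be constant, which is the first part of the theorem.

*Isomorphisms.* For an isometric isomorphism `Φ`, the constant coefficients `z_x` of `Φ(L_x)` form
a point of the open polyball, and the first order coefficients form a matrix `B`. This matrix is
invertible, as a kernel vector would define a point derivation vanishing on the generators, and
such derivations are zero; for `𝔏_θ`, where the generators are not norm dense, this rests on
`PermSet.IsShiftEigen.eq_zero`. The first order part of the relations then holds in all
directions, so that it cancels the terms with constant coefficients in the second order part. What
remains says that the linear map `B` preserves the quadratic relations
(`PermSet.preservesRelations_of_isometry`). By minimality, `B` is a block permutation matrix up to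
entries that do not matter, its blocks intertwine `θ` and `τ`
(`PermSet.PreservesRelations.exists_perm`), and the unitary parts of their polar decompositions do
so as well.

*Unitaries.* If `(s, A)` intertwines `θ` and `τ`, then the operators `L_{A x}` satisfy the
relations of `θ`, and the vectors obtained by applying words in them to `ξ_1` form an orthonormal
basis. This yields the unitary `U_{s,A}`, and conjugation by it gives the isomorphisms of both
algebras (`PermSet.Intertwines.map_shiftAlgebra`).

*Automorphisms.* If two blocks have at least two generators, then the linearized relations force
`z = 0` (`PermSet.eq_zero_of_linearized_relations`). For `Φ(X) = W X W*` it follows that `W` maps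
the vacuum to a multiple of itself, that `B` is unitary, and that `Φ(L_x) = ∑_y B_{xy} L_y`. The
entries of `B` outside the blocks `(i, s(i))` vanish: for large blocks by unitarity, and for blocks
with one generator because characters bound the `ℓ¹`-norm of a row by its `ℓ²`-norm.
-/

noncomputable section

/-! ### Words, degrees and unique factorization -/

namespace PermSet

variable {k : ℕ} {n : Fin k → ℕ}

theorem gen_mul_gen (θ : PermSet n) {i j : Fin k} (h : i < j) (p : Fin (n i)) (q : Fin (n j)) :
    gen θ ⟨i, p⟩ * gen θ ⟨j, q⟩ =
      gen θ ⟨j, (θ i j h (p, q)).2⟩ * gen θ ⟨i, (θ i j h (p, q)).1⟩ :=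
  PresentedMonoid.mk_eq_mk_of_rel (Rel.comm i j h p q)

theorem gen_mul_gen_perm (θ : PermSet n) {i j : Fin k} (h : i ≠ j) (p : Fin (n i))
    (q : Fin (n j)) :
    gen θ ⟨i, p⟩ * gen θ ⟨j, q⟩ =
      gen θ ⟨j, (θ.perm i j h (p, q)).2⟩ * gen θ ⟨i, (θ.perm i j h (p, q)).1⟩ := by
  rcases lt_or_gt_of_ne h with hij | hij
  · rw [gen_mul_gen θ hij]
    simp [perm, hij]
  · rw [gen_mul_gen θ hij]
    simp [perm, hij.not_gt]

/-- The multidegree of an element of `𝔽⁺_θ`: the multiset of the blocks of its letters. -/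
def deg (θ : PermSet n) : Semigp θ →* Multiplicative (Multiset (Fin k)) :=
  PresentedMonoid.lift (fun x => Multiplicative.ofAdd {x.1}) (by
    rintro _ _ ⟨i, j, h, p, q⟩
    simp only [map_mul, FreeMonoid.lift_eval_of]
    exact mul_comm _ _)

theorem deg_gen (θ : PermSet n) (x : Gen n) : deg θ (gen θ x) = Multiplicative.ofAdd {x.1} := rfl

/-- Words in the generators with prescribed sequence `c` of blocks. -/
def Word (n : Fin k → ℕ) : List (Fin k) → Type
  | [] => PUnit
  | a :: c => Fin (n a) × Word n c

instance instFintypeWord : ∀ c : List (Fin k), Fintype (Word n c)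
  | [] => inferInstanceAs (Fintype PUnit)
  | a :: c =>
    letI := instFintypeWord c
    inferInstanceAs (Fintype (Fin (n a) × Word n c))

/-- Prefixing a letter to a word. -/
def Word.cons {a : Fin k} {c : List (Fin k)} (p : Fin (n a)) (w : Word n c) : Word n (a :: c) :=
  (p, w)

theorem Word.cons_inj {a : Fin k} {c : List (Fin k)} {p q : Fin (n a)} {w w' : Word n c} :
    Word.cons p w = Word.cons q w' ↔ p = q ∧ w = w' := Prod.ext_iff

/-- The element of `𝔽⁺_θ` spelled by a word. -/
def Word.val (θ : PermSet n) : ∀ {c : List (Fin k)}, Word n c → Semigp θ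
  | [], _ => 1
  | a :: _, w => gen θ ⟨a, w.1⟩ * Word.val θ w.2

theorem Word.val_cons (θ : PermSet n) {a : Fin k} {c : List (Fin k)} (p : Fin (n a))
    (w : Word n c) : (Word.cons p w).val θ = gen θ ⟨a, p⟩ * w.val θ := rfl

theorem Word.deg_val (θ : PermSet n) : ∀ {c : List (Fin k)} (w : Word n c),
    deg θ (w.val θ) = Multiplicative.ofAdd (c : Multiset (Fin k))
  | [], _ => map_one _
  | a :: c, w => by
    change deg θ (gen θ ⟨a, w.1⟩ * Word.val θ w.2) = _
    rw [map_mul, deg_gen, Word.deg_val θ w.2]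
    rfl

/-- Splitting a word in two. -/
def Word.append : ∀ (c c' : List (Fin k)), Word n (c ++ c') ≃ Word n c × Word n c'
  | [], c' => (Equiv.punitProd (Word n c')).symm
  | a :: c, c' =>
    (Equiv.prodCongr (Equiv.refl (Fin (n a))) (Word.append c c')).trans
      (Equiv.prodAssoc (Fin (n a)) (Word n c) (Word n c')).symm

theorem Word.val_append (θ : PermSet n) : ∀ (c c' : List (Fin k)) (w : Word n (c ++ c')),
    w.val θ = (Word.append c c' w).1.val θ * (Word.append c c' w).2.val θ
  | [], c', w => (one_mul _).symm
  | a :: c, c', w => by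
    change gen θ ⟨a, w.1⟩ * Word.val θ w.2 = _
    rw [Word.val_append θ c c' w.2, ← mul_assoc]
    rfl

/-- Letters of different blocks can be interchanged, so words with rearranged block sequences
spell the same elements, and equally often. -/
theorem Word.exists_equiv_of_perm (θ : PermSet n) {c c' : List (Fin k)} (h : c.Perm c') :
    ∃ E : Word n c ≃ Word n c', ∀ w, (E w).val θ = w.val θ := by
  induction h with
  | nil => exact ⟨Equiv.refl _, fun _ => rfl⟩
  | @cons a c c' _ ih =>
    obtain ⟨E, hE⟩ := ih
    refine ⟨Equiv.prodCongr (Equiv.refl (Fin (n a))) E, fun w => ?_⟩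
    change gen θ ⟨a, w.1⟩ * Word.val θ (E w.2) = gen θ ⟨a, w.1⟩ * Word.val θ w.2
    rw [hE]
  | swap a b c =>
    by_cases hab : b = a
    · subst hab
      exact ⟨Equiv.refl _, fun _ => rfl⟩
    · refine ⟨(Equiv.prodAssoc (Fin (n b)) (Fin (n a)) (Word n c)).symm.trans
        ((Equiv.prodCongr ((θ.perm b a hab).trans (Equiv.prodComm _ _)) (Equiv.refl _)).trans
        (Equiv.prodAssoc (Fin (n a)) (Fin (n b)) (Word n c))), fun w => ?_⟩
      obtain ⟨p, q, w⟩ := w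
      change gen θ ⟨a, (θ.perm b a hab (p, q)).2⟩ * (gen θ ⟨b, (θ.perm b a hab (p, q)).1⟩ *
        Word.val θ w) = gen θ ⟨b, p⟩ * (gen θ ⟨a, q⟩ * Word.val θ w)
      rw [← mul_assoc, ← mul_assoc, gen_mul_gen_perm θ hab]
  | trans _ _ ih₁ ih₂ =>
    obtain ⟨E₁, h₁⟩ := ih₁
    obtain ⟨E₂, h₂⟩ := ih₂
    exact ⟨E₁.trans E₂, fun w => by simp [h₁, h₂]⟩

theorem induction_gen {θ : PermSet n} {P : Semigp θ → Prop} (one : P 1)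
    (mul : ∀ x w, P w → P (gen θ x * w)) (w : Semigp θ) : P w := by
  induction w using PresentedMonoid.inductionOn with
  | h a =>
    induction a using FreeMonoid.recOn with
    | one => exact one
    | of_mul x xs h =>
      rw [map_mul]
      exact mul x _ h

theorem exists_word (θ : PermSet n) (u : Semigp θ) :
    ∃ (c : List (Fin k)) (w : Word n c), w.val θ = u := by
  induction u using induction_gen with
  | one => exact ⟨[], PUnit.unit, rfl⟩
  | mul x u ih =>
    obtain ⟨c, w, rfl⟩ := ih
    exact ⟨x.1 :: c, (x.2, w), rfl⟩

theorem exists_word_of_deg {θ : PermSet n} {u : Semigp θ} {c : List (Fin k)}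
    (h : deg θ u = Multiplicative.ofAdd (c : Multiset (Fin k))) :
    ∃ w : Word n c, w.val θ = u := by
  obtain ⟨c', w, rfl⟩ := exists_word θ u
  rw [Word.deg_val] at h
  obtain ⟨E, hE⟩ := Word.exists_equiv_of_perm θ
    (Multiset.coe_eq_coe.mp (Multiplicative.ofAdd.injective h))
  exact ⟨E w, hE w⟩

/-- The homomorphism to the free monoid on block `i` with a zero adjoined that sends the letters
of all other blocks to zero. -/
def toFree (θ : PermSet n) (i : Fin k) : Semigp θ →* WithZero (FreeMonoid (Fin (n i))) :=
  PresentedMonoid.lift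
    (fun x => if h : x.1 = i then ((FreeMonoid.of (h ▸ x.2) : FreeMonoid (Fin (n i))) :
      WithZero (FreeMonoid (Fin (n i)))) else 0) (by
    rintro _ _ ⟨a, b, h, p, q⟩
    simp only [map_mul, FreeMonoid.lift_eval_of]
    by_cases ha : a = i
    · have hb : b ≠ i := fun hb => h.ne (ha.trans hb.symm)
      simp [hb]
    · simp [ha])

theorem toFree_gen (θ : PermSet n) (i : Fin k) (p : Fin (n i)) :
    toFree θ i (gen θ ⟨i, p⟩) = ((FreeMonoid.of p : FreeMonoid (Fin (n i))) :
      WithZero (FreeMonoid (Fin (n i)))) := by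
  simp [toFree, gen, PresentedMonoid.lift_of]

theorem toFree_val (θ : PermSet n) (i : Fin k) : ∀ (m : ℕ) (w : Word n (List.replicate m i)),
    ∃ l : FreeMonoid (Fin (n i)), toFree θ i (w.val θ) = (l : WithZero (FreeMonoid (Fin (n i))))
  | 0, _ => ⟨1, map_one _⟩
  | m + 1, w => by
    obtain ⟨l, hl⟩ := toFree_val θ i m w.2
    refine ⟨FreeMonoid.of w.1 * l, ?_⟩
    change toFree θ i (gen θ ⟨i, w.1⟩ * Word.val θ w.2) = _
    rw [map_mul, hl, toFree_gen, WithZero.coe_mul]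

open Classical in
/-- The number of words with block sequence `c` that spell `e`. -/
def wordCount (θ : PermSet n) (c : List (Fin k)) (e : Semigp θ) : ℕ :=
  (Finset.univ.filter fun w : Word n c => w.val θ = e).card

theorem wordCount_perm {θ : PermSet n} {c c' : List (Fin k)} (h : c.Perm c') (e : Semigp θ) :
    wordCount θ c e = wordCount θ c' e := by
  classical
  obtain ⟨E, hE⟩ := Word.exists_equiv_of_perm θ h
  refine Finset.card_equiv E fun w => ?_
  simp [hE]

variable {θ : PermSet n}

theorem wordCount_le_cons {i : Fin k} {c : List (Fin k)} (x : Fin (n i)) (e : Semigp θ) :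
    wordCount θ c e ≤ wordCount θ (i :: c) (gen θ ⟨i, x⟩ * e) := by
  classical
  refine Finset.card_le_card_of_injOn (Word.cons x) ?_ ?_
  · intro w hw
    simp only [Finset.coe_filter, Finset.mem_univ, true_and, Set.mem_ofPred_eq] at hw ⊢
    rw [Word.val_cons, hw]
  · intro w _ w' _ h
    exact (Word.cons_inj.mp h).2

/-- If a product of a letter of block `i` and `e` can also start with a different letter of that block,
then it is spelled by more words than `e`. -/
theorem wordCount_lt_cons {i : Fin k} {c : List (Fin k)} {x x' : Fin (n i)} {e : Semigp θ}
    {w : Word n c} (h : gen θ ⟨i, x⟩ * e = gen θ ⟨i, x'⟩ * w.val θ) (hx : x ≠ x') :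
    wordCount θ c e < wordCount θ (i :: c) (gen θ ⟨i, x⟩ * e) := by
  classical
  have h1 : wordCount θ c e = ((Finset.univ.filter fun w : Word n c => w.val θ = e).image
      (Word.cons x)).card := by
    rw [Finset.card_image_of_injective _ fun w w' h => (Word.cons_inj.mp h).2]
    rfl
  rw [h1]
  refine Finset.card_lt_card ((Finset.ssubset_iff_of_subset ?_).mpr ⟨Word.cons x' w, ?_, ?_⟩)
  · intro v hv
    obtain ⟨w, hw, rfl⟩ := Finset.mem_image.mp hv
    simp only [Finset.mem_filter, Finset.mem_univ, true_and] at hw ⊢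
    rw [Word.val_cons, hw]
  · simp only [Finset.mem_filter, Finset.mem_univ, true_and]
    rw [Word.val_cons, h]
  · intro hv
    obtain ⟨w, hw, h⟩ := Finset.mem_image.mp hv
    exact hx (Word.cons_inj.mp h).1

theorem deg_gen_mul_inj {x y : Gen n} (hxy : x.1 = y.1) {u v : Semigp θ}
    (h : gen θ x * u = gen θ y * v) : deg θ u = deg θ v := by
  have h2 := congrArg (deg θ) h
  rw [map_mul, map_mul, deg_gen, deg_gen, hxy] at h2
  exact mul_left_cancel h2

variable [IsCancelMul (Semigp θ)]

/-- The letters of a single block generate a free monoid. -/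
theorem val_replicate_injective (i : Fin k) : ∀ m : ℕ,
    Function.Injective (Word.val θ : Word n (List.replicate m i) → Semigp θ)
  | 0 => fun _ _ _ => rfl
  | m + 1 => by
    rintro ⟨p, w⟩ ⟨q, w'⟩ h
    change gen θ ⟨i, p⟩ * Word.val θ w = gen θ ⟨i, q⟩ * Word.val θ w' at h
    obtain ⟨l, hl⟩ := toFree_val θ i m w
    obtain ⟨l', hl'⟩ := toFree_val θ i m w'
    have h2 := congrArg (toFree θ i) h
    rw [map_mul, map_mul, hl, hl', toFree_gen, toFree_gen, ← WithZero.coe_mul,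
      ← WithZero.coe_mul, WithZero.coe_inj] at h2
    have h3 : p :: FreeMonoid.toList l = q :: FreeMonoid.toList l' :=
      congrArg FreeMonoid.toList h2
    obtain rfl : p = q := (List.cons.inj h3).1
    rw [val_replicate_injective i m (mul_left_cancel h)]

/-- A bound that does not depend on `m`: by cancellation, a word is determined by its value and its
initial part with block sequence `c`. -/
theorem wordCount_le (c : List (Fin k)) (i : Fin k) (m : ℕ) (e : Semigp θ) :
    wordCount θ (c ++ List.replicate m i) e ≤ Fintype.card (Word n c) := by
  classical
  refine Finset.card_le_card_of_injOn (fun w => (Word.append _ _ w).1) (by simp) ?_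
  intro w hw w' hw' h
  simp only [Finset.coe_filter, Finset.mem_univ, true_and, Set.mem_ofPred_eq] at hw hw'
  rw [Word.val_append] at hw hw'
  simp only at h
  rw [← hw', h] at hw
  exact (Word.append _ _).injective
    (Prod.ext h (val_replicate_injective i m (mul_left_cancel hw)))

/-- Unique factorization: the leftmost letter from a given block is determined by the element.

The commutation relations are only assumed to be binary, so for three or more blocks this uses
cancellation in an essential way. If `e_{ip} u = e_{iq} v` with `p ≠ q`, then the number of words
spelling an element grows under left multiplication by letters of block `i`. It is bounded, so it
is maximal at some left multiple `e` of `e_{ip} u`, and maximality forces uniqueness of the first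
letter of `x u'` for each element `u'` that occurs as left factor in some left multiple of `e`.
Counting shows that these `u'` include `u`. -/
theorem gen_mul_cancel_letter {i : Fin k} {p q : Fin (n i)} {u v : Semigp θ}
    (h : gen θ ⟨i, p⟩ * u = gen θ ⟨i, q⟩ * v) : p = q := by
  obtain ⟨c, wu, hwu⟩ := exists_word θ u
  have hdu : deg θ u = Multiplicative.ofAdd (c : Multiset (Fin k)) := by
    rw [← hwu, Word.deg_val]
  let P : List (Fin (n i)) → Semigp θ := fun l => (l.map fun x => gen θ ⟨i, x⟩).prod
  have hP : ∀ x l, P (x :: l) = gen θ ⟨i, x⟩ * P l := fun x l => by simp [P]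
  have hPapp : ∀ l l', P (l ++ l') = P l * P l' := fun l l' => by simp [P]
  have hPdeg : ∀ l, deg θ (P l) =
      Multiplicative.ofAdd (List.replicate l.length i : Multiset (Fin k)) := by
    intro l
    induction l with
    | nil => exact map_one _
    | cons x l ih =>
      rw [hP, map_mul, ih, deg_gen]
      rfl
  let e : List (Fin (n i)) → Semigp θ := fun l => P l * (gen θ ⟨i, p⟩ * u)
  have he : ∀ x l, e (x :: l) = gen θ ⟨i, x⟩ * e l := fun x l => by
    simp only [e, hP, mul_assoc]
  let pat : List (Fin (n i)) → List (Fin k) := fun l => c ++ List.replicate (l.length + 1) i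
  have hpat : ∀ x l, (pat (x :: l)).Perm (i :: pat l) := fun x l => by
    have : pat (x :: l) = c ++ i :: List.replicate (l.length + 1) i := rfl
    rw [this]
    exact List.perm_middle
  have hedeg : ∀ l, deg θ (e l) = Multiplicative.ofAdd (pat l : Multiset (Fin k)) := by
    intro l
    induction l with
    | nil =>
      have h1 : e [] = gen θ ⟨i, p⟩ * u := one_mul _
      rw [h1, map_mul, deg_gen, hdu, ← ofAdd_add]
      refine congrArg _ ?_
      rw [add_comm]
      rfl
    | cons x l ih =>
      rw [he, map_mul, deg_gen, ih, ← ofAdd_add, Multiset.coe_eq_coe.mpr (hpat x l)]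
      rfl
  let N : List (Fin (n i)) → ℕ := fun l => wordCount θ (pat l) (e l)
  have hN : ∀ x l, N (x :: l) = wordCount θ (i :: pat l) (gen θ ⟨i, x⟩ * e l) := fun x l => by
    change wordCount θ (pat (x :: l)) (e (x :: l)) = _
    rw [wordCount_perm (hpat x l), he]
  have hmono : ∀ l l', N l ≤ N (l' ++ l) := by
    intro l l'
    induction l' with
    | nil => exact le_rfl
    | cons x l' ih =>
      refine ih.trans ?_
      rw [List.cons_append, hN]
      exact wordCount_le_cons _ _
  obtain ⟨l₀, hl₀⟩ : ∃ l₀, ∀ l, N l ≤ N l₀ := by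
    have hb : BddAbove (Set.range N) :=
      ⟨Fintype.card (Word n c), by rintro _ ⟨l, rfl⟩; exact wordCount_le _ _ _ _⟩
    obtain ⟨l₀, h₀⟩ := Nat.sSup_mem (Set.range_nonempty N) hb
    exact ⟨l₀, fun l => by rw [h₀]; exact le_csSup hb ⟨l, rfl⟩⟩
  -- maximality of the number of words makes the first letter from block `i` unique
  have hM : ∀ l' x x' e'', gen θ ⟨i, x⟩ * e (l' ++ l₀) = gen θ ⟨i, x'⟩ * e'' → x = x' := by
    intro l' x x' e'' hx
    by_contra hne
    obtain ⟨w, rfl⟩ := exists_word_of_deg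
      ((deg_gen_mul_inj (x := ⟨i, x⟩) (y := ⟨i, x'⟩) rfl hx).symm.trans (hedeg (l' ++ l₀)))
    have h1 := wordCount_lt_cons hx hne
    rw [← hN] at h1
    exact (h1.trans_le (hl₀ (x :: (l' ++ l₀)))).not_ge (hmono l₀ l')
  -- the elements of the degree of `u` that are left factors of left multiples of the maximal one
  let U₀ : Set (Semigp θ) := {u | deg θ u = Multiplicative.ofAdd (c : Multiset (Fin k)) ∧
    ∃ l' t, u * P t = e (l' ++ l₀)}
  have hfin : Finite U₀ := by
    refine Set.Finite.subset (Set.finite_range (Word.val θ : Word n c → Semigp θ)) ?_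
    rintro u ⟨hu, -⟩
    exact exists_word_of_deg hu
  have hstar : ∀ u ∈ U₀, ∀ x x' u', gen θ ⟨i, x⟩ * u = gen θ ⟨i, x'⟩ * u' → x = x' := by
    rintro u ⟨-, l', t, hu⟩ x x' u' hx
    refine hM l' x x' (u' * P t) ?_
    rw [← hu, ← mul_assoc, hx, mul_assoc]
  have hswap : ∀ (x : Fin (n i)) (u : Semigp θ),
      deg θ u = Multiplicative.ofAdd (c : Multiset (Fin k)) → ∃ (u' : Semigp θ) (x' : Fin (n i)),
        deg θ u' = Multiplicative.ofAdd (c : Multiset (Fin k)) ∧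
        gen θ ⟨i, x⟩ * u = u' * gen θ ⟨i, x'⟩ := by
    intro x u hu
    have hd : deg θ (gen θ ⟨i, x⟩ * u) =
        Multiplicative.ofAdd ((c ++ [i] : List (Fin k)) : Multiset (Fin k)) := by
      rw [map_mul, deg_gen, hu, ← ofAdd_add, add_comm]
      rfl
    obtain ⟨w, hw⟩ := exists_word_of_deg hd
    refine ⟨(Word.append c [i] w).1.val θ, (Word.append c [i] w).2.1, Word.deg_val _ _, ?_⟩
    rw [← hw, Word.val_append]
    exact congrArg _ (mul_one _)
  have hU₀ : ∀ (x : Fin (n i)) (u : U₀), ∃ y : Fin (n i) × U₀,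
      gen θ ⟨i, x⟩ * (u : Semigp θ) = (y.2 : Semigp θ) * gen θ ⟨i, y.1⟩ := by
    rintro x ⟨u, hu, l', t, ht⟩
    obtain ⟨u', x', hu', hx⟩ := hswap x u hu
    refine ⟨⟨x', u', hu', x :: l', x' :: t, ?_⟩, hx⟩
    rw [hP, ← mul_assoc, ← hx, List.cons_append, he, ← ht, mul_assoc]
  -- moving a letter of block `i` from the left to the right permutes the finite set
  -- `{letters} × U₀`, so that the converse move also stays in `U₀`
  choose g hg using hU₀
  have hginj : Function.Injective fun y : Fin (n i) × U₀ => g y.1 y.2 := by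
    rintro ⟨x, u⟩ ⟨x', u'⟩ hy
    have h1 : gen θ ⟨i, x⟩ * (u : Semigp θ) = gen θ ⟨i, x'⟩ * (u' : Semigp θ) := by
      rw [hg, hg]
      simp only at hy
      rw [hy]
    obtain rfl := hstar u u.2 x x' u' h1
    exact Prod.ext rfl (Subtype.ext (mul_left_cancel h1))
  have hgsurj := Finite.injective_iff_surjective.mp hginj
  have hback : ∀ x x' u u', gen θ ⟨i, x⟩ * u = u' * gen θ ⟨i, x'⟩ → u' ∈ U₀ → u ∈ U₀ := by
    intro x x' u u' hx hu'
    obtain ⟨⟨x₂, u₂⟩, h₂⟩ := hgsurj (x', ⟨u', hu'⟩)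
    have h3 := hg x₂ u₂
    simp only at h₂
    rw [h₂] at h3
    have h4 := h3.trans hx.symm
    obtain rfl := hstar u₂ u₂.2 x₂ x u h4
    rw [← mul_left_cancel h4]
    exact u₂.2
  have hpush : ∀ (l : List (Fin (n i))) (u : Semigp θ),
      deg θ u = Multiplicative.ofAdd (c : Multiset (Fin k)) → ∃ (u' : Semigp θ)
        (t : List (Fin (n i))), deg θ u' = Multiplicative.ofAdd (c : Multiset (Fin k)) ∧
        P l * u = u' * P t ∧ (u' ∈ U₀ → u ∈ U₀) := by
    intro l u hu
    induction l with
    | nil => exact ⟨u, [], hu, by simp [P], id⟩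
    | cons x l ih =>
      obtain ⟨u', t, hu', h1, h2⟩ := ih
      obtain ⟨u'', x', hu'', h3⟩ := hswap x u' hu'
      refine ⟨u'', x' :: t, hu'', ?_, fun h4 => h2 (hback x x' u' u'' h3 h4)⟩
      rw [hP, hP, mul_assoc, h1, ← mul_assoc, h3, mul_assoc]
  obtain ⟨u', t, hu', h1, h2⟩ := hpush (l₀ ++ [p]) u hdu
  refine hstar u (h2 ⟨hu', [], t, ?_⟩) p q v h
  rw [← h1, hPapp, mul_assoc, hP]
  exact congrArg (fun y => P l₀ * (y * u)) (mul_one _)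

theorem gen_mul_inj {i : Fin k} {p q : Fin (n i)} {u v : Semigp θ} :
    gen θ ⟨i, p⟩ * u = gen θ ⟨i, q⟩ * v ↔ p = q ∧ u = v := by
  refine ⟨fun h => ?_, fun ⟨hp, hu⟩ => by rw [hp, hu]⟩
  obtain rfl := gen_mul_cancel_letter h
  exact ⟨rfl, mul_left_cancel h⟩

end PermSet

/-! ### Coordinates and Schur multipliers on the Fock space -/

section Fock

variable {S : Type}

theorem fockVec_apply [DecidableEq S] (w v : S) :
    (fockVec w : FockSpace S) v = if v = w then 1 else 0 := by
  classical
  simp only [fockVec, lp.single_apply, Pi.single_apply]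
  congr

theorem fockVec_apply_self (w : S) : (fockVec w : FockSpace S) w = 1 := by
  classical
  rw [fockVec_apply, if_pos rfl]

theorem fockVec_apply_of_ne {w v : S} (h : v ≠ w) : (fockVec w : FockSpace S) v = 0 := by
  classical
  rw [fockVec_apply, if_neg h]

theorem inner_fockVec_left (w : S) (f : FockSpace S) : inner ℂ (fockVec w) f = f w := by
  classical
  simp [fockVec, lp.inner_single_left]

theorem norm_fockVec (w : S) : ‖(fockVec w : FockSpace S)‖ = 1 := orthonormal_fockVec.1 w

theorem hasSum_fockVec (f : FockSpace S) : HasSum (fun w => f w • fockVec w) f := by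
  classical
  have h := lp.hasSum_single (E := fun _ : S => ℂ) (p := 2) (by simp) f
  convert h using 2 with w
  rw [fockVec, ← lp.single_smul, smul_eq_mul, mul_one]

/-- The `w`-th coordinate as a bounded functional. -/
def coord (w : S) : FockSpace S →L[ℂ] ℂ := lp.evalCLM ℂ (fun _ => ℂ) 2 w

@[simp] theorem coord_apply (w : S) (f : FockSpace S) : coord w f = f w := rfl

theorem fock_clm_ext {E : Type*} [NormedAddCommGroup E] [NormedSpace ℂ E]
    {g h : FockSpace S →L[ℂ] E} (H : ∀ w, g (fockVec w) = h (fockVec w)) : g = h := by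
  ext f
  have h1 := (hasSum_fockVec f).mapL g
  have h2 := (hasSum_fockVec f).mapL h
  simp only [map_smul, H] at h1 h2
  exact h1.unique h2

theorem fock_op_ext {A B : FockSpace S →L[ℂ] FockSpace S}
    (H : ∀ w v, (A (fockVec v)) w = (B (fockVec v)) w) : A = B :=
  fock_clm_ext fun v => lp.ext (funext fun w => H w v)

theorem sum_norm_sq_le (s : Finset S) (f : FockSpace S) : ∑ w ∈ s, ‖f w‖ ^ 2 ≤ ‖f‖ ^ 2 := by
  have h := orthonormal_fockVec.sum_inner_products_le (𝕜 := ℂ) (s := s) f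
  simpa only [inner_fockVec_left] using h

theorem norm_apply_le (w : S) (f : FockSpace S) : ‖f w‖ ≤ ‖f‖ := by
  have h := sum_norm_sq_le {w} f
  rw [Finset.sum_singleton] at h
  exact le_of_sq_le_sq h (norm_nonneg _)

/-- The amplification of `T` to countably many orthogonal copies of the Fock space. -/
def amplify (T : FockSpace S →L[ℂ] FockSpace S) :
    lp (fun _ : ℕ => FockSpace S) 2 →L[ℂ] lp (fun _ : ℕ => FockSpace S) 2 :=
  LinearMap.mkContinuous
    { toFun := fun f => ⟨fun i => T (f i), ((lp.memℓp f).const_smul (‖T‖ : ℂ)).mono' fun i => by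
        change ‖T (f i)‖ ≤ ‖(‖T‖ : ℂ) • f i‖
        rw [norm_smul, Complex.norm_real, norm_norm]
        exact T.le_opNorm (f i)⟩
      map_add' := fun f g => by
        ext1; funext i; exact map_add T (f i) (g i)
      map_smul' := fun c f => by
        ext1; funext i; exact map_smul T c (f i) } ‖T‖ (fun f => by
    have h : ‖(‖T‖ : ℂ) • f‖ = ‖T‖ * ‖f‖ := by
      rw [norm_smul, Complex.norm_real, norm_norm]
    rw [← h]
    refine lp.norm_mono (by simp) fun i => ?_
    change ‖T (f i)‖ ≤ ‖(‖T‖ : ℂ) • f i‖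
    rw [norm_smul, Complex.norm_real, norm_norm]
    exact T.le_opNorm (f i))

theorem amplify_apply (T : FockSpace S →L[ℂ] FockSpace S) (f : lp (fun _ : ℕ => FockSpace S) 2)
    (i : ℕ) : amplify T f i = T (f i) := rfl

theorem norm_amplify_le (T : FockSpace S →L[ℂ] FockSpace S) : ‖amplify T‖ ≤ ‖T‖ :=
  LinearMap.mkContinuous_norm_le _ (norm_nonneg _) _

/-- The vector `∑_{i ∈ s} δ_i ⊗ f` of the amplified Fock space. -/
def spread (s : Finset ℕ) (f : FockSpace S) : lp (fun _ : ℕ => FockSpace S) 2 :=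
  ∑ i ∈ s, lp.single 2 i f

theorem inner_spread (s : Finset ℕ) (f : FockSpace S) (g : lp (fun _ : ℕ => FockSpace S) 2) :
    inner ℂ (spread s f) g = ∑ i ∈ s, inner ℂ f (g i) := by
  rw [spread, sum_inner]
  simp only [lp.inner_single_left]

theorem spread_apply (s : Finset ℕ) (f : FockSpace S) (i : ℕ) :
    spread s f i = if i ∈ s then f else 0 := by
  classical
  rw [spread, lp.coeFn_sum, Finset.sum_apply]
  simp only [lp.single_apply, Pi.single_apply]
  rw [Finset.sum_ite_eq]

theorem inner_spread_spread (s t : Finset ℕ) (T : FockSpace S →L[ℂ] FockSpace S)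
    (f g : FockSpace S) :
    inner ℂ (spread s f) (amplify T (spread t g)) = ((s ∩ t).card : ℂ) * inner ℂ f (T g) := by
  rw [inner_spread]
  simp only [amplify_apply, spread_apply]
  have : ∀ i ∈ s, inner ℂ f (T (if i ∈ t then g else 0)) =
      if i ∈ t then inner ℂ f (T g) else 0 := by
    intro i _
    split_ifs <;> simp
  rw [Finset.sum_congr rfl this, ← Finset.sum_filter, Finset.filter_mem_eq_inter,
    Finset.sum_const, nsmul_eq_mul]

/-- A Schur multiplier: the matrix entries of `T` may be multiplied by the normalized Gram matrix
`#(s_v ∩ t_w) / M` of two families of indicator vectors without increasing the norm. -/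
theorem exists_schur_multiplier (T : FockSpace S →L[ℂ] FockSpace S) {M : ℕ} (hM : 0 < M)
    (s t : S → Finset ℕ) (hs : ∀ w, (s w).card = M) (ht : ∀ w, (t w).card = M) :
    ∃ A : FockSpace S →L[ℂ] FockSpace S, ‖A‖ ≤ ‖T‖ ∧
      ∀ v w, (A (fockVec w)) v = ((s v ∩ t w).card / M : ℂ) * (T (fockVec w)) v := by
  classical
  let c : ℂ := ((√(M : ℝ))⁻¹ : ℝ)
  have hc : c * c = (M : ℂ)⁻¹ := by
    simp only [c]
    rw [← Complex.ofReal_mul, ← mul_inv, Real.mul_self_sqrt (Nat.cast_nonneg M)]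
    simp
  have hcc : starRingEnd ℂ c = c := Complex.conj_ofReal _
  have hamp1 : ∀ f : lp (fun _ : ℕ => FockSpace S) 2, amplify 1 f = f := fun f => rfl
  have key : ∀ u : S → Finset ℕ, (∀ w, (u w).card = M) →
      Orthonormal ℂ fun w => c • spread (u w) (fockVec w) := by
    intro u hu
    rw [orthonormal_iff_ite]
    intro v w
    rw [inner_smul_left, inner_smul_right, hcc, ← mul_assoc, hc]
    have h1 := inner_spread_spread (u v) (u w) 1 (fockVec v) (fockVec w)
    rw [hamp1] at h1
    rw [h1, one_apply_eq_self, orthonormal_iff_ite.mp orthonormal_fockVec]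
    split_ifs with h
    · subst h
      rw [Finset.inter_self, hu, mul_one, inv_mul_cancel₀]
      exact_mod_cast hM.ne'
    · simp
  let V : ∀ u : S → Finset ℕ, (∀ w, (u w).card = M) →
      FockSpace S →ₗᵢ[ℂ] lp (fun _ : ℕ => FockSpace S) 2 :=
    fun u hu => (key u hu).orthogonalFamily.linearIsometry
  have hV : ∀ u hu w, V u hu (fockVec w) = c • spread (u w) (fockVec w) := by
    intro u hu w
    have h := (key u hu).orthogonalFamily.linearIsometry_apply_single (i := w) (1 : ℂ)
    simpa only [V, fockVec, LinearIsometry.toSpanSingleton_apply, one_smul] using h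
  refine ⟨(V s hs).toContinuousLinearMap.adjoint ∘L amplify T ∘L
    (V t ht).toContinuousLinearMap, ?_, ?_⟩
  · refine ContinuousLinearMap.opNorm_le_bound _ (norm_nonneg _) fun f => ?_
    have h1 : ‖(V s hs).toContinuousLinearMap.adjoint‖ ≤ 1 := by
      rw [LinearIsometryEquiv.norm_map]
      exact (V s hs).norm_toContinuousLinearMap_le
    have h2 : ‖(amplify T ∘L (V t ht).toContinuousLinearMap) f‖ ≤ ‖T‖ * ‖f‖ := by
      refine (ContinuousLinearMap.le_opNorm (amplify T) _).trans ?_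
      refine mul_le_mul (norm_amplify_le T) ?_ (norm_nonneg _) (norm_nonneg _)
      exact ((V t ht).norm_map f).le
    calc _ ≤ ‖(V s hs).toContinuousLinearMap.adjoint‖ * ‖(amplify T ∘L
          (V t ht).toContinuousLinearMap) f‖ := ContinuousLinearMap.le_opNorm _ _
      _ ≤ 1 * ‖(amplify T ∘L (V t ht).toContinuousLinearMap) f‖ := by gcongr
      _ ≤ _ := by rw [one_mul]; exact h2
  · intro v w
    rw [← inner_fockVec_left, ContinuousLinearMap.comp_apply,
      ContinuousLinearMap.adjoint_inner_right]
    simp only [ContinuousLinearMap.comp_apply, LinearIsometry.coe_toContinuousLinearMap, hV]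
    rw [map_smul, inner_smul_left, inner_smul_right, hcc, inner_spread_spread,
      inner_fockVec_left]
    rw [← mul_assoc, ← mul_assoc, hc]
    ring

end Fock

/-! ### Analytic Toeplitz operators -/

section Toeplitz

variable {S : Type} [Monoid S]

/-- The analytic Toeplitz operators: the operators whose matrix has the form of a left convolution,
`(T ξ_v)(w) = (T ξ_1)(u)` if `w = uv` and `(T ξ_v)(w) = 0` if `w` is not a left multiple of `v`.
Equivalently, the operators that commute with all right shifts. -/
structure IsToeplitz (T : FockSpace S →L[ℂ] FockSpace S) : Prop where
  apply_mul : ∀ u v, (T (fockVec v)) (u * v) = (T (fockVec 1)) u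
  apply_eq_zero : ∀ w v, (∀ u, w ≠ u * v) → (T (fockVec v)) w = 0

theorem IsToeplitz.add {A B : FockSpace S →L[ℂ] FockSpace S} (hA : IsToeplitz A)
    (hB : IsToeplitz B) : IsToeplitz (A + B) where
  apply_mul u v := congrArg₂ (· + ·) (hA.apply_mul u v) (hB.apply_mul u v)
  apply_eq_zero w v h := by
    simpa using congrArg₂ (· + ·) (hA.apply_eq_zero w v h) (hB.apply_eq_zero w v h)

theorem IsToeplitz.smul {A : FockSpace S →L[ℂ] FockSpace S} (c : ℂ) (hA : IsToeplitz A) :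
    IsToeplitz (c • A) where
  apply_mul u v := congrArg (c • ·) (hA.apply_mul u v)
  apply_eq_zero w v h := by simpa using congrArg (c • ·) (hA.apply_eq_zero w v h)

theorem isToeplitz_zero : IsToeplitz (0 : FockSpace S →L[ℂ] FockSpace S) :=
  ⟨fun _ _ => rfl, fun _ _ _ => rfl⟩

theorem IsToeplitz.ext {A B : FockSpace S →L[ℂ] FockSpace S} (hA : IsToeplitz A)
    (hB : IsToeplitz B) (h : A (fockVec 1) = B (fockVec 1)) : A = B := by
  refine fock_op_ext fun w v => ?_
  by_cases hw : ∃ u, w = u * v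
  · obtain ⟨u, rfl⟩ := hw
    rw [hA.apply_mul, hB.apply_mul, h]
  · push Not at hw
    rw [hA.apply_eq_zero w v hw, hB.apply_eq_zero w v hw]

variable [IsCancelMul S]

theorem leftShift_one : leftShift (1 : S) = 1 :=
  fock_clm_ext fun w => by rw [leftShift_fockVec, one_mul]; rfl

theorem leftShift_mul (u v : S) : leftShift (u * v) = leftShift u * leftShift v :=
  fock_clm_ext fun w => by
    rw [mul_apply_eq_comp, leftShift_fockVec, leftShift_fockVec, leftShift_fockVec,
      mul_assoc]

theorem leftShift_fockVec_one (u : S) : leftShift u (fockVec 1) = fockVec u := by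
  rw [leftShift_fockVec, mul_one]

theorem norm_leftShift_le (u : S) : ‖(leftShift u : FockSpace S →L[ℂ] FockSpace S)‖ ≤ 1 :=
  LinearIsometry.norm_toContinuousLinearMap_le _

theorem leftShift_apply_mul (u w : S) (f : FockSpace S) : leftShift u f (u * w) = f w := by
  have : (coord (u * w)).comp (leftShift u) = coord w := fock_clm_ext fun v => by
    classical
    simp only [ContinuousLinearMap.comp_apply, coord_apply, leftShift_fockVec, fockVec_apply,
      mul_right_inj]
  exact DFunLike.congr_fun this f

theorem leftShift_apply_of_ne {u w : S} (h : ∀ v, w ≠ u * v) (f : FockSpace S) :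
    leftShift u f w = 0 := by
  have : (coord w).comp (leftShift u) = 0 := fock_clm_ext fun v => by
    simp only [ContinuousLinearMap.comp_apply, coord_apply, leftShift_fockVec]
    exact fockVec_apply_of_ne (h v)
  exact DFunLike.congr_fun this f

theorem adjoint_leftShift_apply (u w : S) (f : FockSpace S) :
    (leftShift u).adjoint f w = f (u * w) := by
  rw [← inner_fockVec_left, ContinuousLinearMap.adjoint_inner_right, leftShift_fockVec,
    inner_fockVec_left]

theorem shiftAlgebra_toSubmodule :
    Subalgebra.toSubmodule (shiftAlgebra S) =
      Submodule.span ℂ (Set.range (leftShift : S → FockSpace S →L[ℂ] FockSpace S)) := by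
  let φ : S →* (FockSpace S →L[ℂ] FockSpace S) := ⟨⟨leftShift, leftShift_one⟩, leftShift_mul⟩
  have : Set.range (leftShift : S → FockSpace S →L[ℂ] FockSpace S) = (MonoidHom.mrange φ : Set _) :=
    rfl
  rw [shiftAlgebra, Algebra.adjoin_eq_span, this, Submonoid.closure_eq]

theorem shiftAlgebra_induction {P : (FockSpace S →L[ℂ] FockSpace S) → Prop}
    (shift : ∀ u, P (leftShift u)) (zero : P 0) (add : ∀ A B, P A → P B → P (A + B))
    (smul : ∀ (c : ℂ) A, P A → P (c • A)) {A : FockSpace S →L[ℂ] FockSpace S}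
    (hA : A ∈ shiftAlgebra S) : P A := by
  rw [← Subalgebra.mem_toSubmodule, shiftAlgebra_toSubmodule] at hA
  refine Submodule.span_induction ?_ zero (fun A B _ _ => add A B) (fun c A _ => smul c A) hA
  rintro _ ⟨u, rfl⟩
  exact shift u

theorem isToeplitz_leftShift (u : S) : IsToeplitz (leftShift u) where
  apply_mul w v := by
    classical
    rw [leftShift_fockVec, leftShift_fockVec_one, fockVec_apply, fockVec_apply]
    simp
  apply_eq_zero w v h := by
    rw [leftShift_fockVec]
    exact fockVec_apply_of_ne (h u)

theorem mem_weakToeplitz_iff {T : FockSpace S →L[ℂ] FockSpace S} :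
    T ∈ weakToeplitz S ↔ ContinuousLinearMapWOT.ofCLM T ∈
      closure {A : FockSpace S →WOT[ℂ] FockSpace S | A.toCLM ∈ shiftAlgebra S} := by
  constructor
  · rintro ⟨A, hA, rfl⟩
    exact hA
  · intro h
    exact ⟨ContinuousLinearMapWOT.ofCLM T, h, rfl⟩

theorem shiftAlgebra_le_weakToeplitz : shiftAlgebra S ≤ weakToeplitz S := fun _ hA =>
  mem_weakToeplitz_iff.mpr (subset_closure hA)

theorem isClosed_weakToeplitz : IsClosed (weakToeplitz S : Set (FockSpace S →L[ℂ] FockSpace S)) := by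
  have : (weakToeplitz S : Set (FockSpace S →L[ℂ] FockSpace S)) = ContinuousLinearMapWOT.ofCLM ⁻¹'
      closure {A : FockSpace S →WOT[ℂ] FockSpace S | A.toCLM ∈ shiftAlgebra S} :=
    Set.ext fun T => mem_weakToeplitz_iff
  rw [this]
  exact isClosed_closure.preimage ContinuousLinearMapWOT.continuous_ofCLM

theorem normToeplitz_le_weakToeplitz : normToeplitz S ≤ weakToeplitz S :=
  Subalgebra.topologicalClosure_minimal shiftAlgebra_le_weakToeplitz isClosed_weakToeplitz

theorem leftShift_mem_shiftAlgebra (u : S) : leftShift u ∈ shiftAlgebra S :=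
  Algebra.subset_adjoin ⟨u, rfl⟩

theorem leftShift_mem_weakToeplitz (u : S) : leftShift u ∈ weakToeplitz S :=
  shiftAlgebra_le_weakToeplitz (leftShift_mem_shiftAlgebra u)

theorem isToeplitz_of_mem_weakToeplitz {T : FockSpace S →L[ℂ] FockSpace S}
    (hT : T ∈ weakToeplitz S) : IsToeplitz T := by
  have hcont : ∀ w v : S,
      Continuous fun A : FockSpace S →WOT[ℂ] FockSpace S => (A (fockVec v)) w := fun w v =>
    ContinuousLinearMapWOT.continuous_dual_apply (fockVec v) (coord w)
  have hcl : IsClosed {A : FockSpace S →WOT[ℂ] FockSpace S | IsToeplitz A.toCLM} := by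
    have : {A : FockSpace S →WOT[ℂ] FockSpace S | IsToeplitz A.toCLM} =
        {A | ∀ u v, (A (fockVec v)) (u * v) = (A (fockVec 1)) u} ∩
        {A | ∀ w v, (∀ u, w ≠ u * v) → (A (fockVec v)) w = 0} :=
      Set.ext fun A => ⟨fun h => ⟨h.1, h.2⟩, fun h => ⟨h.1, h.2⟩⟩
    rw [this]
    simp only [Set.ofPred_forall]
    refine IsClosed.inter (isClosed_iInter fun u => isClosed_iInter fun v =>
      isClosed_eq (hcont _ _) (hcont _ _)) (isClosed_iInter fun u => isClosed_iInter fun v =>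
      isClosed_iInter fun _ => isClosed_eq (hcont _ _) continuous_const)
  refine closure_minimal (fun A hA => ?_) hcl (mem_weakToeplitz_iff.mp hT)
  exact shiftAlgebra_induction (P := IsToeplitz) isToeplitz_leftShift isToeplitz_zero
    (fun A B hA hB => hA.add hB) (fun c A hA => hA.smul c) hA

end Toeplitz

/-! ### Degrees and factorizations of length two -/

namespace PermSet

variable {k : ℕ} {n : Fin k → ℕ}

/-- The number of letters of block `i` in an element of `𝔽⁺_θ`. -/
def blockDeg (θ : PermSet n) (i : Fin k) (w : Semigp θ) : ℕ :=
  Multiset.count i (Multiplicative.toAdd (deg θ w))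

/-- The number of letters of an element of `𝔽⁺_θ`. -/
def length (θ : PermSet n) (w : Semigp θ) : ℕ :=
  Multiset.card (Multiplicative.toAdd (deg θ w))

section Degree

variable {θ : PermSet n}

theorem blockDeg_one (i : Fin k) : blockDeg θ i 1 = 0 := by simp [blockDeg]

theorem blockDeg_mul (i : Fin k) (u v : Semigp θ) :
    blockDeg θ i (u * v) = blockDeg θ i u + blockDeg θ i v := by simp [blockDeg]

theorem blockDeg_gen (i : Fin k) (x : Gen n) :
    blockDeg θ i (gen θ x) = if x.1 = i then 1 else 0 := by
  simp [blockDeg, deg_gen, Multiset.count_singleton, eq_comm]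

theorem length_one : length θ 1 = 0 := by simp [length]

theorem length_mul (u v : Semigp θ) : length θ (u * v) = length θ u + length θ v := by
  simp [length]

theorem length_gen (x : Gen n) : length θ (gen θ x) = 1 := by simp [length, deg_gen]

theorem eq_one_or_exists_gen_mul (w : Semigp θ) : w = 1 ∨ ∃ x u, w = gen θ x * u := by
  induction w using induction_gen with
  | one => exact Or.inl rfl
  | mul x u _ => exact Or.inr ⟨x, u, rfl⟩

theorem eq_one_of_length {w : Semigp θ} (h : length θ w = 0) : w = 1 := by
  obtain rfl | ⟨x, u, rfl⟩ := eq_one_or_exists_gen_mul w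
  · rfl
  · rw [length_mul, length_gen] at h
    omega

theorem exists_gen_of_length {w : Semigp θ} (h : length θ w = 1) : ∃ x, w = gen θ x := by
  obtain rfl | ⟨x, u, rfl⟩ := eq_one_or_exists_gen_mul w
  · rw [length_one] at h
    omega
  · rw [length_mul, length_gen] at h
    have hu : u = 1 := eq_one_of_length (by omega)
    exact ⟨x, by rw [hu, mul_one]⟩

/-- A letter of block `i` can be moved to the front of any element in which block `i` occurs. -/
theorem exists_gen_mul_of_blockDeg {i : Fin k} {w : Semigp θ} (h : blockDeg θ i w ≠ 0) :
    ∃ (p : Fin (n i)) (u : Semigp θ), w = gen θ ⟨i, p⟩ * u := by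
  have hi : i ∈ Multiplicative.toAdd (deg θ w) := Multiset.count_ne_zero.mp h
  obtain ⟨s, hs⟩ := Multiset.exists_cons_of_mem hi
  induction s using Quotient.inductionOn with
  | h c =>
    obtain ⟨v, rfl⟩ := exists_word_of_deg (c := i :: c) (u := w)
      (Multiplicative.toAdd.injective hs)
    exact ⟨v.1, Word.val θ v.2, rfl⟩

theorem gen_ne_one (x : Gen n) : gen θ x ≠ 1 := fun h => by
  have := length_gen (θ := θ) x
  rw [h, length_one] at this
  omega

theorem finite_length_lt (M : ℕ) : {w : Semigp θ | length θ w < M}.Finite := by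
  have h : ∀ l : List (Gen n), length θ (l.map (gen θ)).prod = l.length := by
    intro l
    induction l with
    | nil => exact length_one
    | cons x l ih => rw [List.map_cons, List.prod_cons, length_mul, length_gen, ih,
        List.length_cons, add_comm]
  refine ((List.finite_length_lt (Gen n) M).image fun l => (l.map (gen θ)).prod).subset ?_
  intro w hw
  have : ∃ l : List (Gen n), (l.map (gen θ)).prod = w := by
    clear hw
    induction w using induction_gen with
    | one => exact ⟨[], rfl⟩
    | mul x u ih =>
      obtain ⟨l, rfl⟩ := ih
      exact ⟨x :: l, rfl⟩
  obtain ⟨l, rfl⟩ := this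
  refine ⟨l, ?_, rfl⟩
  rw [Set.mem_ofPred_eq, h] at hw
  exact hw

variable [IsCancelMul (Semigp θ)]

theorem gen_injective : Function.Injective (gen θ) := by
  rintro ⟨i, p⟩ ⟨j, q⟩ h
  have h1 := congrArg (deg θ) h
  rw [deg_gen, deg_gen] at h1
  obtain rfl : i = j := Multiset.singleton_inj.mp (Multiplicative.ofAdd.injective h1)
  have h2 : gen θ ⟨i, p⟩ * 1 = gen θ ⟨i, q⟩ * 1 := by rw [h]
  rw [(gen_mul_inj.mp h2).1]

/-- The factorizations of an element of degree `(i, j)` into two generators. -/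
theorem gen_mul_gen_eq_iff {i j : Fin k} (h : i ≠ j) (p : Fin (n i)) (q : Fin (n j))
    (x y : Gen n) : gen θ x * gen θ y = gen θ ⟨i, p⟩ * gen θ ⟨j, q⟩ ↔
      (x = ⟨i, p⟩ ∧ y = ⟨j, q⟩) ∨
      (x = ⟨j, (θ.perm i j h (p, q)).2⟩ ∧ y = ⟨i, (θ.perm i j h (p, q)).1⟩) := by
  constructor
  · intro hxy
    have h1 := congrArg (blockDeg θ x.1) hxy
    simp only [blockDeg_mul, blockDeg_gen, if_true] at h1
    obtain ⟨a, r⟩ := x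
    by_cases ha : i = a
    · subst ha
      obtain ⟨rfl, h2⟩ := gen_mul_inj.mp hxy
      exact Or.inl ⟨rfl, gen_injective h2⟩
    · have hj : j = a := by
        by_contra hj
        simp only [if_neg ha, if_neg hj] at h1
        omega
      subst hj
      rw [gen_mul_gen_perm θ h] at hxy
      obtain ⟨rfl, h2⟩ := gen_mul_inj.mp hxy
      exact Or.inr ⟨rfl, gen_injective h2⟩
  · rintro (⟨rfl, rfl⟩ | ⟨rfl, rfl⟩)
    · rfl
    · rw [gen_mul_gen_perm θ h]

theorem gen_mul_gen_eq_iff_same (i : Fin k) (p q : Fin (n i)) (x y : Gen n) :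
    gen θ x * gen θ y = gen θ ⟨i, p⟩ * gen θ ⟨i, q⟩ ↔ x = ⟨i, p⟩ ∧ y = ⟨i, q⟩ := by
  constructor
  · intro hxy
    have h1 := congrArg (blockDeg θ x.1) hxy
    simp only [blockDeg_mul, blockDeg_gen, if_true] at h1
    obtain ⟨a, r⟩ := x
    have ha : i = a := by
      by_contra ha
      simp only [if_neg ha] at h1
      omega
    subst ha
    obtain ⟨rfl, h2⟩ := gen_mul_inj.mp hxy
    exact ⟨rfl, gen_injective h2⟩
  · rintro ⟨rfl, rfl⟩
    rfl

theorem adjoint_gen_comp_gen (i : Fin k) (p q : Fin (n i)) (f : FockSpace (Semigp θ)) :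
    (leftShift (gen θ ⟨i, p⟩)).adjoint (leftShift (gen θ ⟨i, q⟩) f) = if p = q then f else 0 := by
  refine lp.ext (funext fun w => ?_)
  rw [adjoint_leftShift_apply]
  split_ifs with h
  · rw [h, leftShift_apply_mul]
  · exact leftShift_apply_of_ne (fun v hv => h (gen_mul_inj.mp hv).1) f

theorem inner_gen_gen (i : Fin k) (p q : Fin (n i)) (f g : FockSpace (Semigp θ)) :
    inner ℂ (leftShift (gen θ ⟨i, p⟩) f) (leftShift (gen θ ⟨i, q⟩) g) =
      if p = q then inner ℂ f g else 0 := by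
  rw [← ContinuousLinearMap.adjoint_inner_right, adjoint_gen_comp_gen]
  split_ifs <;> simp

/-- The generators of one block are isometries with orthogonal ranges. -/
theorem norm_sq_sum_gen (i : Fin k) (a : Fin (n i) → ℂ) (f : FockSpace (Semigp θ)) :
    ‖(∑ p, a p • leftShift (gen θ ⟨i, p⟩)) f‖ ^ 2 = (∑ p, ‖a p‖ ^ 2) * ‖f‖ ^ 2 := by
  have h : (((‖(∑ p, a p • leftShift (gen θ ⟨i, p⟩)) f‖ ^ 2 : ℝ)) : ℂ) =
      (((∑ p, ‖a p‖ ^ 2) * ‖f‖ ^ 2 : ℝ) : ℂ) := by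
    rw [Complex.ofReal_pow, Complex.ofReal_mul, Complex.ofReal_sum, Complex.ofReal_pow]
    simp only [Complex.ofReal_pow]
    have h1 := inner_self_eq_norm_sq_to_K (𝕜 := ℂ) ((∑ p, a p • leftShift (gen θ ⟨i, p⟩)) f)
    have h2 := inner_self_eq_norm_sq_to_K (𝕜 := ℂ) f
    simp only [RCLike.ofReal_eq_complex_ofReal] at h1 h2
    rw [← h1, ← h2]
    simp only [sum_apply, smul_apply, sum_inner,
      inner_sum, inner_smul_left, inner_smul_right, inner_gen_gen, mul_ite, mul_zero,
      Finset.sum_mul]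
    refine Finset.sum_congr rfl fun p _ => ?_
    rw [Finset.sum_ite_eq' Finset.univ p, if_pos (Finset.mem_univ p), ← mul_assoc,
      Complex.mul_conj']
  exact_mod_cast h

theorem norm_sum_gen_le (i : Fin k) (a : Fin (n i) → ℂ) :
    ‖(∑ p, a p • leftShift (gen θ ⟨i, p⟩) : FockSpace (Semigp θ) →L[ℂ] FockSpace (Semigp θ))‖ ≤
      √(∑ p, ‖a p‖ ^ 2) := by
  refine ContinuousLinearMap.opNorm_le_bound _ (Real.sqrt_nonneg _) fun f => ?_
  refine le_of_sq_le_sq ?_ (by positivity)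
  rw [norm_sq_sum_gen, mul_pow, Real.sq_sqrt (Finset.sum_nonneg fun p _ => by positivity)]

end Degree

/-! ### The weakly closed algebra consists of all analytic Toeplitz operators -/

section Weak

/-- A bounded sequence of functionals that converges on the basis vectors converges pointwise. -/
theorem tendsto_of_bounded_of_basis {S : Type} {φ : ℕ → FockSpace S →L[ℂ] ℂ}
    {ψ : FockSpace S →L[ℂ] ℂ} {C : ℝ} (hC : ∀ m, ‖φ m‖ ≤ C) (hψ : ‖ψ‖ ≤ C)
    (h : ∀ w, Filter.Tendsto (fun m => φ m (fockVec w)) Filter.atTop (nhds (ψ (fockVec w))))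
    (f : FockSpace S) : Filter.Tendsto (fun m => φ m f) Filter.atTop (nhds (ψ f)) := by
  classical
  have hC0 : 0 ≤ C := (norm_nonneg _).trans hψ
  rw [Metric.tendsto_atTop]
  intro ε hε
  have hδ : 0 < ε / (3 * (C + 1)) := by positivity
  obtain ⟨s, hs⟩ := ((Metric.tendsto_nhds.mp (hasSum_fockVec f)) _ hδ).exists
  set g := ∑ w ∈ s, f w • fockVec w with hg
  have hgt : Filter.Tendsto (fun m => φ m g) Filter.atTop (nhds (ψ g)) := by
    simp only [hg, map_sum, map_smul]
    exact tendsto_finsetSum _ fun w _ => (h w).const_smul (f w)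
  obtain ⟨m₀, hm₀⟩ := (Metric.tendsto_atTop.mp hgt) (ε / 3) (by positivity)
  refine ⟨m₀, fun m hm => ?_⟩
  have h1 : ∀ χ : FockSpace S →L[ℂ] ℂ, ‖χ‖ ≤ C → dist (χ g) (χ f) ≤ ε / 3 := by
    intro χ hχ
    rw [dist_eq_norm, ← map_sub]
    rw [dist_eq_norm] at hs
    calc ‖χ (g - f)‖ ≤ ‖χ‖ * ‖g - f‖ := χ.le_opNorm _
      _ ≤ (C + 1) * (ε / (3 * (C + 1))) := by gcongr; linarith
      _ = ε / 3 := by field_simp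
  have h2 := h1 _ (hC m)
  have h3 := h1 _ hψ
  rw [dist_comm] at h2
  have h4 := hm₀ m hm
  calc dist (φ m f) (ψ f) ≤ dist (φ m f) (φ m g) + dist (φ m g) (ψ g) + dist (ψ g) (ψ f) :=
        dist_triangle4 _ _ _ _
    _ < ε := by linarith

variable {θ : PermSet n} [IsCancelMul (Semigp θ)]

/-- The Fejér means of an analytic Toeplitz operator with respect to the length of words: the Schur
multiplier with entries `max (1 - (|v| - |w|) / M) 0`, the normalized size of the intersection of two
intervals of `M` integers starting at `|v|` and `|w|`. -/
theorem exists_fejer_mean {T : FockSpace (Semigp θ) →L[ℂ] FockSpace (Semigp θ)}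
    (hT : IsToeplitz T) {M : ℕ} (hM : 0 < M) :
    ∃ A ∈ shiftAlgebra (Semigp θ), ‖A‖ ≤ ‖T‖ ∧ ∀ v w, (A (fockVec w)) v =
      ((M - (length θ v - length θ w) : ℕ) / M : ℂ) * (T (fockVec w)) v := by
  classical
  have hcard : ∀ a b : ℕ, b ≤ a →
      (Finset.Ico a (a + M) ∩ Finset.Ico b (b + M)).card = M - (a - b) := by
    intro a b hab
    rw [Finset.Ico_inter_Ico, Nat.card_Ico]
    simp only [max_def, min_def]
    split_ifs <;> omega
  obtain ⟨A, hA, hAe⟩ := exists_schur_multiplier T hM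
    (fun w => Finset.Ico (length θ w) (length θ w + M))
    (fun w => Finset.Ico (length θ w) (length θ w + M)) (by simp) (by simp)
  have hAe' : ∀ v w, (A (fockVec w)) v =
      ((M - (length θ v - length θ w) : ℕ) / M : ℂ) * (T (fockVec w)) v := by
    intro v w
    rw [hAe]
    by_cases hv : ∃ u, v = u * w
    · obtain ⟨u, rfl⟩ := hv
      rw [hcard]
      rw [length_mul]
      omega
    · push Not at hv
      rw [hT.apply_eq_zero v w hv, mul_zero, mul_zero]
  refine ⟨A, ?_, hA, hAe'⟩
  have hAT : IsToeplitz A := by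
    refine ⟨fun u v => ?_, fun w v h => ?_⟩
    · rw [hAe', hAe', hT.apply_mul, length_mul, length_one, Nat.add_sub_cancel, Nat.sub_zero]
    · rw [hAe', hT.apply_eq_zero w v h, mul_zero]
  have hsum : ∑ u ∈ (finite_length_lt (θ := θ) M).toFinset, (A (fockVec 1)) u • leftShift u ∈
      shiftAlgebra (Semigp θ) :=
    Subalgebra.sum_mem _ fun u _ => Subalgebra.smul_mem _ (leftShift_mem_shiftAlgebra u) _
  convert hsum using 1
  refine hAT.ext (isToeplitz_of_mem_weakToeplitz (shiftAlgebra_le_weakToeplitz hsum)) ?_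
  refine lp.ext (funext fun w => ?_)
  rw [← coord_apply w (_ : FockSpace (Semigp θ)), ← coord_apply w (_ : FockSpace (Semigp θ))]
  simp only [sum_apply, smul_apply, map_sum, map_smul,
    leftShift_fockVec_one, coord_apply, fockVec_apply, smul_eq_mul, mul_ite, mul_one, mul_zero]
  rw [Finset.sum_ite_eq]
  split_ifs with h
  · rfl
  · have h1 : M ≤ length θ w := by simpa using h
    rw [hAe', length_one, Nat.sub_zero, Nat.sub_eq_zero_of_le h1]
    simp

/-- An analytic Toeplitz operator is the limit of its Fejér means in the weak operator topology. -/
theorem mem_weakToeplitz_of_isToeplitz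
    {T : FockSpace (Semigp θ) →L[ℂ] FockSpace (Semigp θ)} (hT : IsToeplitz T) :
    T ∈ weakToeplitz (Semigp θ) := by
  choose A hA hAn hAe using fun m : ℕ => exists_fejer_mean hT (Nat.succ_pos m)
  refine mem_weakToeplitz_iff.mpr (mem_closure_of_tendsto (b := Filter.atTop)
    (f := fun m => ContinuousLinearMapWOT.ofCLM (A m)) ?_ (Filter.Eventually.of_forall hA))
  rw [ContinuousLinearMapWOT.tendsto_iff_forall_dual_apply_tendsto]
  intro f y
  have h1 : ∀ v w, Filter.Tendsto (fun m => (A m (fockVec w)) v) Filter.atTop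
      (nhds ((T (fockVec w)) v)) := by
    intro v w
    simp only [hAe]
    have h2 : Filter.Tendsto (fun m : ℕ => ((m.succ - (length θ v - length θ w) : ℕ) / m.succ : ℂ))
        Filter.atTop (nhds 1) := by
      have h3 := (tendsto_const_nhds (x := (1 : ℂ))).sub
        ((tendsto_const_div_atTop_nhds_zero_nat ((length θ v - length θ w : ℕ) : ℂ)).comp
          (Filter.tendsto_add_atTop_nat 1))
      rw [sub_zero] at h3
      refine h3.congr' ?_
      filter_upwards [Filter.eventually_ge_atTop (length θ v - length θ w)] with m hm
      have h4 : ((m : ℂ) + 1) ≠ 0 := by exact_mod_cast Nat.succ_ne_zero m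
      have h5 : length θ v - length θ w ≤ m.succ := hm.trans (Nat.le_succ m)
      simp only [Function.comp_apply]
      rw [Nat.cast_sub h5, Nat.cast_add, Nat.cast_one, sub_div, div_self h4]
    simpa using h2.mul_const ((T (fockVec w)) v)
  have h2 : ∀ v, Filter.Tendsto (fun m => (A m f) v) Filter.atTop (nhds ((T f) v)) := by
    intro v
    have hb : ∀ B : FockSpace (Semigp θ) →L[ℂ] FockSpace (Semigp θ), ‖B‖ ≤ ‖T‖ →
        ‖(coord v).comp B‖ ≤ ‖T‖ := by
      intro B hB
      refine ContinuousLinearMap.opNorm_le_bound _ (norm_nonneg _) fun g => ?_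
      exact (norm_apply_le v _).trans ((B.le_opNorm g).trans (by gcongr))
    exact tendsto_of_bounded_of_basis (φ := fun m => (coord v).comp (A m))
      (ψ := (coord v).comp T) (fun m => hb _ (hAn m)) (hb _ le_rfl) (fun w => h1 v w) f
  obtain ⟨g, rfl⟩ := (InnerProductSpace.toDual ℂ _).surjective y
  simp only [InnerProductSpace.toDual_apply_apply]
  have hb : ∀ B : FockSpace (Semigp θ) →L[ℂ] FockSpace (Semigp θ), ‖B‖ ≤ ‖T‖ →
      ‖innerSL ℂ (B f)‖ ≤ ‖T‖ * ‖f‖ := by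
    intro B hB
    rw [innerSL_apply_norm]
    exact (B.le_opNorm f).trans (by gcongr)
  have h3 := tendsto_of_bounded_of_basis (φ := fun m => innerSL ℂ (A m f))
    (ψ := innerSL ℂ (T f)) (fun m => hb _ (hAn m)) (hb _ le_rfl) (fun w => by
      simp only [innerSL_apply_apply]
      have h4 : ∀ B : FockSpace (Semigp θ) →L[ℂ] FockSpace (Semigp θ),
          inner ℂ (B f) (fockVec w) = starRingEnd ℂ ((B f) w) := fun B => by
        rw [← inner_conj_symm, inner_fockVec_left]
      simp only [h4]
      exact (Complex.continuous_conj.tendsto _).comp (h2 w)) g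
  have h5 := (Complex.continuous_conj.tendsto _).comp h3
  simp only [Function.comp_def, innerSL_apply_apply, inner_conj_symm] at h5
  exact h5

theorem mem_weakToeplitz_iff_isToeplitz
    {T : FockSpace (Semigp θ) →L[ℂ] FockSpace (Semigp θ)} :
    T ∈ weakToeplitz (Semigp θ) ↔ IsToeplitz T :=
  ⟨isToeplitz_of_mem_weakToeplitz, mem_weakToeplitz_of_isToeplitz⟩

end Weak

/-! ### Fourier coefficients of products -/

section Coefficients

variable {θ : PermSet n} {T : FockSpace (Semigp θ) →L[ℂ] FockSpace (Semigp θ)}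

/-- The functional `T ↦ (T ξ_1)(1)` is multiplicative on analytic Toeplitz operators. -/
theorem _root_.IsToeplitz.apply_one (hT : IsToeplitz T) (f : FockSpace (Semigp θ)) :
    (T f) 1 = (T (fockVec 1)) 1 * f 1 := by
  classical
  have : (coord 1).comp T = (T (fockVec 1)) 1 • coord 1 := fock_clm_ext fun v => by
    simp only [ContinuousLinearMap.comp_apply, smul_apply, coord_apply,
      smul_eq_mul, fockVec_apply]
    split_ifs with h
    · rw [← h, mul_one]
    · rw [mul_zero]
      refine hT.apply_eq_zero _ _ fun u hu => h ?_
      have h1 := congrArg (length θ) hu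
      rw [length_one, length_mul] at h1
      exact (eq_one_of_length (by omega)).symm
  exact DFunLike.congr_fun this f

/-- The first order coefficients of a product obey the Leibniz rule. -/
theorem _root_.IsToeplitz.apply_gen (hT : IsToeplitz T) (f : FockSpace (Semigp θ)) (y : Gen n) :
    (T f) (gen θ y) = (T (fockVec 1)) 1 * f (gen θ y) + (T (fockVec 1)) (gen θ y) * f 1 := by
  classical
  have : (coord (gen θ y)).comp T = (T (fockVec 1)) 1 • coord (gen θ y) +
      (T (fockVec 1)) (gen θ y) • coord 1 := fock_clm_ext fun v => by
    simp only [ContinuousLinearMap.comp_apply, smul_apply, coord_apply,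
      smul_eq_mul, fockVec_apply, add_apply]
    by_cases hv : v = 1
    · subst hv
      simp [gen_ne_one]
    · by_cases hy : gen θ y = v
      · subst hy
        have := hT.apply_mul 1 (gen θ y)
        rw [one_mul] at this
        simp [this, Ne.symm hv]
      · rw [if_neg hy, if_neg (Ne.symm hv), mul_zero, mul_zero, add_zero]
        refine hT.apply_eq_zero _ _ fun u hu => ?_
        have h1 := congrArg (length θ) hu
        rw [length_gen, length_mul] at h1
        have : length θ v ≠ 0 := fun h => hv (eq_one_of_length h)
        have hu1 : u = 1 := eq_one_of_length (by omega)
        rw [hu1, one_mul] at hu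
        exact hy hu
  exact DFunLike.congr_fun this f

variable [IsCancelMul (Semigp θ)]

open Classical in
/-- The coefficients of `T f` at elements of length two, by the convolution formula. -/
theorem _root_.IsToeplitz.apply_of_length_two (hT : IsToeplitz T) (f : FockSpace (Semigp θ))
    {w : Semigp θ} (hw : length θ w = 2) :
    (T f) w = (T (fockVec 1)) 1 * f w +
      (∑ x, ∑ y, if gen θ x * gen θ y = w then (T (fockVec 1)) (gen θ x) * f (gen θ y) else 0) +
      (T (fockVec 1)) w * f 1 := by
  have : (coord w).comp T = (T (fockVec 1)) 1 • coord w +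
      (∑ x, ∑ y, if gen θ x * gen θ y = w then (T (fockVec 1)) (gen θ x) • coord (gen θ y)
        else 0) + (T (fockVec 1)) w • coord 1 := fock_clm_ext fun v => by
    have hite : ∀ (c : Prop) [Decidable c] (φ : FockSpace (Semigp θ) →L[ℂ] ℂ) (g),
        (if c then φ else 0) g = if c then φ g else 0 := by
      intro c _ φ g
      split_ifs <;> rfl
    simp only [ContinuousLinearMap.comp_apply, smul_apply, coord_apply,
      smul_eq_mul, fockVec_apply, add_apply, sum_apply,
      hite, mul_ite, mul_one, mul_zero]
    by_cases hv : ∃ u, w = u * v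
    · obtain ⟨u, rfl⟩ := hv
      rw [hT.apply_mul]
      rw [length_mul] at hw
      obtain hu | hu | hu : length θ u = 0 ∨ length θ u = 1 ∨ length θ u = 2 := by omega
      · obtain rfl := eq_one_of_length hu
        have hv1 : v ≠ 1 := by
          rintro rfl
          simp [length_one] at hw
        have hvg : ∀ y, gen θ y ≠ v := by
          rintro y rfl
          rw [length_gen] at hw
          omega
        simp [Ne.symm hv1, hvg]
      · obtain ⟨x, rfl⟩ := exists_gen_of_length hu
        obtain ⟨y, rfl⟩ := exists_gen_of_length (w := v) (by omega)
        have h1 : gen θ x * gen θ y ≠ gen θ y := fun h => by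
          have := congrArg (length θ) h
          rw [length_mul, length_gen, length_gen] at this
          omega
        rw [if_neg h1, if_neg (Ne.symm (gen_ne_one y)), zero_add, add_zero]
        symm
        rw [Finset.sum_eq_single x, Finset.sum_eq_single y]
        · simp
        · intro y' _ hy'
          rw [if_neg (fun h => hy' (gen_injective h))]
          simp
        · simp
        · intro x' _ hx'
          refine Finset.sum_eq_zero fun y' _ => ?_
          by_cases hy' : gen θ y' = gen θ y
          · rw [hy', if_neg]
            exact fun h => hx' (gen_injective (mul_right_cancel h))
          · simp [hy']
        · simp
      · obtain rfl := eq_one_of_length (w := v) (by omega)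
        have hu1 : u ≠ 1 := by
          rintro rfl
          rw [length_one] at hu
          omega
        simp [gen_ne_one, hu1]
    · push Not at hv
      rw [hT.apply_eq_zero w v hv]
      have h1 : w ≠ v := fun h => hv 1 (by rw [one_mul, h])
      have h2 : (1 : Semigp θ) ≠ v := fun h => hv w (by rw [← h, mul_one])
      rw [if_neg h1, if_neg h2, zero_add, add_zero]
      symm
      refine Finset.sum_eq_zero fun x _ => Finset.sum_eq_zero fun y _ => ?_
      split_ifs with h3 h4
      · exact absurd (by rw [← h3, h4]) (hv (gen θ x))
      · rfl
      · rfl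
  have h := DFunLike.congr_fun this f
  have hite : ∀ (c : Prop) [Decidable c] (φ : FockSpace (Semigp θ) →L[ℂ] ℂ) (g),
      (if c then φ else 0) g = if c then φ g else 0 := by
    intro c _ φ g
    split_ifs <;> rfl
  simpa only [ContinuousLinearMap.comp_apply, smul_apply, coord_apply,
      smul_eq_mul, add_apply, sum_apply, hite] using h

end Coefficients

end PermSet

/-! ### The Gelfand space -/

namespace PermSet

variable {k : ℕ} {n : Fin k → ℕ}

/-- The points at which the (commutative) coordinates satisfy the relations of `𝔽⁺_θ`. -/
def relationCone (θ : PermSet n) : Set (∀ i : Fin k, Fin (n i) → ℂ) :=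
  {z | ∀ (i j : Fin k) (h : i < j) (p : Fin (n i)) (q : Fin (n j)),
    z i p * z j q = z j (θ i j h (p, q)).2 * z i (θ i j h (p, q)).1}

variable {θ : PermSet n}

/-- The union of the coordinate subspaces and of the product of the diagonals. -/
def minimalCone (n : Fin k → ℕ) : Set (∀ i : Fin k, Fin (n i) → ℂ) :=
  {z | (∃ j, ∀ i, i ≠ j → z i = 0) ∨ ∀ i p q, z i p = z i q}

theorem minimalCone_subset_relationCone : minimalCone n ⊆ relationCone θ := by
  rintro z (⟨l, hl⟩ | hz) i j h p q
  · by_cases hi : i = l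
    · have hj : z j = 0 := hl j fun hj => h.ne (hi.trans hj.symm)
      simp [hj]
    · simp [hl i hi]
  · rw [hz i p (θ i j h (p, q)).1, hz j q (θ i j h (p, q)).2, mul_comm]

theorem smul_mem_relationCone {z : ∀ i : Fin k, Fin (n i) → ℂ} (hz : z ∈ relationCone θ) (c : ℂ) :
    c • z ∈ relationCone θ := fun i j h p q => by
  simp only [Pi.smul_apply, smul_eq_mul]
  linear_combination c * c * hz i j h p q

/-- The multiplicative functional on `𝔽⁺_θ` defined by a point of the relation cone. -/
def evalHom {z : ∀ i : Fin k, Fin (n i) → ℂ} (hz : z ∈ relationCone θ) : Semigp θ →* ℂ :=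
  PresentedMonoid.lift (fun x => z x.1 x.2) (by
    rintro _ _ ⟨i, j, h, p, q⟩
    simp only [map_mul, FreeMonoid.lift_eval_of]
    exact hz i j h p q)

theorem evalHom_gen {z : ∀ i : Fin k, Fin (n i) → ℂ} (hz : z ∈ relationCone θ) (x : Gen n) :
    evalHom hz (gen θ x) = z x.1 x.2 := rfl

theorem sum_word_evalHom {z : ∀ i : Fin k, Fin (n i) → ℂ} (hz : z ∈ relationCone θ) :
    ∀ c : List (Fin k), ∑ w : Word n c, ‖evalHom hz (w.val θ)‖ ^ 2 =
      (c.map fun i => ∑ p, ‖z i p‖ ^ 2).prod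
  | [] => by
    change ∑ w : PUnit, ‖evalHom hz 1‖ ^ 2 = _
    simp
  | a :: c => by
    change ∑ w : Fin (n a) × Word n c, ‖evalHom hz (gen θ ⟨a, w.1⟩ * w.2.val θ)‖ ^ 2 = _
    simp only [map_mul, norm_mul, mul_pow, evalHom_gen]
    rw [Fintype.sum_prod_type, List.map_cons, List.prod_cons, ← sum_word_evalHom hz c,
      Finset.sum_mul_sum]

/-- The elements of degree `e` are among the values of the words with one fixed block sequence, so that
the sum is dominated by a product of `k` geometric series. -/
theorem summable_evalHom {z : ∀ i : Fin k, Fin (n i) → ℂ} (hz : z ∈ relationCone θ) {t : ℝ}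
    (ht : t < 1) (ht0 : 0 ≤ t) (h : ∀ i, ∑ p, ‖z i p‖ ^ 2 ≤ t) :
    Summable fun w => ‖evalHom hz w‖ ^ 2 := by
  classical
  refine summable_of_sum_le (c := (1 - t)⁻¹ ^ k) (fun w => by positivity) fun s => ?_
  let d : Semigp θ → Multiset (Fin k) := fun w => Multiplicative.toAdd (deg θ w)
  rw [← Finset.sum_fiberwise_of_maps_to (s := s) (t := s.image d) (g := d)
    (fun w hw => Finset.mem_image_of_mem d hw)]
  have h1 : ∀ e ∈ s.image d, ∑ w ∈ s with d w = e, ‖evalHom hz w‖ ^ 2 ≤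
      ∏ i, t ^ (Multiset.count i e) := by
    intro e _
    have h2 : ∑ w ∈ s with d w = e, ‖evalHom hz w‖ ^ 2 ≤
        ∑ w ∈ Finset.univ.image (Word.val θ : Word n e.toList → Semigp θ),
          ‖evalHom hz w‖ ^ 2 := by
      refine Finset.sum_le_sum_of_subset_of_nonneg (fun w hw => ?_) fun _ _ _ => by positivity
      obtain ⟨-, hw⟩ := Finset.mem_filter.mp hw
      have hw' : deg θ w = Multiplicative.ofAdd ((e.toList : List (Fin k)) :
          Multiset (Fin k)) := by
        rw [Multiset.coe_toList, ← hw]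
        rfl
      obtain ⟨v, rfl⟩ := exists_word_of_deg hw'
      exact Finset.mem_image_of_mem _ (Finset.mem_univ v)
    refine h2.trans ((Finset.sum_image_le_of_nonneg fun _ _ => by positivity).trans ?_)
    rw [sum_word_evalHom]
    have h3 : ∀ c : List (Fin k), (c.map fun i => ∑ p, ‖z i p‖ ^ 2).prod ≤ t ^ c.length := by
      intro c
      induction c with
      | nil => simp
      | cons a c ih =>
        rw [List.map_cons, List.prod_cons, List.length_cons, pow_succ']
        refine mul_le_mul (h a) ih (List.prod_nonneg ?_) ht0
        intro x hx
        obtain ⟨i, -, rfl⟩ := List.mem_map.mp hx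
        positivity
    refine (h3 _).trans (le_of_eq ?_)
    rw [Finset.prod_pow_eq_pow_sum, Multiset.length_toList,
      Multiset.sum_count_eq_card fun a _ => Finset.mem_univ a]
  refine (Finset.sum_le_sum h1).trans ?_
  obtain ⟨M, hM⟩ : ∃ M : ℕ, ∀ e ∈ s.image d, ∀ i, Multiset.count i e < M := by
    refine ⟨(s.image d).sup Multiset.card + 1, fun e he i => ?_⟩
    exact Nat.lt_succ_of_le ((Multiset.count_le_card _ _).trans (Finset.le_sup he))
  calc ∑ e ∈ s.image d, ∏ i, t ^ (Multiset.count i e)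
      = ∑ f ∈ (s.image d).image fun e i => Multiset.count i e, ∏ i, t ^ (f i) := by
        refine (Finset.sum_image (f := fun f : Fin k → ℕ => ∏ i, t ^ f i)
          (g := fun (e : Multiset (Fin k)) i => Multiset.count i e) ?_).symm
        exact fun e _ e' _ he => Multiset.ext.mpr fun a => congrFun he a
    _ ≤ ∑ f ∈ Fintype.piFinset fun _ : Fin k => Finset.range M, ∏ i, t ^ (f i) := by
        refine Finset.sum_le_sum_of_subset_of_nonneg (fun f hf => ?_) fun _ _ _ => by positivity
        obtain ⟨e, he, rfl⟩ := Finset.mem_image.mp hf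
        exact Fintype.mem_piFinset.mpr fun i => Finset.mem_range.mpr (hM e he i)
    _ = ∏ _i : Fin k, ∑ j ∈ Finset.range M, t ^ j := by
        rw [Finset.prod_univ_sum]
    _ ≤ (1 - t)⁻¹ ^ k := by
        rw [Finset.prod_const, Finset.card_univ, Fintype.card_fin]
        gcongr
        rw [← tsum_geometric_of_lt_one ht0 ht]
        exact (summable_geometric_of_lt_one ht0 ht).sum_le_tsum _ fun _ _ => by positivity

/-- An interior point of the relation cone is a joint eigenvalue of the adjoints of the left
shifts. -/
theorem exists_eval_functional {z : ∀ i : Fin k, Fin (n i) → ℂ} (hz : z ∈ relationCone θ) {t : ℝ}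
    (ht : t < 1) (ht0 : 0 ≤ t) (h : ∀ i, ∑ p, ‖z i p‖ ^ 2 ≤ t) :
    ∃ φ : FockSpace (Semigp θ) →L[ℂ] ℂ, ∀ w, φ (fockVec w) = evalHom hz w := by
  have hmem : Memℓp (fun w : Semigp θ => starRingEnd ℂ (evalHom hz w)) 2 := by
    refine memℓp_gen ?_
    simpa using summable_evalHom hz ht ht0 h
  refine ⟨innerSL ℂ (⟨_, hmem⟩ : FockSpace (Semigp θ)), fun w => ?_⟩
  rw [innerSL_apply_apply, ← inner_conj_symm, inner_fockVec_left]
  exact Complex.conj_conj _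

variable [IsCancelMul (Semigp θ)]

instance : CompleteSpace (normToeplitz (Semigp θ)) :=
  (Subalgebra.isClosed_topologicalClosure _).completeSpace_coe

instance : NormOneClass (normToeplitz (Semigp θ)) := by
  have : Nontrivial (FockSpace (Semigp θ)) :=
    nontrivial_of_ne (fockVec 1) 0 fun h => by simpa [h] using norm_fockVec (1 : Semigp θ)
  exact ⟨ContinuousLinearMap.norm_id⟩

/-- The joint eigenvectors define characters at the interior points. -/
theorem mem_gelfandSpace_of_lt {z : ∀ i : Fin k, Fin (n i) → ℂ} (hz : z ∈ relationCone θ) {t : ℝ}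
    (ht : t < 1) (ht0 : 0 ≤ t) (h : ∀ i, ∑ p, ‖z i p‖ ^ 2 ≤ t) : z ∈ gelfandSpace θ := by
  obtain ⟨φ, hφ⟩ := exists_eval_functional hz ht ht0 h
  have key : ∀ X ∈ normToeplitz (Semigp θ), ∀ f, φ (X f) = φ (X (fockVec 1)) * φ f := by
    intro X hX
    have hcl : IsClosed {X : FockSpace (Semigp θ) →L[ℂ] FockSpace (Semigp θ) |
        ∀ f, φ (X f) = φ (X (fockVec 1)) * φ f} := by
      simp only [Set.ofPred_forall]
      exact isClosed_iInter fun f => isClosed_eq (by fun_prop) (by fun_prop)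
    have hX' : X ∈ closure (shiftAlgebra (Semigp θ) :
        Set (FockSpace (Semigp θ) →L[ℂ] FockSpace (Semigp θ))) := hX
    refine closure_minimal (fun A hA => ?_) hcl hX'
    refine shiftAlgebra_induction (P := fun X => ∀ f, φ (X f) = φ (X (fockVec 1)) * φ f)
      ?_ ?_ ?_ ?_ hA
    · intro u f
      have : φ.comp (leftShift u) = evalHom hz u • φ := fock_clm_ext fun w => by
        simp [leftShift_fockVec, hφ]
      rw [leftShift_fockVec_one, hφ]
      exact DFunLike.congr_fun this f
    · simp
    · intro A B hA hB f
      simp only [add_apply, map_add, hA f, hB f]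
      ring
    · intro c A hA f
      simp only [smul_apply, map_smul, hA f, smul_eq_mul]
      ring
  let ρ : normToeplitz (Semigp θ) →L[ℂ] ℂ :=
    (φ.comp (ContinuousLinearMap.apply ℂ _ (fockVec 1))).comp
      (Subalgebra.toSubmodule (normToeplitz (Semigp θ))).subtypeL
  have hρ : ∀ X, ρ X = φ ((X : FockSpace (Semigp θ) →L[ℂ] FockSpace (Semigp θ)) (fockVec 1)) :=
    fun X => rfl
  refine ⟨⟨StrongDual.toWeakDual ρ, ?_, ?_⟩, ?_⟩
  · intro h0
    have h1 : ρ 1 = 0 := DFunLike.congr_fun h0 1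
    rw [hρ] at h1
    have h2 : φ (fockVec 1) = 0 := h1
    rw [hφ, map_one] at h2
    exact one_ne_zero h2
  · intro X Y
    exact key X X.2 _
  · funext i p
    change φ (leftShift (gen θ ⟨i, p⟩) (fockVec 1)) = _
    rw [leftShift_fockVec_one, hφ, evalHom_gen]

theorem isClosed_gelfandSpace : IsClosed (gelfandSpace θ) := by
  refine (isCompact_range ?_).isClosed
  refine continuous_pi fun i => continuous_pi fun p => ?_
  exact (WeakDual.eval_continuous _).comp continuous_subtype_val

theorem norm_character_le (ρ : WeakDual.characterSpace ℂ (normToeplitz (Semigp θ)))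
    (X : normToeplitz (Semigp θ)) : ‖ρ X‖ ≤ ‖X‖ := AlgHom.norm_apply_le_self ρ X

/-- The characters of `𝒜_θ` are the points of the closed polyball at which the relations hold. -/
theorem gelfandSpace_eq :
    gelfandSpace θ = {z | z ∈ relationCone θ ∧ ∀ i, ∑ p, ‖z i p‖ ^ 2 ≤ 1} := by
  refine Set.Subset.antisymm ?_ ?_
  · rintro _ ⟨ρ, rfl⟩
    refine ⟨fun i j h p q => ?_, fun i => ?_⟩
    · rw [← map_mul, ← map_mul]
      refine congrArg ρ (Subtype.ext ?_)
      change leftShift _ * leftShift _ = leftShift _ * leftShift _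
      rw [← leftShift_mul, ← leftShift_mul, gen_mul_gen θ h]
    · set z : Fin (n i) → ℂ := fun p =>
        ρ ⟨leftShift (gen θ ⟨i, p⟩), leftShift_mem_normToeplitz _ _⟩ with hz
      change ∑ p, ‖z p‖ ^ 2 ≤ 1
      set s := ∑ p, ‖z p‖ ^ 2 with hs
      have hs0 : 0 ≤ s := Finset.sum_nonneg fun _ _ => by positivity
      -- an operator of norm at most `|z|` with `ρ(X) = |z|^2`
      let X : normToeplitz (Semigp θ) := ∑ p, starRingEnd ℂ (z p) •
        ⟨leftShift (gen θ ⟨i, p⟩), leftShift_mem_normToeplitz _ _⟩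
      have h1 : ρ X = (s : ℂ) := by
        simp only [X, map_sum, map_smul, hs, Complex.ofReal_sum, smul_eq_mul, Complex.ofReal_pow]
        exact Finset.sum_congr rfl fun p _ => Complex.conj_mul' (z p)
      have h2 : ‖X‖ ≤ √s := by
        have h3 := norm_sum_gen_le (θ := θ) i fun p => starRingEnd ℂ (z p)
        simp only [RCLike.norm_conj] at h3
        convert h3 using 1
        change ‖(X : FockSpace (Semigp θ) →L[ℂ] FockSpace (Semigp θ))‖ = _
        simp [X]
      have h3 := (norm_character_le ρ X).trans h2
      rw [h1, Complex.norm_real, Real.norm_of_nonneg hs0] at h3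
      by_contra hlt
      push Not at hlt
      have h4 : √s < s := by
        rw [Real.sqrt_lt' (by linarith)]
        nlinarith
      linarith
  · rintro z ⟨hz, hz1⟩
    have hlim : Filter.Tendsto (fun m : ℕ => ((1 - 1 / ((m : ℝ) + 1) : ℝ) : ℂ) • z) Filter.atTop
        (nhds z) := by
      have h1 : Filter.Tendsto (fun m : ℕ => ((1 - 1 / ((m : ℝ) + 1) : ℝ) : ℂ)) Filter.atTop
          (nhds 1) := by
        have h2 := (tendsto_const_nhds (x := (1 : ℝ))).sub
          (tendsto_one_div_add_atTop_nhds_zero_nat (𝕜 := ℝ))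
        rw [sub_zero] at h2
        exact_mod_cast (Complex.continuous_ofReal.tendsto _).comp h2
      simpa using h1.smul_const z
    refine isClosed_gelfandSpace.mem_of_tendsto hlim (Filter.Eventually.of_forall fun m => ?_)
    set r : ℝ := 1 - 1 / ((m : ℝ) + 1) with hr
    have hr0 : 0 ≤ r := by
      rw [hr, sub_nonneg, div_le_one (by positivity)]
      linarith [Nat.cast_nonneg (α := ℝ) m]
    have hr1 : r < 1 := by
      have : 0 < 1 / ((m : ℝ) + 1) := by positivity
      linarith
    refine mem_gelfandSpace_of_lt (t := r ^ 2) (smul_mem_relationCone hz _) (by nlinarith)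
      (by positivity) fun i => ?_
    simp only [Pi.smul_apply, smul_eq_mul, norm_mul, Complex.norm_real, mul_pow,
      Real.norm_of_nonneg hr0]
    rw [← Finset.mul_sum]
    exact mul_le_of_le_one_right (by positivity) (hz1 i)

theorem isMinimalType_of_subset (h : relationCone θ ⊆ minimalCone n) : IsMinimalType θ := by
  rw [IsMinimalType, gelfandSpace_eq]
  ext z
  exact ⟨fun hz => ⟨hz.2, h hz.1⟩, fun hz => ⟨minimalCone_subset_relationCone hz.2, hz.1⟩⟩

/-- Every point of the relation cone can be scaled into the closed polyball. -/
theorem relationCone_subset_of_isMinimalType (h : IsMinimalType θ) :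
    relationCone θ ⊆ minimalCone n := by
  intro z hz
  obtain ⟨C, hC0, hC⟩ : ∃ C : ℝ, 0 < C ∧ ∀ i, ∑ p, ‖z i p‖ ^ 2 ≤ C ^ 2 := by
    refine ⟨1 + ∑ i, ∑ p, ‖z i p‖ ^ 2, by positivity, fun i => ?_⟩
    have h1 : ∑ p, ‖z i p‖ ^ 2 ≤ ∑ i, ∑ p, ‖z i p‖ ^ 2 :=
      Finset.single_le_sum (f := fun i => ∑ p, ‖z i p‖ ^ 2) (fun _ _ => by positivity)
        (Finset.mem_univ i)
    have h2 : 0 ≤ ∑ i, ∑ p, ‖z i p‖ ^ 2 := by positivity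
    nlinarith
  have hCc : ((C⁻¹ : ℝ) : ℂ) ≠ 0 := by exact_mod_cast (inv_pos.mpr hC0).ne'
  have h1 : ((C⁻¹ : ℝ) : ℂ) • z ∈ gelfandSpace θ := by
    rw [gelfandSpace_eq]
    refine ⟨smul_mem_relationCone hz _, fun i => ?_⟩
    simp only [Pi.smul_apply, smul_eq_mul, norm_mul, Complex.norm_real, mul_pow,
      Real.norm_of_nonneg (inv_pos.mpr hC0).le]
    rw [← Finset.mul_sum, inv_pow, inv_mul_le_iff₀ (by positivity), mul_one]
    exact hC i
  rw [show gelfandSpace θ = minimalSpace n from h] at h1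
  rcases h1.2 with ⟨j, hj⟩ | hE
  · refine Or.inl ⟨j, fun i hi => ?_⟩
    have := hj i hi
    simpa [hC0.ne'] using this
  · refine Or.inr fun i p q => ?_
    have := hE i p q
    simpa [hC0.ne'] using this

theorem isMinimalType_of_isPurelyCyclic (h : IsPurelyCyclic θ) : IsMinimalType θ := by
  refine isMinimalType_of_subset fun z hz => ?_
  -- the products `z_{ip} z_{jq}` are constant along the cycle `θ_{ij}`
  have hconst : ∀ (i j : Fin k), i < j → ∀ (p p' : Fin (n i)) (q q' : Fin (n j)),
      z i p * z j q = z i p' * z j q' := by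
    intro i j hij p p' q q'
    let f : Fin (n i) × Fin (n j) → ℂ := fun x => z i x.1 * z j x.2
    have hf : ∀ x, f (θ i j hij x) = f x := fun x => by
      have := hz i j hij x.1 x.2
      simp only [f]
      rw [this, mul_comm]
    have hfn : ∀ (m : ℕ) x, f ((θ i j hij ^ m) x) = f x := by
      intro m x
      induction m with
      | zero => rfl
      | succ m ih => rw [pow_succ', Equiv.Perm.mul_apply, hf, ih]
    obtain ⟨m, hm⟩ := (h i j hij).2 (Set.mem_univ (p, q)) (Set.mem_univ (p', q'))
    have hfz : f ((θ i j hij ^ m) (p, q)) = f (p, q) := by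
      obtain ⟨a, rfl | rfl⟩ := m.eq_nat_or_neg
      · rw [zpow_natCast]
        exact hfn a _
      · have := hfn a ((θ i j hij ^ (-(a : ℤ))) (p, q))
        rw [← this, zpow_neg, zpow_natCast, ← Equiv.Perm.mul_apply, mul_inv_cancel,
          Equiv.Perm.one_apply]
    rw [hm] at hfz
    exact hfz.symm
  have hpair : ∀ i j, i < j → z i ≠ 0 → z j ≠ 0 →
      (∀ p p', z i p = z i p') ∧ ∀ q q', z j q = z j q' := by
    intro i j hij hi hj
    obtain ⟨p₀, hp₀⟩ := Function.ne_iff.mp hi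
    obtain ⟨q₀, hq₀⟩ := Function.ne_iff.mp hj
    exact ⟨fun p p' => mul_right_cancel₀ hq₀ (hconst i j hij p p' q₀ q₀),
      fun q q' => mul_left_cancel₀ hp₀ (hconst i j hij p₀ p₀ q q')⟩
  by_cases hV : ∃ j, ∀ i, i ≠ j → z i = 0
  · exact Or.inl hV
  refine Or.inr fun i p q => ?_
  push Not at hV
  by_cases hi : z i = 0
  · rw [hi]
    rfl
  obtain ⟨j, hji, hj⟩ := hV i
  rcases lt_or_gt_of_ne hji with hlt | hlt
  · exact (hpair j i hlt hj hi).2 p q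
  · exact (hpair i j hlt hi hj).1 p q

end PermSet

/-! ### Functionals that are multiplicative along the left shifts -/

namespace PermSet

variable {k : ℕ} {n : Fin k → ℕ} {θ : PermSet n}

/-- The part of an analytic Toeplitz operator that is homogeneous of degree `m` in block `i`,
obtained by the Schur multiplier that selects one block diagonal. -/
theorem exists_homogeneous_part (i : Fin k) (m : ℕ)
    {T : FockSpace (Semigp θ) →L[ℂ] FockSpace (Semigp θ)} (hT : IsToeplitz T) :
    ∃ A : FockSpace (Semigp θ) →L[ℂ] FockSpace (Semigp θ), IsToeplitz A ∧ ‖A‖ ≤ ‖T‖ ∧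
      ∀ u, (A (fockVec 1)) u = if blockDeg θ i u = m then (T (fockVec 1)) u else 0 := by
  classical
  obtain ⟨A, hA, hAe⟩ := exists_schur_multiplier T one_pos (fun w => {blockDeg θ i w})
    (fun w => {blockDeg θ i w + m}) (by simp) (by simp)
  have hAe' : ∀ v w, (A (fockVec w)) v =
      if blockDeg θ i v = blockDeg θ i w + m then (T (fockVec w)) v else 0 := by
    intro v w
    rw [hAe]
    split_ifs with h
    · simp [h]
    · rw [Finset.singleton_inter_of_notMem (by simpa using h)]
      simp
  refine ⟨A, ⟨fun u v => ?_, fun w v h => ?_⟩, hA, fun u => ?_⟩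
  · rw [hAe', hAe', hT.apply_mul, blockDeg_mul, blockDeg_one]
    refine if_congr ?_ rfl rfl
    omega
  · rw [hAe', hT.apply_eq_zero w v h, ite_self]
  · rw [hAe', blockDeg_one, zero_add]

variable [IsCancelMul (Semigp θ)]

/-- The backward shift `∑_p z_p L_{ip}^*`. -/
def backShift (θ : PermSet n) [IsCancelMul (Semigp θ)] (i : Fin k) (z : Fin (n i) → ℂ) :
    FockSpace (Semigp θ) →L[ℂ] FockSpace (Semigp θ) :=
  ∑ p, z p • (leftShift (gen θ ⟨i, p⟩)).adjoint

theorem backShift_apply (i : Fin k) (z : Fin (n i) → ℂ) (f : FockSpace (Semigp θ))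
    (w : Semigp θ) : backShift θ i z f w = ∑ p, z p * f (gen θ ⟨i, p⟩ * w) := by
  rw [← coord_apply w (_ : FockSpace (Semigp θ))]
  simp only [backShift, sum_apply, smul_apply, map_sum, map_smul, coord_apply, smul_eq_mul,
    adjoint_leftShift_apply]

theorem norm_backShift_le (i : Fin k) (z : Fin (n i) → ℂ) :
    ‖backShift θ i z‖ ≤ √(∑ p, ‖z p‖ ^ 2) := by
  have h : backShift θ i z =
      (∑ p, starRingEnd ℂ (z p) • leftShift (gen θ ⟨i, p⟩)).adjoint := by
    rw [map_sum, backShift]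
    refine Finset.sum_congr rfl fun p _ => ?_
    rw [map_smulₛₗ, Complex.conj_conj]
  rw [h, LinearIsometryEquiv.norm_map]
  have h3 := norm_sum_gen_le (θ := θ) i fun p => starRingEnd ℂ (z p)
  simpa only [RCLike.norm_conj] using h3

/-- The adjoint of a generator of block `i` maps an analytic Toeplitz operator all of whose terms
contain a letter of block `i` to an analytic Toeplitz operator. -/
theorem isToeplitz_adjoint_comp (i : Fin k) (p : Fin (n i))
    {T : FockSpace (Semigp θ) →L[ℂ] FockSpace (Semigp θ)} (hT : IsToeplitz T)
    (h0 : ∀ u, blockDeg θ i u = 0 → (T (fockVec 1)) u = 0) :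
    IsToeplitz ((leftShift (gen θ ⟨i, p⟩)).adjoint * T) := by
  refine ⟨fun u v => ?_, fun w v hw => ?_⟩
  · simp only [mul_apply_eq_comp, adjoint_leftShift_apply]
    rw [← mul_assoc, hT.apply_mul]
  · rw [mul_apply_eq_comp, adjoint_leftShift_apply]
    by_cases hv : ∃ u, gen θ ⟨i, p⟩ * w = u * v
    · obtain ⟨u, hu⟩ := hv
      rw [hu, hT.apply_mul]
      by_contra hne
      obtain ⟨q, u', rfl⟩ := exists_gen_mul_of_blockDeg fun h => hne (h0 u h)
      rw [mul_assoc] at hu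
      exact hw u' (gen_mul_inj.mp hu).2
    · push Not at hv
      exact hT.apply_eq_zero _ _ hv

theorem eq_sum_gen_mul_adjoint (i : Fin k)
    {T : FockSpace (Semigp θ) →L[ℂ] FockSpace (Semigp θ)} (hT : IsToeplitz T)
    (h0 : ∀ u, blockDeg θ i u = 0 → (T (fockVec 1)) u = 0) :
    T = ∑ p, leftShift (gen θ ⟨i, p⟩) * ((leftShift (gen θ ⟨i, p⟩)).adjoint * T) := by
  refine IsToeplitz.ext hT ?_ (lp.ext (funext fun w => ?_))
  · refine isToeplitz_of_mem_weakToeplitz (Subalgebra.sum_mem _ fun p _ => Subalgebra.mul_mem _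
      (leftShift_mem_weakToeplitz _) ?_)
    exact mem_weakToeplitz_of_isToeplitz (isToeplitz_adjoint_comp i p hT h0)
  · rw [← coord_apply w ((∑ p, _ : FockSpace (Semigp θ) →L[ℂ] FockSpace (Semigp θ)) _)]
    simp only [sum_apply, map_sum, mul_apply_eq_comp, coord_apply]
    by_cases hw : blockDeg θ i w = 0
    · rw [h0 w hw]
      symm
      refine Finset.sum_eq_zero fun p _ => leftShift_apply_of_ne (fun v hv => ?_) _
      rw [hv, blockDeg_mul, blockDeg_gen, if_pos rfl] at hw
      omega
    · obtain ⟨q, u, rfl⟩ := exists_gen_mul_of_blockDeg hw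
      rw [Finset.sum_eq_single q, leftShift_apply_mul, adjoint_leftShift_apply]
      · intro p _ hp
        exact leftShift_apply_of_ne (fun v hv => hp (gen_mul_inj.mp hv).1.symm) _
      · simp

/-- An analytic Toeplitz operator as an element of the weakly closed algebra. -/
def _root_.IsToeplitz.toWeak {T : FockSpace (Semigp θ) →L[ℂ] FockSpace (Semigp θ)}
    (hT : IsToeplitz T) : weakToeplitz (Semigp θ) := ⟨T, mem_weakToeplitz_of_isToeplitz hT⟩

/-- The linear functionals `ψ` on the weakly closed algebra that are bounded and satisfy
`ψ(L_x S) = z_x ψ(S)` for all generators `x`, such as a character `ρ` with `ρ(L_x) = z_x`, or a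
point derivation at `ρ` that vanishes on the generators. -/
structure IsShiftEigen (z : ∀ i : Fin k, Fin (n i) → ℂ)
    (ψ : weakToeplitz (Semigp θ) →ₗ[ℂ] ℂ) : Prop where
  map_gen_mul : ∀ (i : Fin k) (p : Fin (n i)) (S : weakToeplitz (Semigp θ)),
    ψ (⟨leftShift (gen θ ⟨i, p⟩), leftShift_mem_weakToeplitz _⟩ * S) = z i p * ψ S
  bounded : ∃ C, ∀ S, ‖ψ S‖ ≤ C * ‖S‖

variable {z : ∀ i : Fin k, Fin (n i) → ℂ} {ψ : weakToeplitz (Semigp θ) →ₗ[ℂ] ℂ}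

/-- If all terms of `T` contain a letter of block `i`, then `T = ∑_p L_{ip} (L_{ip}^* T)`, so that the
functional does not distinguish `T` from its backward shift. -/
theorem IsShiftEigen.map_backShift (hψ : IsShiftEigen z ψ) (i : Fin k)
    {T : FockSpace (Semigp θ) →L[ℂ] FockSpace (Semigp θ)} (hT : IsToeplitz T)
    (h0 : ∀ u, blockDeg θ i u = 0 → (T (fockVec 1)) u = 0) :
    ∃ h : IsToeplitz (backShift θ i (z i) * T), ψ hT.toWeak = ψ h.toWeak := by
  have hp := fun p => isToeplitz_adjoint_comp i p hT h0
  have h1 : backShift θ i (z i) * T =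
      ∑ p, z i p • ((leftShift (gen θ ⟨i, p⟩)).adjoint * T) := by
    simp only [backShift, Finset.sum_mul, smul_mul_assoc]
  have h2 : IsToeplitz (backShift θ i (z i) * T) := by
    rw [h1]
    exact isToeplitz_of_mem_weakToeplitz (Subalgebra.sum_mem _ fun p _ =>
      Subalgebra.smul_mem _ (mem_weakToeplitz_of_isToeplitz (hp p)) _)
  refine ⟨h2, ?_⟩
  have h3 : hT.toWeak = ∑ p, ⟨leftShift (gen θ ⟨i, p⟩), leftShift_mem_weakToeplitz _⟩ *
      (hp p).toWeak := by
    refine Subtype.ext ?_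
    rw [AddSubmonoidClass.coe_finsetSum]
    exact eq_sum_gen_mul_adjoint i hT h0
  have h4 : h2.toWeak = ∑ p, z i p • (hp p).toWeak := by
    refine Subtype.ext ?_
    rw [AddSubmonoidClass.coe_finsetSum]
    exact h1
  rw [h3, h4, map_sum, map_sum]
  refine Finset.sum_congr rfl fun p _ => ?_
  rw [hψ.map_gen_mul, map_smul, smul_eq_mul]

/-- The `m`-th backward shift of an operator all of whose terms contain at least `m` letters of block
`i`. -/
theorem IsShiftEigen.exists_backShift_pow (hψ : IsShiftEigen z ψ) (i : Fin k) {r : ℝ}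
    (hr : √(∑ p, ‖z i p‖ ^ 2) ≤ r) (m : ℕ) :
    ∀ {T : FockSpace (Semigp θ) →L[ℂ] FockSpace (Semigp θ)} (hT : IsToeplitz T),
      (∀ u, blockDeg θ i u < m → (T (fockVec 1)) u = 0) →
      ∃ (A : FockSpace (Semigp θ) →L[ℂ] FockSpace (Semigp θ)) (hA : IsToeplitz A),
        ψ hT.toWeak = ψ hA.toWeak ∧ ‖A‖ ≤ r ^ m * ‖T‖ ∧
        ∀ u, (A (fockVec 1)) u ≠ 0 → ∃ v, (T (fockVec 1)) v ≠ 0 ∧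
          blockDeg θ i v = blockDeg θ i u + m ∧ ∀ j ≠ i, blockDeg θ j v = blockDeg θ j u := by
  have hr0 : 0 ≤ r := (Real.sqrt_nonneg _).trans hr
  induction m with
  | zero => exact fun {T} hT _ => ⟨T, hT, rfl, by simp, fun u hu => ⟨u, hu, rfl, fun _ _ => rfl⟩⟩
  | succ m ih =>
    intro T hT h0
    obtain ⟨hB, hψB⟩ := hψ.map_backShift i hT fun u hu => h0 u (by omega)
    have hcoef : ∀ u, ((backShift θ i (z i) * T) (fockVec 1)) u =
        ∑ p, z i p * (T (fockVec 1)) (gen θ ⟨i, p⟩ * u) := fun u => by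
      rw [mul_apply_eq_comp, backShift_apply]
    obtain ⟨A, hA, h1, h2, h3⟩ := ih hB fun u hu => by
      rw [hcoef]
      refine Finset.sum_eq_zero fun p _ => ?_
      rw [h0, mul_zero]
      rw [blockDeg_mul, blockDeg_gen, if_pos rfl]
      omega
    refine ⟨A, hA, hψB.trans h1, ?_, fun u hu => ?_⟩
    · calc ‖A‖ ≤ r ^ m * ‖backShift θ i (z i) * T‖ := h2
        _ ≤ r ^ m * (r * ‖T‖) := by
          gcongr
          refine (norm_mul_le _ _).trans ?_
          gcongr
          exact (norm_backShift_le i (z i)).trans hr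
        _ = r ^ (m + 1) * ‖T‖ := by ring
    · obtain ⟨v, hv, hvi, hvj⟩ := h3 u hu
      rw [hcoef] at hv
      obtain ⟨p, -, hp⟩ := Finset.exists_ne_zero_of_sum_ne_zero hv
      refine ⟨_, right_ne_zero_of_mul hp, ?_, fun j hj => ?_⟩
      · rw [blockDeg_mul, blockDeg_gen, if_pos rfl, hvi]
        omega
      · rw [blockDeg_mul, blockDeg_gen, if_neg (Ne.symm hj), hvj j hj, zero_add]

/-- A bounded functional on the weakly closed algebra with `ψ(L_x S) = z_x ψ(S)`, where
`|z_i| < 1` for all blocks, vanishes if `ψ(1) = 0`. No continuity in the weak operator topology is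
assumed. In one block, `ψ(T) = ψ(Z^m (T - T_{<m}))` with the strict contraction `Z = ∑_p z_p L_p^*`
and the polynomial part `T_{<m}` of norm at most `m ‖T‖`; the blocks are treated one by one. -/
theorem IsShiftEigen.eq_zero (hψ : IsShiftEigen z ψ) (hz : ∀ i, ∑ p, ‖z i p‖ ^ 2 < 1)
    (h1 : ψ 1 = 0) : ψ = 0 := by
  classical
  -- induction on the set `C` of the blocks that occur in `T`
  suffices H : ∀ (C : Finset (Fin k)) {T : FockSpace (Semigp θ) →L[ℂ] FockSpace (Semigp θ)}
      (hT : IsToeplitz T), (∀ u, (T (fockVec 1)) u ≠ 0 → ∀ j ∉ C, blockDeg θ j u = 0) →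
      ψ hT.toWeak = 0 by
    refine LinearMap.ext fun T => ?_
    exact H Finset.univ (isToeplitz_of_mem_weakToeplitz T.2) fun u _ j hj =>
      absurd (Finset.mem_univ j) hj
  intro C
  induction C using Finset.induction_on with
  | empty =>
    intro T hT hsupp
    have hu : ∀ u, u ≠ 1 → (T (fockVec 1)) u = 0 := by
      intro u hu
      by_contra hne
      obtain rfl | ⟨x, v, rfl⟩ := eq_one_or_exists_gen_mul u
      · exact hu rfl
      · have := hsupp _ hne x.1 (Finset.notMem_empty _)
        rw [blockDeg_mul, blockDeg_gen, if_pos rfl] at this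
        omega
    have hTc : T = (T (fockVec 1)) 1 • leftShift (1 : Semigp θ) := by
      refine hT.ext ((isToeplitz_leftShift 1).smul _) (lp.ext (funext fun u => ?_))
      rw [smul_apply, leftShift_fockVec, mul_one, lp.coeFn_smul, Pi.smul_apply, smul_eq_mul,
        fockVec_apply]
      split_ifs with h
      · rw [h, mul_one]
      · rw [hu u h, mul_zero]
    have : hT.toWeak = (T (fockVec 1)) 1 • (1 : weakToeplitz (Semigp θ)) := by
      refine Subtype.ext ?_
      rw [leftShift_one] at hTc
      exact hTc
    rw [this, map_smul, h1, smul_zero]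
  | insert i C _ ih =>
    intro T hT hsupp
    obtain ⟨B, hB⟩ := hψ.bounded
    set r := √(∑ p, ‖z i p‖ ^ 2) with hr
    have hr0 : 0 ≤ r := Real.sqrt_nonneg _
    have hr1 : r < 1 := by
      rw [hr, Real.sqrt_lt' one_pos, one_pow]
      exact hz i
    choose A hA hAn hAe using fun m : ℕ => exists_homogeneous_part i m hT
    -- `m` backward shifts remove all letters of block `i` from the homogeneous part of degree `m`
    have hA0 : ∀ m, ψ (hA m).toWeak = 0 := by
      intro m
      obtain ⟨A', hA', h2, -, h3⟩ := hψ.exists_backShift_pow i hr.ge m (hA m) fun u hu => by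
        rw [hAe, if_neg hu.ne]
      rw [h2]
      refine ih hA' fun u hu j hj => ?_
      obtain ⟨v, hv, hvi, hvj⟩ := h3 u hu
      rw [hAe] at hv
      obtain ⟨hvm, hv⟩ := ne_eq _ _ ▸ ite_ne_right_iff.mp hv
      by_cases hji : j = i
      · subst hji
        omega
      · rw [← hvj j hji]
        exact hsupp v hv j (by simp [hji, hj])
    have hbound : ∀ m : ℕ, ‖ψ hT.toWeak‖ ≤ B * (r ^ m * ((m + 1) * ‖T‖)) := by
      intro m
      have hR : IsToeplitz (T - ∑ l ∈ Finset.range m, A l) :=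
        isToeplitz_of_mem_weakToeplitz (Subalgebra.sub_mem _ (mem_weakToeplitz_of_isToeplitz hT)
          (Subalgebra.sum_mem _ fun l _ => mem_weakToeplitz_of_isToeplitz (hA l)))
      have hRψ : ψ hT.toWeak = ψ hR.toWeak := by
        have : hR.toWeak = hT.toWeak - ∑ l ∈ Finset.range m, (hA l).toWeak := by
          refine Subtype.ext ?_
          rw [Subalgebra.coe_sub, AddSubmonoidClass.coe_finsetSum]
          rfl
        rw [this, map_sub, map_sum, Finset.sum_eq_zero fun l _ => hA0 l, sub_zero]
      obtain ⟨A', hA', h2, h3, -⟩ := hψ.exists_backShift_pow i hr.ge m hR fun u hu => by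
        rw [← coord_apply u (_ : FockSpace (Semigp θ))]
        simp only [sub_apply, sum_apply, map_sub, map_sum, coord_apply, hAe]
        rw [Finset.sum_ite_eq, if_pos (Finset.mem_range.mpr hu), sub_self]
      have hB0 : 0 ≤ B := by
        by_contra hneg
        have h5 := hB 1
        have h6 : (0 : ℝ) < ‖(1 : weakToeplitz (Semigp θ))‖ := by
          have : (1 : FockSpace (Semigp θ) →L[ℂ] FockSpace (Semigp θ)) ≠ 0 := fun h => by
            have h7 := congrArg (fun A => A (fockVec (1 : Semigp θ))) h
            have h8 := norm_fockVec (1 : Semigp θ)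
            rw [show (fockVec (1 : Semigp θ)) = 0 from h7, norm_zero] at h8
            exact zero_ne_one h8
          exact norm_pos_iff.mpr fun h => this (congrArg Subtype.val h)
        have h7 := norm_nonneg (ψ 1)
        nlinarith
      rw [hRψ, h2]
      refine (hB _).trans (mul_le_mul_of_nonneg_left ?_ hB0)
      refine h3.trans (mul_le_mul_of_nonneg_left ?_ (pow_nonneg hr0 m))
      calc ‖T - ∑ l ∈ Finset.range m, A l‖ ≤ ‖T‖ + ∑ l ∈ Finset.range m, ‖A l‖ :=
            (norm_sub_le _ _).trans (by gcongr; exact norm_sum_le _ _)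
        _ ≤ ‖T‖ + ∑ _l ∈ Finset.range m, ‖T‖ := by
            gcongr with l
            exact hAn l
        _ = (m + 1) * ‖T‖ := by
            rw [Finset.sum_const, Finset.card_range, nsmul_eq_mul]
            ring
    have hlim : Filter.Tendsto (fun m : ℕ => B * (r ^ m * ((m + 1) * ‖T‖))) Filter.atTop
        (nhds 0) := by
      have h2 := ((tendsto_self_mul_const_pow_of_lt_one hr0 hr1).add
        (tendsto_pow_atTop_nhds_zero_of_lt_one hr0 hr1)).mul_const (B * ‖T‖)
      rw [add_zero, zero_mul] at h2
      refine h2.congr fun m => ?_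
      ring
    exact norm_le_zero_iff.mp (ge_of_tendsto' hlim hbound)

end PermSet

/-! ### Block structure of matrices compatible with the quadratic relations -/

namespace PermSet

variable {k : ℕ} {n : Fin k → ℕ}

/-- The matrix `B` maps the quadratic relations of `θ` to quadratic relations of `τ`: the linear
combinations `b_x = ∑_y B_{xy} f_y` of the generators of `𝔽⁺_τ` satisfy the relations of `θ` in the
semigroup algebra of `𝔽⁺_τ`. The two conditions compare the coefficients at the elements of degree
`2` in one block and of degree `(1,1)` in two blocks. -/
structure PreservesRelations (θ τ : PermSet n) (B : Matrix (Gen n) (Gen n) ℂ) : Prop where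
  same : ∀ (i l : Fin k) (h : i < l) (p : Fin (n i)) (q : Fin (n l)) (j : Fin k)
    (r r' : Fin (n j)), B ⟨i, p⟩ ⟨j, r⟩ * B ⟨l, q⟩ ⟨j, r'⟩ =
      B ⟨l, (θ i l h (p, q)).2⟩ ⟨j, r⟩ * B ⟨i, (θ i l h (p, q)).1⟩ ⟨j, r'⟩
  diff : ∀ (i l : Fin k) (h : i < l) (p : Fin (n i)) (q : Fin (n l)) (a b : Fin k) (hab : a ≠ b)
    (α : Fin (n a)) (β : Fin (n b)),
    B ⟨i, p⟩ ⟨a, α⟩ * B ⟨l, q⟩ ⟨b, β⟩ +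
      B ⟨i, p⟩ ⟨b, (τ.perm a b hab (α, β)).2⟩ * B ⟨l, q⟩ ⟨a, (τ.perm a b hab (α, β)).1⟩ =
    B ⟨l, (θ i l h (p, q)).2⟩ ⟨a, α⟩ * B ⟨i, (θ i l h (p, q)).1⟩ ⟨b, β⟩ +
      B ⟨l, (θ i l h (p, q)).2⟩ ⟨b, (τ.perm a b hab (α, β)).2⟩ *
        B ⟨i, (θ i l h (p, q)).1⟩ ⟨a, (τ.perm a b hab (α, β)).1⟩

variable {θ τ : PermSet n} {B : Matrix (Gen n) (Gen n) ℂ}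

theorem mulVec_single_block (B : Matrix (Gen n) (Gen n) ℂ) (j : Fin k) (v : Fin (n j) → ℂ)
    (x : Gen n) : (B *ᵥ fun y => Pi.single (M := fun i => Fin (n i) → ℂ) j v y.1 y.2) x =
      ∑ r, B x ⟨j, r⟩ * v r := by
  simp only [Matrix.mulVec, dotProduct]
  rw [Fintype.sum_sigma, Finset.sum_eq_single j]
  · simp
  · intro i _ hi
    simp [Pi.single_eq_of_ne hi]
  · simp

theorem eq_zero_of_block (hB : B.det ≠ 0) {j : Fin k} {v : Fin (n j) → ℂ}
    (h : ∀ x, ∑ r, B x ⟨j, r⟩ * v r = 0) : v = 0 := by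
  have h1 := Matrix.eq_zero_of_mulVec_eq_zero hB
    (v := fun y => Pi.single (M := fun i => Fin (n i) → ℂ) j v y.1 y.2)
    (funext fun x => (mulVec_single_block B j v x).trans (h x))
  funext r
  have := congrFun h1 ⟨j, r⟩
  simpa using this

/-- The columns of an invertible relation preserving matrix that belong to a block with at least
two generators live in the rows of a single block. Otherwise they would map `ℂ^{n_j}` into the
product of the diagonals, and then the relations force the rows to be proportional. -/
theorem PreservesRelations.exists_block (hQ : PreservesRelations θ τ B) (hB : B.det ≠ 0)
    (hθ : relationCone θ ⊆ minimalCone n) {j : Fin k} (hj : 2 ≤ n j) :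
    ∃ i, ∀ x : Gen n, x.1 ≠ i → ∀ r, B x ⟨j, r⟩ = 0 := by
  by_contra hcon
  push Not at hcon
  obtain ⟨x₀, -, r₀, hx₀⟩ := hcon j
  obtain ⟨y₀, hxy, r₁, hy₀⟩ := hcon x₀.1
  let X : Gen n → Module.Dual ℂ (Fin (n j) → ℂ) := fun x =>
    ∑ r, B x ⟨j, r⟩ • LinearMap.proj r
  have hX : ∀ x v, X x v = ∑ r, B x ⟨j, r⟩ * v r := fun x v => by simp [X]
  have hXs : ∀ x r, X x (Pi.single r 1) = B x ⟨j, r⟩ := fun x r => by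
    rw [hX]
    simp [Pi.single_apply]
  have hcone : ∀ v : Fin (n j) → ℂ, (fun i p => X ⟨i, p⟩ v) ∈ relationCone θ := by
    intro v i l h p q
    simp only [hX]
    rw [Finset.sum_mul_sum, Finset.sum_mul_sum]
    refine Finset.sum_congr rfl fun r _ => Finset.sum_congr rfl fun r' _ => ?_
    linear_combination v r * v r' * hQ.same i l h p q j r r'
  -- A nonzero difference within a block could be seen at a generic vector `v`, at which `x₀` and `y₀`
  -- do not vanish either; this contradicts the minimality of the cone.
  have hconst : ∀ i p q r, B ⟨i, p⟩ ⟨j, r⟩ = B ⟨i, q⟩ ⟨j, r⟩ := by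
    intro i p q r
    by_contra hne
    let F : Fin 3 → Module.Dual ℂ (Fin (n j) → ℂ) := ![X x₀, X y₀, X ⟨i, p⟩ - X ⟨i, q⟩]
    obtain ⟨v, hv⟩ := Module.Dual.exists_forall_ne_zero_of_forall_exists F (by
      intro m
      fin_cases m
      · exact ⟨Pi.single r₀ 1, by simpa [F, hXs] using hx₀⟩
      · exact ⟨Pi.single r₁ 1, by simpa [F, hXs] using hy₀⟩
      · exact ⟨Pi.single r 1, by simpa [F, hXs, sub_eq_zero] using hne⟩)
    have h0 : X x₀ v ≠ 0 := hv 0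
    have h1 : X y₀ v ≠ 0 := hv 1
    have h2 : X ⟨i, p⟩ v - X ⟨i, q⟩ v ≠ 0 := hv 2
    rcases hθ (hcone v) with ⟨m, hm⟩ | hE
    · by_cases hxm : x₀.1 = m
      · exact h1 (congrFun (hm y₀.1 fun h => hxy (h.trans hxm.symm)) y₀.2)
      · exact h0 (congrFun (hm x₀.1 hxm) x₀.2)
    · exact h2 (sub_eq_zero.mpr (hE i p q))
  -- rows of the same block agree, so that the relations say that rows of different blocks are
  -- proportional
  have hprop : ∀ (x : Gen n) r r', B x ⟨j, r⟩ * B x₀ ⟨j, r'⟩ = B x₀ ⟨j, r⟩ * B x ⟨j, r'⟩ := by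
    rintro ⟨i, p⟩ r r'
    obtain ⟨l, q⟩ := x₀
    rcases lt_trichotomy i l with h | h | h
    · have := hQ.same i l h p q j r r'
      rw [hconst l (θ i l h (p, q)).2 q, hconst i (θ i l h (p, q)).1 p] at this
      exact this
    · subst h
      rw [hconst i p q, hconst i p q]
    · have := hQ.same l i h q p j r' r
      rw [hconst i (θ l i h (q, p)).2 p, hconst l (θ l i h (q, p)).1 q] at this
      rw [mul_comm, this, mul_comm]
  obtain ⟨v, hvk, hv⟩ := Submodule.exists_mem_ne_zero_of_ne_bot
    (LinearMap.ker_ne_bot_of_finrank_lt (f := X x₀) (by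
      simp
      omega))
  refine hv (eq_zero_of_block hB fun x => ?_)
  refine (mul_eq_zero.mp ?_).resolve_right hx₀
  rw [Finset.sum_mul]
  have h0 : X x₀ v = 0 := hvk
  calc ∑ r, B x ⟨j, r⟩ * v r * B x₀ ⟨j, r₀⟩ = ∑ r, B x₀ ⟨j, r⟩ * v r * B x ⟨j, r₀⟩ :=
        Finset.sum_congr rfl fun r _ => by linear_combination v r * hprop x r r₀
    _ = X x₀ v * B x ⟨j, r₀⟩ := by rw [hX, Finset.sum_mul]
    _ = 0 := by rw [h0, zero_mul]

/-- The blocks of an invertible relation preserving matrix: there is a permutation `s` of the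
blocks such that the block columns `s(i)` with `n_i ≥ 2` vanish outside block `i`, and such that
the entries at `(i, s(i))` for `n_i = 1` do not vanish. The permutation is read off from a nonzero
term of the Leibniz expansion of the determinant. -/
theorem PreservesRelations.exists_perm (hQ : PreservesRelations θ τ B) (hB : B.det ≠ 0)
    (hθ : relationCone θ ⊆ minimalCone n) (hn : ∀ i, 1 ≤ n i) :
    ∃ s : Equiv.Perm (Fin k), (∀ i, n (s i) = n i) ∧
      (∀ i, 2 ≤ n i → ∀ x : Gen n, x.1 ≠ i → ∀ r, B x ⟨s i, r⟩ = 0) ∧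
      (∀ i, n i = 1 → ∀ p r, B ⟨i, p⟩ ⟨s i, r⟩ ≠ 0) := by
  obtain ⟨σ, hσ⟩ : ∃ σ : Equiv.Perm (Gen n), ∀ y, B (σ y) y ≠ 0 := by
    by_contra hcon
    push Not at hcon
    refine hB ?_
    rw [Matrix.det_apply]
    refine Finset.sum_eq_zero fun σ _ => ?_
    obtain ⟨y, hy⟩ := hcon σ
    have h0 : ∏ i, B (σ i) i = 0 := Finset.prod_eq_zero (Finset.mem_univ y) hy
    rw [h0, smul_zero]
  let t : Fin k → Fin k := fun j => (σ ⟨j, ⟨0, hn j⟩⟩).1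
  -- for `n_j ≥ 2`, the nonzero entries of the columns of block `j` lie in a single block
  have ht : ∀ j r, (σ ⟨j, r⟩).1 = t j := by
    intro j r
    by_cases hj : 2 ≤ n j
    · obtain ⟨i, hi⟩ := hQ.exists_block hB hθ hj
      have h1 : ∀ r, (σ ⟨j, r⟩).1 = i := fun r => by
        by_contra hne
        exact hσ ⟨j, r⟩ (hi _ hne r)
      exact (h1 r).trans (h1 _).symm
    · have hr : r = ⟨0, hn j⟩ := Fin.ext (by have := r.2; simp only; omega)
      rw [hr]
  have htsurj : Function.Surjective t := fun i => by
    obtain ⟨y, hy⟩ := σ.surjective ⟨i, ⟨0, hn i⟩⟩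
    exact ⟨y.1, by rw [← ht y.1 y.2, Sigma.eta, hy]⟩
  have htbij : Function.Bijective t := ⟨Finite.injective_iff_surjective.mpr htsurj, htsurj⟩
  have hle : ∀ j, n j ≤ n (t j) := by
    intro j
    have h1 := Fintype.card_le_of_injective
      (fun r : Fin (n j) => (⟨σ ⟨j, r⟩, ht j r⟩ : {x : Gen n // x.1 = t j})) (by
        intro r r' h
        have h2 := σ.injective (congrArg Subtype.val h)
        simpa using h2)
    rw [Fintype.card_congr (Equiv.sigmaSubtype (β := fun i => Fin (n i)) (t j))] at h1
    simpa using h1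
  have hnt : ∀ j, n (t j) = n j := by
    have h1 : ∑ j, n (t j) = ∑ j, n j := htbij.sum_comp n
    have h2 := (Finset.sum_eq_sum_iff_of_le fun j _ => hle j).mp h1.symm
    exact fun j => (h2 j (Finset.mem_univ j)).symm
  have hs : ∀ i, t ((Equiv.ofBijective t htbij).symm i) = i := fun i =>
    (Equiv.ofBijective t htbij).apply_symm_apply i
  have hbig : ∀ i j, t j = i → 2 ≤ n i → ∀ x : Gen n, x.1 ≠ i → ∀ r, B x ⟨j, r⟩ = 0 := by
    rintro _ j rfl hi x hx r
    obtain ⟨i, hi'⟩ := hQ.exists_block hB hθ (j := j) (by rw [← hnt]; exact hi)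
    have : t j = i := by
      by_contra hne
      exact hσ ⟨j, r⟩ (hi' _ (by rw [ht]; exact hne) r)
    exact hi' x (this ▸ hx) r
  have hsmall : ∀ i j, t j = i → n i = 1 → ∀ p r, B ⟨i, p⟩ ⟨j, r⟩ ≠ 0 := by
    intro i j hj hi p r
    have h1 := hσ ⟨j, r⟩
    have h2 : (σ ⟨j, r⟩).1 = i := by rw [ht, hj]
    have h3 : σ ⟨j, r⟩ = ⟨i, p⟩ := by
      generalize σ ⟨j, r⟩ = x at h2
      obtain ⟨a, q⟩ := x
      obtain rfl : a = i := h2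
      have : q = p := Fin.ext (by have := q.2; have := p.2; omega)
      rw [this]
    rwa [h3] at h1
  exact ⟨(Equiv.ofBijective t htbij).symm, fun i => by rw [← hnt, hs],
    fun i => hbig i _ (hs i), fun i => hsmall i _ (hs i)⟩

theorem permMat_mul_eq_iff {ι κ : Type} [Fintype ι] [DecidableEq ι] [Fintype κ] [DecidableEq κ]
    (σ : Equiv.Perm ι) (ρ : Equiv.Perm κ) (M : Matrix ι κ ℂ) :
    permMat σ * M = M * permMat ρ ↔ ∀ x y, M x y = M (σ x) (ρ y) := by
  have h1 : ∀ x y, (permMat σ * M) (σ x) y = M x y := by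
    intro x y
    simp [permMat, Matrix.mul_apply]
  have h2 : ∀ x y, (M * permMat ρ) x y = M x (ρ y) := by
    intro x y
    simp [permMat, Matrix.mul_apply]
  constructor
  · intro h x y
    rw [← h1, h, h2]
  · intro h
    ext x y
    obtain ⟨x, rfl⟩ := σ.surjective x
    rw [h1, h2, h]

/-- The intertwining relation in terms of matrix entries. -/
theorem intertwine_entries_iff {θ τ : PermSet n} {s : Equiv.Perm (Fin k)}
    {A : ∀ i : Fin k, Matrix (Fin (n i)) (Fin (n (s i))) ℂ} {i j : Fin k} (h : i < j) :
    permMat (θ i j h) * (A i ⊗ₖ A j) =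
        (A i ⊗ₖ A j) * permMat (τ.perm (s i) (s j) (s.injective.ne h.ne)) ↔
      ∀ p q α β, A i p α * A j q β =
        A j (θ i j h (p, q)).2 (τ.perm (s i) (s j) (s.injective.ne h.ne) (α, β)).2 *
          A i (θ i j h (p, q)).1 (τ.perm (s i) (s j) (s.injective.ne h.ne) (α, β)).1 := by
  rw [permMat_mul_eq_iff]
  constructor
  · intro H p q α β
    rw [mul_comm (A j _ _)]
    exact H (p, q) (α, β)
  · rintro H ⟨p, q⟩ ⟨α, β⟩
    simp only [Matrix.kroneckerMap_apply]
    rw [mul_comm (A i (θ i j h (p, q)).1 _)]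
    exact H p q α β

/-- The blocks at the positions `(i, s(i))` of an invertible relation preserving matrix. -/
theorem PreservesRelations.intertwine_entries (hQ : PreservesRelations θ τ B)
    {s : Equiv.Perm (Fin k)} (hs : ∀ i, n (s i) = n i)
    (hbig : ∀ i, 2 ≤ n i → ∀ x : Gen n, x.1 ≠ i → ∀ r, B x ⟨s i, r⟩ = 0)
    {i j : Fin k} (h : i < j) (p : Fin (n i)) (q : Fin (n j)) (α : Fin (n (s i)))
    (β : Fin (n (s j))) :
    B ⟨i, p⟩ ⟨s i, α⟩ * B ⟨j, q⟩ ⟨s j, β⟩ =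
      B ⟨j, (θ i j h (p, q)).2⟩
          ⟨s j, (τ.perm (s i) (s j) (s.injective.ne h.ne) (α, β)).2⟩ *
        B ⟨i, (θ i j h (p, q)).1⟩
          ⟨s i, (τ.perm (s i) (s j) (s.injective.ne h.ne) (α, β)).1⟩ := by
  have key := hQ.diff i j h p q (s i) (s j) (s.injective.ne h.ne) α β
  by_cases hi : 2 ≤ n i
  · rw [hbig i hi ⟨j, q⟩ h.ne', hbig i hi ⟨j, _⟩ h.ne'] at key
    simpa using key
  by_cases hj : 2 ≤ n j
  · rw [hbig j hj ⟨i, p⟩ h.ne, hbig j hj ⟨i, _⟩ h.ne] at key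
    simpa using key
  have hsub : ∀ a, ¬ 2 ≤ n a → Subsingleton (Fin (n a)) := fun a ha =>
    Fin.subsingleton_iff_le_one.mpr (by omega)
  have := hsub i hi
  have := hsub j hj
  have := hsub (s i) (by rw [hs]; exact hi)
  have := hsub (s j) (by rw [hs]; exact hj)
  rw [Subsingleton.elim (θ i j h (p, q)).1 p, Subsingleton.elim (θ i j h (p, q)).2 q,
    Subsingleton.elim (τ.perm (s i) (s j) (s.injective.ne h.ne) (α, β)).1 α,
    Subsingleton.elim (τ.perm (s i) (s j) (s.injective.ne h.ne) (α, β)).2 β, mul_comm]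

end PermSet

/-! ### From invertible to unitary intertwiners -/

section Polar

open scoped MatrixOrder ComplexOrder

theorem Matrix.PosSemidef.commute_of_commute_mul_self {ι : Type} [Fintype ι] [DecidableEq ι]
    {N X : Matrix ι ι ℂ} (hN : N.PosSemidef) (h : Commute (N * N) X) : Commute N X := by
  rw [← CFC.sqrt_mul_self N hN.nonneg]
  exact h.cfcₙ_nnreal _

/-- The inverse square root of a positive definite matrix. -/
theorem Matrix.PosDef.exists_inv_sqrt {ι : Type} [Fintype ι] [DecidableEq ι]
    {G : Matrix ι ι ℂ} (hG : G.PosDef) : ∃ P : Matrix ι ι ℂ, P.PosSemidef ∧ P * P = G⁻¹ :=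
  ⟨CFC.sqrt G⁻¹, Matrix.nonneg_iff_posSemidef.mp (CFC.sqrt_nonneg _),
    CFC.sqrt_mul_sqrt_self _ hG.inv.posSemidef.nonneg⟩

end Polar

namespace PermSet

variable {k : ℕ} {n : Fin k → ℕ}

theorem permMat_mul_conjTranspose {ι : Type} [Fintype ι] [DecidableEq ι] (σ : Equiv.Perm ι) :
    (permMat σ)ᴴ * permMat σ = 1 := by
  ext x y
  simp [permMat, Matrix.mul_apply, Matrix.one_apply, apply_ite, eq_comm]

open scoped ComplexOrder in
/-- Invertible matrices that intertwine `θ` and `τ` can be replaced by the unitary parts of their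
polar decompositions, as the tensor product of the positive parts commutes with the permutation
matrices of `τ`. -/
theorem exists_intertwines_of_injective {θ τ : PermSet n} {s : Equiv.Perm (Fin k)}
    (hs : ∀ i, n (s i) = n i) {A : ∀ i : Fin k, Matrix (Fin (n i)) (Fin (n (s i))) ℂ}
    (hA : ∀ i, Function.Injective (A i).mulVec)
    (h : ∀ (i j : Fin k) (h : i < j), permMat (θ i j h) * (A i ⊗ₖ A j) =
      (A i ⊗ₖ A j) * permMat (τ.perm (s i) (s j) (s.injective.ne h.ne))) :
    ∃ U, Intertwines θ τ s U := by
  have hG : ∀ i, ((A i)ᴴ * A i).PosDef := fun i => Matrix.PosDef.conjTranspose_mul_self _ (hA i)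
  choose P hP hPG using fun i => (hG i).exists_inv_sqrt
  have hGu : ∀ i, IsUnit ((A i)ᴴ * A i).det := fun i =>
    (Matrix.isUnit_iff_isUnit_det _).mp (hG i).isUnit
  refine ⟨fun i => A i * P i, fun i => ?_, fun i j hij => ?_⟩
  · have h1 : (A i * P i)ᴴ * (A i * P i) = 1 := by
      have h2 : P i * (((A i)ᴴ * A i) * P i) = 1 := by
        rw [mul_eq_one_comm, Matrix.mul_assoc, hPG, Matrix.mul_nonsing_inv _ (hGu i)]
      rw [Matrix.conjTranspose_mul, (hP i).isHermitian.eq, Matrix.mul_assoc, ← h2,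
        Matrix.mul_assoc (A i)ᴴ]
    exact ⟨(Matrix.mul_eq_one_comm_of_card_eq _ _ _ (by simp [hs])).mp h1, h1⟩
  · have hπ := h i j hij
    set σ := permMat (θ i j hij)
    set ρ := permMat (τ.perm (s i) (s j) (s.injective.ne hij.ne))
    set K := A i ⊗ₖ A j
    have hσ : σᴴ * σ = 1 := permMat_mul_conjTranspose _
    have hρ : ρ * ρᴴ = 1 := mul_eq_one_comm.mp (permMat_mul_conjTranspose _)
    have h1 : Kᴴ * σ = ρ * Kᴴ := by
      have := congrArg Matrix.conjTranspose hπ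
      rw [Matrix.conjTranspose_mul, Matrix.conjTranspose_mul] at this
      calc Kᴴ * σ = ρ * (ρᴴ * Kᴴ) * σ := by rw [← Matrix.mul_assoc ρ, hρ, Matrix.one_mul]
        _ = ρ * Kᴴ := by rw [← this, Matrix.mul_assoc, Matrix.mul_assoc, hσ, Matrix.mul_one]
    have h2 : Commute (Kᴴ * K) ρ := by
      change Kᴴ * K * ρ = ρ * (Kᴴ * K)
      rw [Matrix.mul_assoc, ← hπ, ← Matrix.mul_assoc, h1, Matrix.mul_assoc]
    have h3 : (P i ⊗ₖ P j) * (P i ⊗ₖ P j) = (Kᴴ * K)⁻¹ := by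
      rw [← Matrix.mul_kronecker_mul, hPG, hPG, ← Matrix.inv_kronecker,
        Matrix.conjTranspose_kronecker, ← Matrix.mul_kronecker_mul]
    have h4 : Commute (P i ⊗ₖ P j) ρ := by
      refine ((hP i).kronecker (hP j)).commute_of_commute_mul_self ?_
      rw [h3]
      rw [← Matrix.zpow_neg_one]
      exact Matrix.Commute.zpow_left h2 (-1)
    rw [Matrix.mul_kronecker_mul, ← Matrix.mul_assoc, hπ, Matrix.mul_assoc, ← h4.eq,
      Matrix.mul_assoc]

/-- An invertible relation preserving matrix yields a product unitary equivalence. -/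
theorem PreservesRelations.productUnitarilyEquivalent {θ τ : PermSet n}
    {B : Matrix (Gen n) (Gen n) ℂ} (hQ : PreservesRelations θ τ B) (hB : B.det ≠ 0)
    (hθ : relationCone θ ⊆ minimalCone n) (hn : ∀ i, 1 ≤ n i) :
    ProductUnitarilyEquivalent θ τ := by
  obtain ⟨s, hs, hbig, hsmall⟩ := hQ.exists_perm hB hθ hn
  let A : ∀ i : Fin k, Matrix (Fin (n i)) (Fin (n (s i))) ℂ := fun i =>
    Matrix.of fun p r => B ⟨i, p⟩ ⟨s i, r⟩
  have hA : ∀ (i j : Fin k) (h : i < j), permMat (θ i j h) * (A i ⊗ₖ A j) =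
      (A i ⊗ₖ A j) * permMat (τ.perm (s i) (s j) (s.injective.ne h.ne)) := fun i j h => by
    rw [intertwine_entries_iff h]
    intro p q α β
    exact hQ.intertwine_entries hs hbig h p q α β
  refine ⟨s, exists_intertwines_of_injective hs (fun i => ?_) hA⟩
  rw [← Matrix.coe_mulVecLin, ← LinearMap.ker_eq_bot, LinearMap.ker_eq_bot']
  intro v hv
  have hv' : ∀ p, ∑ r, B ⟨i, p⟩ ⟨s i, r⟩ * v r = 0 := fun p => congrFun hv p
  by_cases hi : 2 ≤ n i
  · refine eq_zero_of_block hB fun x => ?_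
    by_cases hx : x.1 = i
    · obtain ⟨j, p⟩ := x
      obtain rfl : j = i := hx
      exact hv' p
    · exact Finset.sum_eq_zero fun r _ => by rw [hbig i hi x hx, zero_mul]
  · have h1 : n i = 1 := by have := hn i; omega
    have : Subsingleton (Fin (n (s i))) :=
      Fin.subsingleton_iff_le_one.mpr (by rw [hs, h1])
    funext r
    have h2 := hv' ⟨0, hn i⟩
    rw [Fintype.sum_subsingleton _ r] at h2
    exact (mul_eq_zero.mp h2).resolve_left (hsmall i h1 _ r)

end PermSet

/-! ### The first order part of an isometric isomorphism -/

section Density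

variable {S : Type} [Monoid S] [IsCancelMul S]

theorem normToeplitz_induction {P : normToeplitz S → Prop} (closed : IsClosed {X | P X})
    (shift : ∀ u, P ⟨leftShift u, leftShift_mem_normToeplitz _ u⟩) (zero : P 0)
    (add : ∀ A B, P A → P B → P (A + B)) (smul : ∀ (c : ℂ) A, P A → P (c • A))
    (X : normToeplitz S) : P X := by
  have hle : shiftAlgebra S ≤ normToeplitz S := Subalgebra.le_topologicalClosure _
  have h1 : ∀ A (hA : A ∈ shiftAlgebra S), P ⟨A, hle hA⟩ := by
    intro A hA
    obtain ⟨_, h⟩ : ∃ h : A ∈ normToeplitz S, P ⟨A, h⟩ := by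
      refine shiftAlgebra_induction (P := fun A => ∃ h : A ∈ normToeplitz S, P ⟨A, h⟩)
        (fun u => ⟨_, shift u⟩) ⟨_, zero⟩ ?_ ?_ hA
      · rintro A B ⟨hA, hA'⟩ ⟨hB, hB'⟩
        exact ⟨_, add _ _ hA' hB'⟩
      · rintro c A ⟨hA, hA'⟩
        exact ⟨_, smul c _ hA'⟩
    exact h
  have h2 : X ∈ closure {X : normToeplitz S | X.1 ∈ shiftAlgebra S} := by
    rw [closure_subtype]
    refine closure_mono ?_ X.2
    intro A hA
    exact ⟨⟨A, hle hA⟩, hA, rfl⟩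
  exact closed.closure_subset_iff.mpr (fun Y hY => h1 Y.1 hY) h2

end Density

namespace PermSet

variable {k : ℕ} {n : Fin k → ℕ} {θ τ : PermSet n}

/-- A bounded functional on the norm closed algebra with `ψ(L_x S) = z_x ψ(S)` and `ψ(1) = 0`
vanishes. -/
theorem eq_zero_of_map_gen_mul [IsCancelMul (Semigp θ)] {z : ∀ i : Fin k, Fin (n i) → ℂ}
    {ψ : normToeplitz (Semigp θ) →ₗ[ℂ] ℂ}
    (hψ : ∀ (i : Fin k) (p : Fin (n i)) (S : normToeplitz (Semigp θ)),
      ψ (⟨leftShift (gen θ ⟨i, p⟩), leftShift_mem_normToeplitz _ _⟩ * S) = z i p * ψ S)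
    (hb : ∃ C, ∀ S, ‖ψ S‖ ≤ C * ‖S‖) (h1 : ψ 1 = 0) : ψ = 0 := by
  have hψc : Continuous ψ := by
    obtain ⟨C, hC⟩ := hb
    exact (ψ.mkContinuous C hC).continuous
  have hw : ∀ u, ψ ⟨leftShift u, leftShift_mem_normToeplitz _ u⟩ = 0 := by
    intro u
    have hgen : ∀ (x : Gen n) (v : Semigp θ),
        ψ ⟨leftShift v, leftShift_mem_normToeplitz _ v⟩ = 0 →
        ψ ⟨leftShift (gen θ x * v), leftShift_mem_normToeplitz _ _⟩ = 0 := by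
      intro x v hv
      have : (⟨leftShift (gen θ x * v), leftShift_mem_normToeplitz _ _⟩ : normToeplitz (Semigp θ)) =
          ⟨leftShift (gen θ ⟨x.1, x.2⟩), leftShift_mem_normToeplitz _ _⟩ *
            ⟨leftShift v, leftShift_mem_normToeplitz _ v⟩ := Subtype.ext (leftShift_mul _ _)
      rw [this, hψ, hv, mul_zero]
    induction u using induction_gen with
    | one => exact (congrArg ψ (Subtype.ext leftShift_one)).trans h1
    | mul x v ih => exact hgen x v ih
  ext X
  refine normToeplitz_induction (P := fun X => ψ X = 0)
    (isClosed_eq hψc continuous_const) hw (map_zero ψ) ?_ ?_ X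
  · intro A B hA hB
    rw [map_add, hA, hB, add_zero]
  · intro c A hA
    rw [map_smul, hA, smul_zero]

section Relations

variable {T : Gen n → FockSpace (Semigp τ) →L[ℂ] FockSpace (Semigp τ)}
  {B : Matrix (Gen n) (Gen n) ℂ}

/-- If analytic Toeplitz operators `T_x` satisfy the relations of `θ`, and their first order
coefficients form an invertible matrix, then the linearized relations at the point of the constant
coefficients `(T_x ξ_1)(1)` hold for all vectors. -/
theorem linearized_relations (hT : ∀ x, IsToeplitz (T x))
    (hrel : ∀ (i j : Fin k) (h : i < j) (p : Fin (n i)) (q : Fin (n j)),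
      T ⟨i, p⟩ * T ⟨j, q⟩ = T ⟨j, (θ i j h (p, q)).2⟩ * T ⟨i, (θ i j h (p, q)).1⟩)
    (hTB : ∀ x y, T x (fockVec 1) (gen τ y) = B x y) (hB : B.det ≠ 0) (v : Gen n → ℂ)
    {i j : Fin k} (h : i < j) (p : Fin (n i)) (q : Fin (n j)) :
    v ⟨i, p⟩ * T ⟨j, q⟩ (fockVec 1) 1 + T ⟨i, p⟩ (fockVec 1) 1 * v ⟨j, q⟩ =
      v ⟨j, (θ i j h (p, q)).2⟩ * T ⟨i, (θ i j h (p, q)).1⟩ (fockVec 1) 1 +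
        T ⟨j, (θ i j h (p, q)).2⟩ (fockVec 1) 1 * v ⟨i, (θ i j h (p, q)).1⟩ := by
  obtain ⟨a, rfl⟩ : ∃ a, B *ᵥ a = v :=
    ⟨B⁻¹ *ᵥ v, by rw [Matrix.mulVec_mulVec, Matrix.mul_nonsing_inv _ (isUnit_iff_ne_zero.mpr hB),
      Matrix.one_mulVec]⟩
  have key : ∀ y, B ⟨i, p⟩ y * T ⟨j, q⟩ (fockVec 1) 1 + T ⟨i, p⟩ (fockVec 1) 1 * B ⟨j, q⟩ y =
      B ⟨j, (θ i j h (p, q)).2⟩ y * T ⟨i, (θ i j h (p, q)).1⟩ (fockVec 1) 1 +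
        T ⟨j, (θ i j h (p, q)).2⟩ (fockVec 1) 1 * B ⟨i, (θ i j h (p, q)).1⟩ y := by
    intro y
    have h1 := congrArg (fun X : FockSpace (Semigp τ) →L[ℂ] FockSpace (Semigp τ) =>
      X (fockVec 1) (gen τ y)) (hrel i j h p q)
    simp only [mul_apply_eq_comp, (hT _).apply_gen (T _ (fockVec 1)), hTB] at h1
    linear_combination h1
  simp only [Matrix.mulVec, dotProduct, Finset.sum_mul, Finset.mul_sum, ← Finset.sum_add_distrib]
  exact Finset.sum_congr rfl fun y _ => by linear_combination a y * key y

/-- The first order coefficients of analytic Toeplitz operators that satisfy the relations of `θ`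
preserve the quadratic relations. The terms of the second order coefficients of a product that
involve constant coefficients cancel by the linearized relations. -/
theorem preservesRelations_of_isToeplitz [IsCancelMul (Semigp τ)] (hT : ∀ x, IsToeplitz (T x))
    (hrel : ∀ (i j : Fin k) (h : i < j) (p : Fin (n i)) (q : Fin (n j)),
      T ⟨i, p⟩ * T ⟨j, q⟩ = T ⟨j, (θ i j h (p, q)).2⟩ * T ⟨i, (θ i j h (p, q)).1⟩)
    (hTB : ∀ x y, T x (fockVec 1) (gen τ y) = B x y) (hB : B.det ≠ 0) :
    PreservesRelations θ τ B := by
  classical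
  have key : ∀ (i j : Fin k) (h : i < j) (p : Fin (n i)) (q : Fin (n j)) (w : Semigp τ),
      length τ w = 2 →
      (∑ x, ∑ y, if gen τ x * gen τ y = w then B ⟨i, p⟩ x * B ⟨j, q⟩ y else 0) =
        ∑ x, ∑ y, if gen τ x * gen τ y = w then
          B ⟨j, (θ i j h (p, q)).2⟩ x * B ⟨i, (θ i j h (p, q)).1⟩ y else 0 := by
    intro i j h p q w hw
    have h1 := congrArg (fun X : FockSpace (Semigp τ) →L[ℂ] FockSpace (Semigp τ) =>
      X (fockVec 1) w) (hrel i j h p q)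
    simp only [mul_apply_eq_comp,
      (hT _).apply_of_length_two (T _ (fockVec 1)) hw, hTB] at h1
    have h2 := linearized_relations hT hrel hTB hB (fun x => T x (fockVec 1) w) h p q
    linear_combination h1 - h2
  constructor
  · intro i l h p q j r r'
    have h1 := key i l h p q (gen τ ⟨j, r⟩ * gen τ ⟨j, r'⟩)
      (by rw [length_mul, length_gen, length_gen])
    simpa only [gen_mul_gen_eq_iff_same, ite_and, Finset.sum_ite_irrel, Finset.sum_const_zero,
      Finset.sum_ite_eq', Finset.sum_ite_eq, Finset.mem_univ, if_true] using h1
  · intro i l h p q a b hab α β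
    have h1 := key i l h p q (gen τ ⟨a, α⟩ * gen τ ⟨b, β⟩)
      (by rw [length_mul, length_gen, length_gen])
    have hsplit : ∀ (f : Gen n → Gen n → ℂ),
        (∑ x, ∑ y, if gen τ x * gen τ y = gen τ ⟨a, α⟩ * gen τ ⟨b, β⟩ then f x y else 0) =
          f ⟨a, α⟩ ⟨b, β⟩ + f ⟨b, (τ.perm a b hab (α, β)).2⟩ ⟨a, (τ.perm a b hab (α, β)).1⟩ := by
      intro f
      have : ∀ x y, (if gen τ x * gen τ y = gen τ ⟨a, α⟩ * gen τ ⟨b, β⟩ then f x y else 0) =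
          (if x = ⟨a, α⟩ then (if y = ⟨b, β⟩ then f x y else 0) else 0) +
          (if x = ⟨b, (τ.perm a b hab (α, β)).2⟩ then
            (if y = ⟨a, (τ.perm a b hab (α, β)).1⟩ then f x y else 0) else 0) := by
        intro x y
        rw [← ite_and, ← ite_and]
        have h2 := gen_mul_gen_eq_iff (θ := τ) hab α β x y
        by_cases h3 : x = ⟨a, α⟩ ∧ y = ⟨b, β⟩
        · have h4 : ¬ (x = ⟨b, (τ.perm a b hab (α, β)).2⟩ ∧
              y = ⟨a, (τ.perm a b hab (α, β)).1⟩) := by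
            rintro ⟨h4, -⟩
            exact hab (congrArg Sigma.fst (h3.1.symm.trans h4))
          rw [if_pos h3, if_neg h4, if_pos (h2.mpr (Or.inl h3)), add_zero]
        · rw [if_neg h3, zero_add]
          exact if_congr (h2.trans (or_iff_right h3)) rfl rfl
      simp only [this, Finset.sum_add_distrib, Finset.sum_ite_irrel, Finset.sum_const_zero,
        Finset.sum_ite_eq', Finset.mem_univ, if_true]
    rwa [hsplit, hsplit] at h1

end Relations

section Isomorphism

variable [IsCancelMul (Semigp θ)]
  {𝒜 : Subalgebra ℂ (FockSpace (Semigp θ) →L[ℂ] FockSpace (Semigp θ))}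
  {𝒞 : Subalgebra ℂ (FockSpace (Semigp τ) →L[ℂ] FockSpace (Semigp τ))}

theorem relations_of_algEquiv (h𝒜 : ∀ u, leftShift u ∈ 𝒜) (Φ : 𝒜 ≃ₐ[ℂ] 𝒞)
    (i j : Fin k) (h : i < j) (p : Fin (n i)) (q : Fin (n j)) :
    (Φ ⟨_, h𝒜 (gen θ ⟨i, p⟩)⟩ : FockSpace (Semigp τ) →L[ℂ] FockSpace (Semigp τ)) *
        Φ ⟨_, h𝒜 (gen θ ⟨j, q⟩)⟩ =
      (Φ ⟨_, h𝒜 (gen θ ⟨j, (θ i j h (p, q)).2⟩)⟩ :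
        FockSpace (Semigp τ) →L[ℂ] FockSpace (Semigp τ)) *
        Φ ⟨_, h𝒜 (gen θ ⟨i, (θ i j h (p, q)).1⟩)⟩ := by
  rw [← MulMemClass.coe_mul, ← MulMemClass.coe_mul, ← map_mul, ← map_mul]
  congr 2
  refine Subtype.ext ?_
  change leftShift _ * leftShift _ = leftShift _ * leftShift _
  rw [← leftShift_mul, ← leftShift_mul, gen_mul_gen]

/-- The constant coefficients of the images of the generators under an isometric isomorphism form
a point of the open polyball: at a boundary point some contraction would be mapped to the
identity. -/
theorem sum_norm_sq_lt_one_of_isometry (h𝒜 : ∀ u, leftShift u ∈ 𝒜)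
    (h𝒞 : ∀ T ∈ 𝒞, IsToeplitz T) (Φ : 𝒜 ≃ₐ[ℂ] 𝒞) (hΦ : Isometry Φ) (i : Fin k) :
    ∑ p, ‖(Φ ⟨_, h𝒜 (gen θ ⟨i, p⟩)⟩ : FockSpace (Semigp τ) →L[ℂ] FockSpace (Semigp τ))
      (fockVec 1) 1‖ ^ 2 < 1 := by
  have hnorm : ∀ S, ‖Φ S‖ = ‖S‖ := (AddMonoidHomClass.isometry_iff_norm Φ).mp hΦ
  set z : Fin (n i) → ℂ := fun p =>
    (Φ ⟨_, h𝒜 (gen θ ⟨i, p⟩)⟩ : FockSpace (Semigp τ) →L[ℂ] FockSpace (Semigp τ)) (fockVec 1) 1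
  change ∑ p, ‖z p‖ ^ 2 < 1
  by_contra hcon
  set R : ℝ := ∑ p, ‖z p‖ ^ 2
  have hR : 1 ≤ R := not_lt.mp hcon
  have hR0 : (R : ℂ) ≠ 0 := by
    rw [Complex.ofReal_ne_zero]
    linarith
  -- a contraction with `(Φ(S) ξ_1)(1) = 1`, so that `Φ(S)` fixes `ξ_1` and is the identity
  let S : 𝒜 := ∑ p, (starRingEnd ℂ (z p) / R) • ⟨_, h𝒜 (gen θ ⟨i, p⟩)⟩
  have hS : (S : FockSpace (Semigp θ) →L[ℂ] FockSpace (Semigp θ)) =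
      ∑ p, (starRingEnd ℂ (z p) / R) • leftShift (gen θ ⟨i, p⟩) := by
    simp [S]
  have hS1 : ‖S‖ ≤ 1 := by
    change ‖(S : FockSpace (Semigp θ) →L[ℂ] FockSpace (Semigp θ))‖ ≤ 1
    rw [hS]
    refine (norm_sum_gen_le i _).trans ?_
    rw [Real.sqrt_le_one]
    have : ∀ p, ‖starRingEnd ℂ (z p) / R‖ ^ 2 = ‖z p‖ ^ 2 / R ^ 2 := fun p => by
      rw [norm_div, RCLike.norm_conj, div_pow, Complex.norm_real, Real.norm_eq_abs, sq_abs]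
    simp only [this]
    rw [← Finset.sum_div, div_le_one (by positivity)]
    nlinarith
  have hone : (Φ S : FockSpace (Semigp τ) →L[ℂ] FockSpace (Semigp τ)) (fockVec 1) 1 = 1 := by
    have h1 : (Φ S : FockSpace (Semigp τ) →L[ℂ] FockSpace (Semigp τ)) =
        ∑ p, (starRingEnd ℂ (z p) / R) •
          (Φ ⟨_, h𝒜 (gen θ ⟨i, p⟩)⟩ : FockSpace (Semigp τ) →L[ℂ] FockSpace (Semigp τ)) := by
      simp only [S, map_sum, map_smul, AddSubmonoidClass.coe_finsetSum, Subalgebra.coe_smul]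
    have h2 : (Φ S : FockSpace (Semigp τ) →L[ℂ] FockSpace (Semigp τ)) (fockVec 1) 1 =
        ∑ p, starRingEnd ℂ (z p) / R * z p := by
      rw [h1, ← coord_apply, sum_apply, map_sum]
      exact Finset.sum_congr rfl fun p _ => by
        rw [smul_apply, map_smul, coord_apply, smul_eq_mul]
    rw [h2]
    have h3 : ∀ p, starRingEnd ℂ (z p) / R * z p = ((‖z p‖ ^ 2 : ℝ) : ℂ) / R := fun p => by
      rw [div_mul_eq_mul_div, Complex.conj_mul', Complex.ofReal_pow]
    rw [Finset.sum_congr rfl fun p _ => h3 p, ← Finset.sum_div, ← Complex.ofReal_sum,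
      div_self hR0]
  have hfix : (Φ S : FockSpace (Semigp τ) →L[ℂ] FockSpace (Semigp τ)) (fockVec 1) = fockVec 1 := by
    have h1 : ‖(Φ S : FockSpace (Semigp τ) →L[ℂ] FockSpace (Semigp τ)) (fockVec 1)‖ ≤ 1 := by
      refine (ContinuousLinearMap.le_opNorm _ _).trans ?_
      rw [norm_fockVec, mul_one]
      exact (hnorm S).trans_le hS1
    have h2 : inner ℂ (fockVec 1)
        ((Φ S : FockSpace (Semigp τ) →L[ℂ] FockSpace (Semigp τ)) (fockVec 1)) = 1 := by
      rw [inner_fockVec_left, hone]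
    have h3 := norm_sub_sq (𝕜 := ℂ)
      ((Φ S : FockSpace (Semigp τ) →L[ℂ] FockSpace (Semigp τ)) (fockVec 1)) (fockVec 1)
    rw [← inner_conj_symm, h2, map_one, norm_fockVec, RCLike.one_re] at h3
    have h4 : ‖(Φ S : FockSpace (Semigp τ) →L[ℂ] FockSpace (Semigp τ)) (fockVec 1) - fockVec 1‖
        ^ 2 ≤ 0 := by
      nlinarith [norm_nonneg
        ((Φ S : FockSpace (Semigp τ) →L[ℂ] FockSpace (Semigp τ)) (fockVec 1))]
    have h5 := pow_eq_zero_iff (two_ne_zero) |>.mp (le_antisymm h4 (sq_nonneg _))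
    exact sub_eq_zero.mp (norm_eq_zero.mp h5)
  have hΦS : Φ S = 1 := Subtype.ext ((h𝒞 _ (Φ S).2).ext (h𝒞 _ (1 : 𝒞).2) hfix)
  have hS' : S = 1 := Φ.injective (hΦS.trans (map_one Φ).symm)
  have h1 : (S : FockSpace (Semigp θ) →L[ℂ] FockSpace (Semigp θ)) (fockVec 1) 1 = 1 := by
    rw [hS']
    exact fockVec_apply_self 1
  rw [hS, ← coord_apply, sum_apply, map_sum, Finset.sum_eq_zero] at h1
  · exact zero_ne_one h1
  · intro p _
    rw [smul_apply, map_smul, coord_apply, leftShift_fockVec_one,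
      fockVec_apply_of_ne (gen_ne_one _).symm, smul_zero]

variable [IsCancelMul (Semigp τ)]

/-- The first order coefficients of the images of the generators under an isometric isomorphism
form an invertible matrix. A vector in its kernel gives a point derivation that vanishes on the
generators, hence vanishes identically. -/
theorem det_ne_zero_of_isometry (h𝒜 : ∀ u, leftShift u ∈ 𝒜) (h𝒞' : ∀ u, leftShift u ∈ 𝒞)
    (h𝒞 : ∀ T ∈ 𝒞, IsToeplitz T)
    (huniq : ∀ (z : ∀ i : Fin k, Fin (n i) → ℂ) (ψ : 𝒜 →ₗ[ℂ] ℂ),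
      (∀ i, ∑ p, ‖z i p‖ ^ 2 < 1) →
      (∀ i p S, ψ (⟨_, h𝒜 (gen θ ⟨i, p⟩)⟩ * S) = z i p * ψ S) →
      (∃ C, ∀ S, ‖ψ S‖ ≤ C * ‖S‖) → ψ 1 = 0 → ψ = 0)
    (Φ : 𝒜 ≃ₐ[ℂ] 𝒞) (hΦ : Isometry Φ) {B : Matrix (Gen n) (Gen n) ℂ}
    (hB : ∀ x y, (Φ ⟨_, h𝒜 (gen θ x)⟩ : FockSpace (Semigp τ) →L[ℂ] FockSpace (Semigp τ))
      (fockVec 1) (gen τ y) = B x y) : B.det ≠ 0 := by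
  classical
  intro hdet
  obtain ⟨a, ha, hBa⟩ := Matrix.exists_mulVec_eq_zero_iff.mpr hdet
  have hnorm : ∀ S, ‖Φ S‖ = ‖S‖ := (AddMonoidHomClass.isometry_iff_norm Φ).mp hΦ
  let δ₀ : FockSpace (Semigp τ) →L[ℂ] ℂ := ∑ y, a y • coord (gen τ y)
  have hδ₀ : ∀ f, δ₀ f = ∑ y, a y * f (gen τ y) := fun f => by
    simp [δ₀, coord_apply, sum_apply]
  -- the point derivation `δ(S) = ∑_y a_y (Φ(S) ξ_1)(y)`
  let δ : 𝒜 →ₗ[ℂ] ℂ :=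
    { toFun := fun S => δ₀ ((Φ S : FockSpace (Semigp τ) →L[ℂ] FockSpace (Semigp τ)) (fockVec 1))
      map_add' := fun S S' => by
        rw [map_add, Subalgebra.coe_add, add_apply, map_add]
      map_smul' := fun c S => by
        rw [map_smul, Subalgebra.coe_smul, smul_apply, map_smul, RingHom.id_apply] }
  have hδ : ∀ S, δ S =
      ∑ y, a y * (Φ S : FockSpace (Semigp τ) →L[ℂ] FockSpace (Semigp τ)) (fockVec 1) (gen τ y) :=
    fun S => hδ₀ _
  have hmul : ∀ S S', δ (S * S') =
      (Φ S : FockSpace (Semigp τ) →L[ℂ] FockSpace (Semigp τ)) (fockVec 1) 1 * δ S' +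
        δ S * (Φ S' : FockSpace (Semigp τ) →L[ℂ] FockSpace (Semigp τ)) (fockVec 1) 1 := by
    intro S S'
    simp only [hδ, map_mul, MulMemClass.coe_mul, mul_apply_eq_comp,
      (h𝒞 _ (Φ S).2).apply_gen ((Φ S').1 (fockVec 1)), Finset.mul_sum, Finset.sum_mul,
      ← Finset.sum_add_distrib]
    exact Finset.sum_congr rfl fun y _ => by ring
  have hδ0 : δ = 0 := by
    refine huniq (fun i p => (Φ ⟨_, h𝒜 (gen θ ⟨i, p⟩)⟩ :
      FockSpace (Semigp τ) →L[ℂ] FockSpace (Semigp τ)) (fockVec 1) 1) δ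
      (sum_norm_sq_lt_one_of_isometry h𝒜 h𝒞 Φ hΦ) ?_ ⟨‖δ₀‖, fun S => ?_⟩ ?_
    · intro i p S
      have h1 : δ ⟨_, h𝒜 (gen θ ⟨i, p⟩)⟩ = 0 := by
        rw [hδ]
        simp only [hB]
        have := congrFun hBa ⟨i, p⟩
        simp only [Matrix.mulVec, dotProduct, Pi.zero_apply] at this
        rw [← this]
        exact Finset.sum_congr rfl fun y _ => mul_comm _ _
      rw [hmul, h1, zero_mul, add_zero]
    · refine (δ₀.le_opNorm _).trans (mul_le_mul_of_nonneg_left ?_ (norm_nonneg _))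
      refine (ContinuousLinearMap.le_opNorm _ _).trans ?_
      rw [norm_fockVec, mul_one]
      exact (hnorm S).le
    · rw [hδ]
      refine Finset.sum_eq_zero fun y _ => ?_
      rw [map_one]
      change a y * (fockVec 1 : FockSpace (Semigp τ)) (gen τ y) = 0
      rw [fockVec_apply_of_ne (gen_ne_one y), mul_zero]
  refine ha (funext fun y => ?_)
  have h1 := DFunLike.congr_fun hδ0 (Φ.symm ⟨_, h𝒞' (gen τ y)⟩)
  rw [hδ, AlgEquiv.apply_symm_apply] at h1
  simpa [leftShift_fockVec_one, fockVec_apply, gen_injective.eq_iff] using h1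

/-- The first order coefficients of an isometric isomorphism. -/
theorem preservesRelations_of_isometry (h𝒜 : ∀ u, leftShift u ∈ 𝒜)
    (h𝒞 : ∀ T ∈ 𝒞, IsToeplitz T) (Φ : 𝒜 ≃ₐ[ℂ] 𝒞) {B : Matrix (Gen n) (Gen n) ℂ}
    (hB : ∀ x y, (Φ ⟨_, h𝒜 (gen θ x)⟩ : FockSpace (Semigp τ) →L[ℂ] FockSpace (Semigp τ))
      (fockVec 1) (gen τ y) = B x y) (hdet : B.det ≠ 0) : PreservesRelations θ τ B :=
  preservesRelations_of_isToeplitz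
    (fun _ => h𝒞 _ (Φ _).2) (relations_of_algEquiv h𝒜 Φ) hB hdet

theorem productUnitarilyEquivalent_of_norm (hθ : relationCone θ ⊆ minimalCone n)
    (hn : ∀ i, 1 ≤ n i) (Φ : normToeplitz (Semigp θ) ≃ₐ[ℂ] normToeplitz (Semigp τ))
    (hΦ : Isometry Φ) : ProductUnitarilyEquivalent θ τ := by
  have hT : ∀ T ∈ normToeplitz (Semigp τ), IsToeplitz T := fun T hT =>
    isToeplitz_of_mem_weakToeplitz (normToeplitz_le_weakToeplitz hT)
  have hdet := det_ne_zero_of_isometry (leftShift_mem_normToeplitz _) (leftShift_mem_normToeplitz _) hT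
    (fun z ψ _ h2 h3 h4 => eq_zero_of_map_gen_mul (z := z) h2 h3 h4) Φ hΦ (fun _ _ => rfl)
  exact (preservesRelations_of_isometry (leftShift_mem_normToeplitz _) hT Φ (fun _ _ => rfl)
    hdet).productUnitarilyEquivalent hdet hθ hn

theorem productUnitarilyEquivalent_of_weak (hθ : relationCone θ ⊆ minimalCone n)
    (hn : ∀ i, 1 ≤ n i) (Φ : weakToeplitz (Semigp θ) ≃ₐ[ℂ] weakToeplitz (Semigp τ))
    (hΦ : Isometry Φ) : ProductUnitarilyEquivalent θ τ := by
  have hT : ∀ T ∈ weakToeplitz (Semigp τ), IsToeplitz T := fun T hT =>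
    isToeplitz_of_mem_weakToeplitz hT
  have hdet := det_ne_zero_of_isometry leftShift_mem_weakToeplitz leftShift_mem_weakToeplitz hT
    (fun z ψ h1 h2 h3 h4 => IsShiftEigen.eq_zero ⟨h2, h3⟩ h1 h4) Φ hΦ (fun _ _ => rfl)
  exact (preservesRelations_of_isometry leftShift_mem_weakToeplitz hT Φ (fun _ _ => rfl)
    hdet).productUnitarilyEquivalent hdet hθ hn

end Isomorphism

end PermSet

/-! ### The unitary operators implementing product unitary equivalences -/

section Conjugation

variable {S S' : Type}

/-- Conjugation by a unitary operator. -/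
def conjBy (U : FockSpace S ≃ₗᵢ[ℂ] FockSpace S') :
    (FockSpace S →L[ℂ] FockSpace S) ≃ₐ[ℂ] (FockSpace S' →L[ℂ] FockSpace S') :=
  U.toContinuousLinearEquiv.conjContinuousAlgEquiv.toAlgEquiv

variable {U : FockSpace S ≃ₗᵢ[ℂ] FockSpace S'}

theorem conjBy_apply (X : FockSpace S →L[ℂ] FockSpace S) (f : FockSpace S') :
    conjBy U X f = U (X (U.symm f)) := rfl

theorem isometry_conjBy : Isometry (conjBy U) := by
  refine AddMonoidHomClass.isometry_of_norm (conjBy U) fun X => le_antisymm ?_ ?_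
  · refine ContinuousLinearMap.opNorm_le_bound _ (norm_nonneg _) fun f => ?_
    rw [conjBy_apply, U.norm_map]
    refine (X.le_opNorm _).trans_eq ?_
    rw [U.symm.norm_map]
  · refine ContinuousLinearMap.opNorm_le_bound _ (norm_nonneg _) fun f => ?_
    have h := (conjBy U X).le_opNorm (U f)
    rwa [conjBy_apply, U.symm_apply_apply, U.norm_map, U.norm_map] at h

/-- Conjugation by a unitary operator, restricted to subalgebras. -/
def conjByRestrict {𝒜 : Subalgebra ℂ (FockSpace S →L[ℂ] FockSpace S)}
    {𝒞 : Subalgebra ℂ (FockSpace S' →L[ℂ] FockSpace S')}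
    (h : 𝒜.map (conjBy U).toAlgHom = 𝒞) : 𝒜 ≃ₐ[ℂ] 𝒞 :=
  ((conjBy U).subalgebraMap 𝒜).trans (Subalgebra.equivOfEq _ _ h)

theorem isometry_conjByRestrict {𝒜 : Subalgebra ℂ (FockSpace S →L[ℂ] FockSpace S)}
    {𝒞 : Subalgebra ℂ (FockSpace S' →L[ℂ] FockSpace S')}
    (h : 𝒜.map (conjBy U).toAlgHom = 𝒞) : Isometry (conjByRestrict h) :=
  fun X Y => isometry_conjBy (U := U) X Y

variable [Monoid S] [IsCancelMul S] [Monoid S'] [IsCancelMul S']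

theorem map_normToeplitz (h : (shiftAlgebra S).map (conjBy U).toAlgHom = shiftAlgebra S') :
    (normToeplitz S).map (conjBy U).toAlgHom = normToeplitz S' := by
  refine SetLike.coe_injective ?_
  have h' : conjBy U '' shiftAlgebra S = shiftAlgebra S' := congrArg SetLike.coe h
  change conjBy U '' closure (shiftAlgebra S : Set _) = closure (shiftAlgebra S' : Set _)
  rw [← h']
  exact U.toContinuousLinearEquiv.conjContinuousAlgEquiv.toHomeomorph.image_closure _

theorem conjBy_mem_weakToeplitz (h : ∀ X ∈ shiftAlgebra S, conjBy U X ∈ shiftAlgebra S')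
    {X : FockSpace S →L[ℂ] FockSpace S} (hX : X ∈ weakToeplitz S) :
    conjBy U X ∈ weakToeplitz S' := by
  rw [mem_weakToeplitz_iff] at hX ⊢
  have hc : Continuous fun A : FockSpace S →WOT[ℂ] FockSpace S =>
      ContinuousLinearMapWOT.ofCLM (conjBy U A.toCLM) := by
    refine ContinuousLinearMapWOT.continuous_of_dual_apply_continuous fun f y => ?_
    exact ContinuousLinearMapWOT.continuous_dual_apply (U.symm f)
      (y.comp (U.toContinuousLinearEquiv : FockSpace S →L[ℂ] FockSpace S'))
  exact map_mem_closure (f := fun A : FockSpace S →WOT[ℂ] FockSpace S =>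
    ContinuousLinearMapWOT.ofCLM (conjBy U A.toCLM)) hc hX fun A hA => h _ hA

theorem map_weakToeplitz (h : (shiftAlgebra S).map (conjBy U).toAlgHom = shiftAlgebra S') :
    (weakToeplitz S).map (conjBy U).toAlgHom = weakToeplitz S' := by
  refine le_antisymm ?_ ?_
  · rintro _ ⟨X, hX, rfl⟩
    exact conjBy_mem_weakToeplitz (fun Y hY => h.le ⟨Y, hY, rfl⟩) hX
  · intro Y hY
    refine ⟨conjBy U.symm Y, conjBy_mem_weakToeplitz (fun Z hZ => ?_) hY, ?_⟩
    · obtain ⟨X, hX, rfl⟩ := h.ge hZ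
      have : conjBy U.symm (conjBy U X) = X := by
        ext f : 1
        change U.symm (U (X (U.symm (U f)))) = X f
        rw [U.symm_apply_apply, U.symm_apply_apply]
      change conjBy U.symm (conjBy U X) ∈ shiftAlgebra S
      rw [this]
      exact hX
    · ext f : 1
      change U (U.symm (Y (U (U.symm f)))) = Y f
      rw [U.apply_symm_apply, U.apply_symm_apply]

end Conjugation

namespace PermSet

variable {k : ℕ} {n : Fin k → ℕ} {θ τ : PermSet n} {s : Equiv.Perm (Fin k)}
  {A : ∀ i : Fin k, Matrix (Fin (n i)) (Fin (n (s i))) ℂ}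

section Rows

theorem Intertwines.sum_row (h : Intertwines θ τ s A) (i : Fin k) (p q : Fin (n i)) :
    ∑ r, starRingEnd ℂ (A i p r) * A i q r = if p = q then 1 else 0 := by
  have := congrFun (congrFun (h.1 i).1 q) p
  rw [Matrix.mul_apply, Matrix.one_apply] at this
  rw [if_congr (eq_comm (a := p)) rfl rfl, ← this]
  exact Finset.sum_congr rfl fun r _ => mul_comm _ _

theorem Intertwines.sum_col (h : Intertwines θ τ s A) (i : Fin k) (r t : Fin (n (s i))) :
    ∑ p, starRingEnd ℂ (A i p r) * A i p t = if r = t then 1 else 0 := by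
  have := congrFun (congrFun (h.1 i).2 r) t
  rwa [Matrix.mul_apply, Matrix.one_apply] at this

end Rows

variable [IsCancelMul (Semigp τ)]

theorem letterOp_mem_shiftAlgebra (x : Gen n) : letterOp τ s A x ∈ shiftAlgebra (Semigp τ) :=
  Subalgebra.sum_mem _ fun _ _ => Subalgebra.smul_mem _ (leftShift_mem_shiftAlgebra _) _

theorem Intertwines.letterOp_mul_letterOp (hA : Intertwines θ τ s A) {i j : Fin k} (h : i < j)
    (p : Fin (n i)) (q : Fin (n j)) :
    letterOp τ s A ⟨i, p⟩ * letterOp τ s A ⟨j, q⟩ =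
      letterOp τ s A ⟨j, (θ i j h (p, q)).2⟩ * letterOp τ s A ⟨i, (θ i j h (p, q)).1⟩ := by
  have h1 := (intertwine_entries_iff h).mp (hA.2 i j h) p q
  simp only [letterOp, Finset.sum_mul_sum, smul_mul_smul_comm, ← leftShift_mul]
  rw [← Fintype.sum_prod_type', Finset.sum_comm, ← Fintype.sum_prod_type']
  refine Fintype.sum_equiv (τ.perm (s i) (s j) (s.injective.ne h.ne)) _ _ ?_
  rintro ⟨α, β⟩
  dsimp only
  rw [h1, gen_mul_gen_perm τ (s.injective.ne h.ne)]

/-- The representation of `𝔽⁺_θ` on the Fock space of `𝔽⁺_τ` that sends the generators to the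
operators `L_{A e_{ip}}`. -/
def Intertwines.rep (hA : Intertwines θ τ s A) :
    Semigp θ →* (FockSpace (Semigp τ) →L[ℂ] FockSpace (Semigp τ)) :=
  PresentedMonoid.lift (letterOp τ s A) (by
    rintro _ _ ⟨i, j, h, p, q⟩
    simp only [map_mul, FreeMonoid.lift_eval_of]
    exact hA.letterOp_mul_letterOp h p q)

theorem Intertwines.rep_gen (hA : Intertwines θ τ s A) (x : Gen n) :
    hA.rep (gen θ x) = letterOp τ s A x := rfl

theorem letterOp_apply (x : Gen n) (f : FockSpace (Semigp τ)) :
    letterOp τ s A x f = ∑ q, A x.1 x.2 q • leftShift (gen τ ⟨s x.1, q⟩) f := by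
  simp [letterOp, sum_apply]

theorem Intertwines.inner_letterOp (hA : Intertwines θ τ s A) (i : Fin k) (p q : Fin (n i))
    (f g : FockSpace (Semigp τ)) :
    inner ℂ (letterOp τ s A ⟨i, p⟩ f) (letterOp τ s A ⟨i, q⟩ g) =
      if p = q then inner ℂ f g else 0 := by
  simp only [letterOp_apply, sum_inner, inner_sum, inner_smul_left, inner_smul_right,
    inner_gen_gen, mul_ite, mul_zero, Finset.sum_ite_eq', Finset.mem_univ, if_true]
  have h : (if p = q then inner ℂ f g else 0) =
      (∑ r, starRingEnd ℂ (A i p r) * A i q r) * inner ℂ f g := by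
    rw [hA.sum_row, ite_mul, one_mul, zero_mul]
  rw [h, Finset.sum_mul]
  exact Finset.sum_congr rfl fun r _ => by ring

/-- The vector `T_w ξ_1` is supported on the elements whose multidegree is that of `w`, relabelled by
`s`. -/
theorem Intertwines.blockDeg_of_rep_ne_zero (hA : Intertwines θ τ s A) (w : Semigp θ) :
    ∀ u, hA.rep w (fockVec 1) u ≠ 0 → ∀ i, blockDeg τ (s i) u = blockDeg θ i w := by
  classical
  induction w using induction_gen with
  | one =>
    intro u hu i
    rw [map_one] at hu
    have : u = 1 := by
      by_contra h
      exact hu (fockVec_apply_of_ne h)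
    rw [this, blockDeg_one, blockDeg_one]
  | mul x w ih =>
    intro u hu i
    rw [map_mul, hA.rep_gen, mul_apply_eq_comp, letterOp_apply, ← coord_apply, map_sum] at hu
    obtain ⟨q, -, hq⟩ := Finset.exists_ne_zero_of_sum_ne_zero hu
    rw [map_smul, coord_apply, smul_eq_mul] at hq
    by_cases hv : ∃ v, u = gen τ ⟨s x.1, q⟩ * v
    · obtain ⟨v, rfl⟩ := hv
      rw [leftShift_apply_mul] at hq
      rw [blockDeg_mul, blockDeg_mul, ih v (right_ne_zero_of_mul hq), blockDeg_gen, blockDeg_gen]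
      simp [s.injective.eq_iff]
    · rw [leftShift_apply_of_ne (fun v h => hv ⟨v, h⟩), mul_zero] at hq
      exact absurd rfl hq

theorem Intertwines.inner_rep_eq_zero (hA : Intertwines θ τ s A) {w w' : Semigp θ} {i : Fin k}
    (h : blockDeg θ i w ≠ blockDeg θ i w') :
    inner ℂ (hA.rep w (fockVec 1)) (hA.rep w' (fockVec 1)) = 0 := by
  rw [lp.inner_eq_tsum]
  refine (tsum_congr fun u => ?_).trans tsum_zero
  by_contra hu
  rw [RCLike.inner_apply] at hu
  refine h ?_
  rw [← hA.blockDeg_of_rep_ne_zero w u (fun h0 => hu (by rw [h0, map_zero, mul_zero])) i,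
    ← hA.blockDeg_of_rep_ne_zero w' u (fun h0 => hu (by rw [h0, zero_mul])) i]

theorem eq_one_of_blockDeg {w : Semigp θ} (h : ∀ i, blockDeg θ i w = 0) : w = 1 := by
  rcases eq_one_or_exists_gen_mul w with rfl | ⟨x, u, rfl⟩
  · rfl
  · have := h x.1
    rw [blockDeg_mul, blockDeg_gen, if_pos rfl] at this
    omega

variable [IsCancelMul (Semigp θ)]

/-- Letters of one block act as isometries with orthogonal ranges, and elements of different
degrees have disjointly supported images. -/
theorem Intertwines.orthonormal_rep (hA : Intertwines θ τ s A) :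
    Orthonormal ℂ fun w : Semigp θ => hA.rep w (fockVec 1) := by
  classical
  rw [orthonormal_iff_ite]
  intro w
  induction w using induction_gen with
  | one =>
    intro w'
    by_cases h : ∀ i, blockDeg θ i w' = 0
    · rw [eq_one_of_blockDeg h, if_pos rfl, map_one]
      change inner ℂ (fockVec 1 : FockSpace (Semigp τ)) (fockVec 1) = 1
      rw [inner_fockVec_left, fockVec_apply_self]
    · push Not at h
      obtain ⟨i, hi⟩ := h
      rw [hA.inner_rep_eq_zero (i := i) (by rw [blockDeg_one]; exact hi.symm), if_neg]
      rintro rfl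
      exact hi (blockDeg_one i)
  | mul x u ih =>
    intro w'
    obtain ⟨i, p⟩ := x
    by_cases h : blockDeg θ i (gen θ ⟨i, p⟩ * u) = blockDeg θ i w'
    · obtain ⟨q, u', rfl⟩ := exists_gen_mul_of_blockDeg (i := i) (w := w') (by
        rw [← h, blockDeg_mul, blockDeg_gen, if_pos rfl]
        omega)
      rw [map_mul, map_mul, hA.rep_gen, hA.rep_gen, mul_apply_eq_comp, mul_apply_eq_comp,
        hA.inner_letterOp, ih, ← ite_and]
      exact if_congr gen_mul_inj.symm rfl rfl
    · rw [hA.inner_rep_eq_zero h, if_neg]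
      rintro rfl
      exact h rfl

/-- The isometry `ξ_w ↦ T_w ξ_1` from the Fock space of `θ` to that of `τ`. -/
def Intertwines.isometry (hA : Intertwines θ τ s A) :
    FockSpace (Semigp θ) →ₗᵢ[ℂ] FockSpace (Semigp τ) :=
  hA.orthonormal_rep.orthogonalFamily.linearIsometry

theorem Intertwines.isometry_fockVec (hA : Intertwines θ τ s A) (w : Semigp θ) :
    hA.isometry (fockVec w) = hA.rep w (fockVec 1) := by
  classical
  have h := hA.orthonormal_rep.orthogonalFamily.linearIsometry_apply_single (i := w) (1 : ℂ)
  simpa only [isometry, fockVec, LinearIsometry.toSpanSingleton_apply, one_smul] using h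

theorem Intertwines.isometry_leftShift (hA : Intertwines θ τ s A) (x : Gen n)
    (f : FockSpace (Semigp θ)) :
    hA.isometry (leftShift (gen θ x) f) = letterOp τ s A x (hA.isometry f) := by
  have : hA.isometry.toContinuousLinearMap.comp (leftShift (gen θ x)) =
      (letterOp τ s A x).comp hA.isometry.toContinuousLinearMap := fock_clm_ext fun w => by
    simp only [ContinuousLinearMap.comp_apply, LinearIsometry.coe_toContinuousLinearMap,
      leftShift_fockVec, hA.isometry_fockVec]
    rw [map_mul, hA.rep_gen, mul_apply_eq_comp]
  exact DFunLike.congr_fun this f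

/-- The left shifts of `τ` in terms of the images of those of `θ`. -/
theorem Intertwines.leftShift_isometry (hA : Intertwines θ τ s A) (i : Fin k)
    (r : Fin (n (s i))) (f : FockSpace (Semigp θ)) :
    leftShift (gen τ ⟨s i, r⟩) (hA.isometry f) =
      hA.isometry ((∑ p, starRingEnd ℂ (A i p r) • leftShift (gen θ ⟨i, p⟩)) f) := by
  have h : ∀ p, hA.isometry (leftShift (gen θ ⟨i, p⟩) f) =
      ∑ q, A i p q • leftShift (gen τ ⟨s i, q⟩) (hA.isometry f) := fun p =>
    (hA.isometry_leftShift ⟨i, p⟩ f).trans (letterOp_apply _ _)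
  simp only [sum_apply, smul_apply, map_sum, map_smul, h, Finset.smul_sum, smul_smul]
  rw [Finset.sum_comm]
  simp only [← Finset.sum_smul, hA.sum_col, ite_smul, one_smul, zero_smul, Finset.sum_ite_eq,
    Finset.mem_univ, if_true]

theorem Intertwines.isometry_surjective (hA : Intertwines θ τ s A) :
    Function.Surjective hA.isometry := by
  have hbasis : ∀ u : Semigp τ, fockVec u ∈ hA.isometry.toLinearMap.range := by
    intro u
    induction u using induction_gen with
    | one => exact ⟨fockVec 1, by
        rw [LinearIsometry.coe_toLinearMap, hA.isometry_fockVec, map_one]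
        rfl⟩
    | mul y u ih =>
      obtain ⟨j, r⟩ := y
      obtain ⟨i, rfl⟩ := s.surjective j
      obtain ⟨f, hf⟩ := ih
      rw [LinearIsometry.coe_toLinearMap] at hf
      exact ⟨_, by
        rw [LinearIsometry.coe_toLinearMap, ← leftShift_fockVec, ← hf, hA.leftShift_isometry]⟩
  have hcl : IsClosed (hA.isometry.toLinearMap.range : Set (FockSpace (Semigp τ))) := by
    rw [LinearMap.coe_range]
    exact hA.isometry.isometry.isClosedEmbedding.isClosed_range
  intro f
  have hf : f ∈ (hA.isometry.toLinearMap.range : Set (FockSpace (Semigp τ))) :=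
    hcl.mem_of_tendsto (hasSum_fockVec f) (Filter.Eventually.of_forall fun t =>
      Submodule.sum_mem _ fun u _ => Submodule.smul_mem _ _ (hbasis u))
  exact hf

/-- The unitary operator `U_{s,A}`. -/
def Intertwines.unitary (hA : Intertwines θ τ s A) :
    FockSpace (Semigp θ) ≃ₗᵢ[ℂ] FockSpace (Semigp τ) :=
  LinearIsometryEquiv.ofSurjective hA.isometry hA.isometry_surjective

theorem Intertwines.conjBy_leftShift (hA : Intertwines θ τ s A) (x : Gen n) :
    conjBy hA.unitary (leftShift (gen θ x)) = letterOp τ s A x := by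
  ext f : 1
  obtain ⟨g, rfl⟩ := hA.unitary.surjective f
  rw [conjBy_apply, LinearIsometryEquiv.symm_apply_apply]
  exact hA.isometry_leftShift x g

theorem Intertwines.map_shiftAlgebra (hA : Intertwines θ τ s A) :
    (shiftAlgebra (Semigp θ)).map (conjBy hA.unitary).toAlgHom = shiftAlgebra (Semigp τ) := by
  have hgen : ∀ w, conjBy hA.unitary (leftShift w) = hA.rep w := by
    intro w
    induction w using induction_gen with
    | one => rw [leftShift_one, map_one, map_one]
    | mul x w ih => rw [leftShift_mul, map_mul, map_mul, ih, hA.conjBy_leftShift, hA.rep_gen]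
  refine le_antisymm ?_ ?_
  · rw [shiftAlgebra, AlgHom.map_adjoin, Algebra.adjoin_le_iff]
    rintro _ ⟨_, ⟨w, rfl⟩, rfl⟩
    change conjBy hA.unitary (leftShift w) ∈ shiftAlgebra (Semigp τ)
    rw [hgen]
    induction w using induction_gen with
    | one =>
      rw [map_one]
      exact one_mem _
    | mul x w ih =>
      rw [map_mul, hA.rep_gen]
      exact mul_mem (letterOp_mem_shiftAlgebra x) ih
  · refine Algebra.adjoin_le ?_
    rintro _ ⟨w, rfl⟩
    induction w using induction_gen with
    | one =>
      rw [leftShift_one]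
      exact one_mem _
    | mul y w ih =>
      rw [leftShift_mul]
      refine mul_mem ?_ ih
      obtain ⟨j, r⟩ := y
      obtain ⟨i, rfl⟩ := s.surjective j
      refine ⟨∑ p, starRingEnd ℂ (A i p r) • leftShift (gen θ ⟨i, p⟩),
        Subalgebra.sum_mem _ fun _ _ => Subalgebra.smul_mem _ (leftShift_mem_shiftAlgebra _) _, ?_⟩
      ext f : 1
      obtain ⟨g, rfl⟩ := hA.unitary.surjective f
      change conjBy hA.unitary _ _ = _
      rw [conjBy_apply, LinearIsometryEquiv.symm_apply_apply]
      exact (hA.leftShift_isometry i r g).symm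

theorem exists_norm_of_productUnitarilyEquivalent (h : ProductUnitarilyEquivalent θ τ) :
    ∃ Φ : normToeplitz (Semigp θ) ≃ₐ[ℂ] normToeplitz (Semigp τ), Isometry Φ := by
  obtain ⟨s, A, hA⟩ := h
  exact ⟨_, isometry_conjByRestrict (map_normToeplitz hA.map_shiftAlgebra)⟩

theorem exists_weak_of_productUnitarilyEquivalent (h : ProductUnitarilyEquivalent θ τ) :
    ∃ Φ : weakToeplitz (Semigp θ) ≃ₐ[ℂ] weakToeplitz (Semigp τ), Isometry Φ := by
  obtain ⟨s, A, hA⟩ := h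
  exact ⟨_, isometry_conjByRestrict (map_weakToeplitz hA.map_shiftAlgebra)⟩

end PermSet

namespace PermSet

variable {k : ℕ} {n : Fin k → ℕ} {θ : PermSet n} [IsCancelMul (Semigp θ)]
  {s : Equiv.Perm (Fin k)} {A : ∀ i : Fin k, Matrix (Fin (n i)) (Fin (n (s i))) ℂ}

/-- The automorphism `X ↦ U_{s,A} X U_{s,A}*`. -/
def Intertwines.automorphism (hA : Intertwines θ θ s A) :
    normToeplitz (Semigp θ) ≃ₐ[ℂ] normToeplitz (Semigp θ) :=
  conjByRestrict (map_normToeplitz hA.map_shiftAlgebra)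

theorem Intertwines.implements (hA : Intertwines θ θ s A) :
    Implements θ hA.unitary hA.automorphism := fun _ _ => rfl

theorem Intertwines.automorphism_leftShift (hA : Intertwines θ θ s A) (x : Gen n) :
    (hA.automorphism ⟨leftShift (gen θ x), leftShift_mem_normToeplitz _ _⟩ :
      FockSpace (Semigp θ) →L[ℂ] FockSpace (Semigp θ)) = letterOp θ s A x :=
  hA.conjBy_leftShift x

theorem Intertwines.isProductUnitary (hA : Intertwines θ θ s A) :
    IsProductUnitary θ s A hA.unitary := by
  intro l _
  have h : hA.rep (l.map (gen θ)).prod = (l.map (letterOp θ s A)).prod := by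
    rw [map_list_prod, List.map_map]
    rfl
  rw [← h]
  exact hA.isometry_fockVec _

end PermSet

/-! ### Unitarily implemented automorphisms -/

theorem Matrix.sum_norm_sq_row {ι κ : Type} [Fintype κ] [DecidableEq ι] {A : Matrix ι κ ℂ}
    (h : A * Aᴴ = 1) (x : ι) : ∑ y, ‖A x y‖ ^ 2 = 1 := by
  have h1 := congrFun (congrFun h x) x
  rw [Matrix.mul_apply, Matrix.one_apply_eq] at h1
  have h2 : ((∑ y, ‖A x y‖ ^ 2 : ℝ) : ℂ) = 1 := by
    rw [← h1, Complex.ofReal_sum]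
    refine Finset.sum_congr rfl fun y _ => ?_
    rw [Matrix.conjTranspose_apply, Complex.ofReal_pow, ← Complex.mul_conj']
    rfl
  exact_mod_cast h2

namespace PermSet

variable {k : ℕ} {n : Fin k → ℕ} {θ : PermSet n}

/-- If the linearized relations at a point `z` hold in all directions, then `z_j = 0` for every
block `j` that is not the only block with at least two generators: a direction in block `i` and
`z_j` together form a point of the relation cone. -/
theorem eq_zero_of_linearized_relations (hθ : relationCone θ ⊆ minimalCone n) {z : Gen n → ℂ}
    (hz : ∀ (v : Gen n → ℂ) (i j : Fin k) (h : i < j) (p : Fin (n i)) (q : Fin (n j)),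
      v ⟨i, p⟩ * z ⟨j, q⟩ + z ⟨i, p⟩ * v ⟨j, q⟩ =
        v ⟨j, (θ i j h (p, q)).2⟩ * z ⟨i, (θ i j h (p, q)).1⟩ +
          z ⟨j, (θ i j h (p, q)).2⟩ * v ⟨i, (θ i j h (p, q)).1⟩)
    {i j : Fin k} (hij : i ≠ j) (hi : 2 ≤ n i) (q : Fin (n j)) : z ⟨j, q⟩ = 0 := by
  classical
  let a : Fin (n i) := ⟨0, by omega⟩
  let b : Fin (n i) := ⟨1, by omega⟩
  have hab : b ≠ a := fun h => by simpa [a, b] using congrArg Fin.val h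
  let v : Gen n → ℂ := fun y => if y = ⟨i, a⟩ then 1 else 0
  have hv : ∀ l, l ≠ i → ∀ p, v ⟨l, p⟩ = 0 := fun l hl p =>
    if_neg fun h => hl (congrArg Sigma.fst h)
  let u : ∀ l : Fin k, Fin (n l) → ℂ := fun l p =>
    if l = i then v ⟨l, p⟩ else if l = j then z ⟨l, p⟩ else 0
  have hui : ∀ p, u i p = v ⟨i, p⟩ := fun p => if_pos rfl
  have huj : ∀ p, u j p = z ⟨j, p⟩ := fun p => by simp [u, hij.symm]
  have hu0 : ∀ l, l ≠ i → l ≠ j → ∀ p, u l p = 0 := fun l h1 h2 p => by simp [u, h1, h2]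
  have hu : u ∈ relationCone θ := by
    intro l m h p q
    have key := hz v l m h p q
    by_cases hli : l = i
    · subst hli
      by_cases hmj : m = j
      · subst hmj
        rw [hv m h.ne', hv m h.ne'] at key
        rw [hui, hui, huj, huj]
        linear_combination key
      · rw [hu0 m h.ne' hmj, hu0 m h.ne' hmj]
        ring
    · by_cases hlj : l = j
      · subst hlj
        by_cases hmi : m = i
        · subst hmi
          rw [hv l hli, hv l hli] at key
          rw [hui, hui, huj, huj]
          linear_combination key
        · rw [hu0 m hmi h.ne', hu0 m hmi h.ne']
          ring
      · rw [hu0 l hli hlj, hu0 l hli hlj]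
        ring
  have hua : u i a = 1 := (hui a).trans (if_pos rfl)
  rcases hθ hu with ⟨m, hm⟩ | hE
  · have him : i = m := by
      by_contra h
      rw [hm i h] at hua
      exact zero_ne_one hua
    rw [← huj, hm j (him ▸ hij.symm)]
    rfl
  · have hub : u i b = 0 := (hui b).trans (if_neg fun h => hab (by simpa using h))
    rw [hE i a b, hub] at hua
    exact absurd hua zero_ne_one

variable [IsCancelMul (Semigp θ)]

section FirstOrder

variable {W : FockSpace (Semigp θ) ≃ₗᵢ[ℂ] FockSpace (Semigp θ)} {B : Matrix (Gen n) (Gen n) ℂ}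

/-- If conjugation by a unitary maps the generators to analytic Toeplitz operators without constant
coefficients, then the matrix of their first order coefficients is unitary. In fact, up to
a phase, the adjoint of the unitary fixes the vacuum vector and acts by this matrix on the
span of the vectors `ξ_y` of the generators `y`. -/
theorem conjTranspose_mul_self_of_conjBy
    (hT : ∀ x, IsToeplitz (conjBy W (leftShift (gen θ x))))
    (h0 : ∀ x, conjBy W (leftShift (gen θ x)) (fockVec 1) 1 = 0)
    (hB : ∀ x y, conjBy W (leftShift (gen θ x)) (fockVec 1) (gen θ y) = B x y) : Bᴴ * B = 1 := by
  classical
  have hsymm : ∀ w f, W f w = inner ℂ (W.symm (fockVec w)) f := fun w f => by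
    rw [← inner_fockVec_left, ← W.inner_map_map (W.symm (fockVec w)) f, W.apply_symm_apply]
  have hcoord : ∀ w v, W.symm (fockVec w) v = starRingEnd ℂ (W (fockVec v) w) := fun w v => by
    rw [hsymm, inner_conj_symm, inner_fockVec_left]
  have hconj : ∀ x f, W (leftShift (gen θ x) f) = conjBy W (leftShift (gen θ x)) (W f) :=
    fun x f => by rw [conjBy_apply, W.symm_apply_apply]
  have hone : ∀ x u, W (fockVec (gen θ x * u)) 1 = 0 := fun x u => by
    rw [← leftShift_fockVec, hconj, (hT x).apply_one, h0, zero_mul]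
  set c : ℂ := W.symm (fockVec 1) 1
  have hvac : W.symm (fockVec 1) = c • fockVec 1 := by
    refine lp.ext (funext fun w => ?_)
    rw [lp.coeFn_smul, Pi.smul_apply, fockVec_apply]
    rcases eq_one_or_exists_gen_mul w with rfl | ⟨x, u, rfl⟩
    · simp [c]
    · rw [hcoord, hone, map_zero, if_neg, smul_zero]
      intro h
      have := congrArg (length θ) h
      rw [length_mul, length_gen, length_one] at this
      omega
  have hc : starRingEnd ℂ c * c = 1 := by
    have h1 := W.symm.norm_map (fockVec 1)
    rw [hvac, norm_smul, norm_fockVec, mul_one] at h1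
    rw [Complex.conj_mul', h1]
    simp
  have hW1 : ∀ f, W f 1 = starRingEnd ℂ c * f 1 := fun f => by
    rw [hsymm, hvac, inner_smul_left, inner_fockVec_left]
  have hgen : ∀ y, W.symm (fockVec (gen θ y)) =
      ∑ x, (starRingEnd ℂ (B x y) * c) • fockVec (gen θ x) := by
    intro y
    refine lp.ext (funext fun w => ?_)
    rw [← coord_apply w (∑ x, _), map_sum]
    simp only [map_smul, coord_apply, fockVec_apply, smul_eq_mul, mul_ite, mul_one, mul_zero]
    rcases eq_one_or_exists_gen_mul w with rfl | ⟨x, u, rfl⟩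
    · have h1 : (W.symm (fockVec (gen θ y)) : FockSpace (Semigp θ)) 1 = 0 := by
        have h2 : W (fockVec 1) = (starRingEnd ℂ c) • fockVec 1 := by
          rw [← W.symm.injective.eq_iff, W.symm_apply_apply, map_smul, hvac, smul_smul, hc,
            one_smul]
        rw [hcoord, h2, lp.coeFn_smul, Pi.smul_apply, fockVec_apply_of_ne (gen_ne_one y),
          smul_zero, map_zero]
      rw [h1, Finset.sum_eq_zero]
      exact fun x _ => if_neg (gen_ne_one x).symm
    · rw [hcoord, ← leftShift_fockVec, hconj, (hT x).apply_gen, h0, hB, zero_mul, zero_add, hW1,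
        fockVec_apply]
      by_cases hu : u = 1
      · subst hu
        simp [gen_injective.eq_iff]
      · rw [if_neg (Ne.symm hu), Finset.sum_eq_zero]
        · simp
        · intro a _
          refine if_neg fun h => hu (eq_one_of_length ?_)
          have := congrArg (length θ) h
          rw [length_mul, length_gen, length_gen] at this
          omega
  ext y' y
  have h1 : inner ℂ (W.symm (fockVec (gen θ y))) (W.symm (fockVec (gen θ y'))) =
      if y' = y then (1 : ℂ) else 0 := by
    rw [W.symm.inner_map_map, inner_fockVec_left, fockVec_apply]
    exact if_congr (gen_injective.eq_iff.trans eq_comm) rfl rfl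
  rw [Matrix.mul_apply, Matrix.one_apply, ← h1, hgen, hgen]
  simp only [sum_inner, inner_sum, inner_smul_left, inner_smul_right, inner_fockVec_left,
    fockVec_apply, gen_injective.eq_iff, mul_ite, mul_one, mul_zero, Finset.sum_ite_eq',
    Finset.mem_univ, if_true, map_mul, Complex.conj_conj]
  refine Finset.sum_congr rfl fun x _ => ?_
  rw [Matrix.conjTranspose_apply]
  change starRingEnd ℂ (B x y') * B x y = _
  linear_combination (-(starRingEnd ℂ (B x y') * B x y)) * hc

end FirstOrder

/-- A vector of norm at most one whose generator coefficients form a unit vector has no other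
coefficients. -/
theorem eq_sum_gen_of_norm_le_one {f : FockSpace (Semigp θ)} (hf : ‖f‖ ≤ 1)
    (h : ∑ y, ‖f (gen θ y)‖ ^ 2 = 1) : f = ∑ y, f (gen θ y) • fockVec (gen θ y) := by
  classical
  refine lp.ext (funext fun w => ?_)
  rw [← coord_apply w (∑ y, _), map_sum]
  simp only [map_smul, coord_apply, fockVec_apply, smul_eq_mul, mul_ite, mul_one, mul_zero]
  by_cases hw : ∃ y, gen θ y = w
  · obtain ⟨y, rfl⟩ := hw
    simp [gen_injective.eq_iff]
  · rw [Finset.sum_eq_zero fun y _ => if_neg fun hy => hw ⟨y, hy.symm⟩]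
    have h1 := sum_norm_sq_le (insert w (Finset.univ.image (gen θ))) f
    rw [Finset.sum_insert (by simpa using hw), Finset.sum_image fun _ _ _ _ h => gen_injective h,
      h] at h1
    have h2 : ‖f w‖ ^ 2 ≤ 0 := by nlinarith [norm_nonneg f]
    exact norm_eq_zero.mp (pow_eq_zero_iff two_ne_zero |>.mp (le_antisymm h2 (sq_nonneg _)))

/-- The points of the Gelfand space bound the coefficients of linear combinations of the
generators: coefficients that are supported on blocks with one generator have `ℓ¹`-norm at most the
operator norm. -/
theorem sum_norm_le_of_isMinimalType (hθ : IsMinimalType θ) {b : Gen n → ℂ}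
    (hb : ∀ y, 2 ≤ n y.1 → b y = 0) :
    ∑ y, ‖b y‖ ≤ ‖∑ y, b y • leftShift (gen θ y)‖ := by
  classical
  let ζ : ∀ i : Fin k, Fin (n i) → ℂ := fun i p =>
    if 2 ≤ n i then 0 else starRingEnd ℂ (b ⟨i, p⟩) / ‖b ⟨i, p⟩‖
  have hsub : ∀ i, ¬ 2 ≤ n i → Subsingleton (Fin (n i)) := fun i hi =>
    Fin.subsingleton_iff_le_one.mpr (by omega)
  have hζ : ζ ∈ minimalSpace n := by
    refine ⟨fun i => ?_, Or.inr fun i p q => ?_⟩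
    · by_cases hi : 2 ≤ n i
      · simp [ζ, hi]
      · have := hsub i hi
        rcases isEmpty_or_nonempty (Fin (n i)) with _ | ⟨⟨p⟩⟩
        · simp
        · rw [Fintype.sum_subsingleton _ p]
          simp only [ζ, if_neg hi, norm_div, RCLike.norm_conj, Complex.norm_real, norm_norm]
          exact pow_le_one₀ (by positivity) (div_self_le_one _)
    · by_cases hi : 2 ≤ n i
      · simp [ζ, hi]
      · have := hsub i hi
        rw [Subsingleton.elim p q]
  rw [← hθ] at hζ
  obtain ⟨ρ, hρ⟩ := hζ
  have hρ' : ∀ i p, ρ ⟨leftShift (gen θ ⟨i, p⟩), leftShift_mem_normToeplitz _ _⟩ = ζ i p :=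
    fun i p => congrFun (congrFun hρ i) p
  let X : normToeplitz (Semigp θ) :=
    ∑ y, b y • ⟨leftShift (gen θ y), leftShift_mem_normToeplitz _ _⟩
  have hX : (X : FockSpace (Semigp θ) →L[ℂ] FockSpace (Semigp θ)) =
      ∑ y, b y • leftShift (gen θ y) := by
    simp only [X, AddSubmonoidClass.coe_finsetSum, Subalgebra.coe_smul]
  have h1 : ρ X = ((∑ y, ‖b y‖ : ℝ) : ℂ) := by
    rw [map_sum, Complex.ofReal_sum]
    refine Finset.sum_congr rfl fun y _ => ?_
    obtain ⟨i, p⟩ := y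
    rw [map_smul, hρ', smul_eq_mul]
    by_cases hi : 2 ≤ n i
    · simp [hb ⟨i, p⟩ hi]
    · simp only [ζ, if_neg hi]
      by_cases h0 : b ⟨i, p⟩ = 0
      · simp [h0]
      · have : (‖b ⟨i, p⟩‖ : ℂ) ≠ 0 := by simpa using h0
        rw [← mul_div_assoc, Complex.mul_conj', div_eq_iff this, sq]
  have h2 := norm_character_le ρ X
  rw [h1, Complex.norm_real, Real.norm_of_nonneg (Finset.sum_nonneg fun _ _ => norm_nonneg _)]
    at h2
  rw [← hX]
  exact h2

/-- A unitary matrix preserving the relations, whose rows have operator norm at most one as linear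
combinations of generators, vanishes outside the blocks at the positions `(i, s(i))`. -/
theorem eq_zero_of_ne_block (hθ : IsMinimalType θ) {B : Matrix (Gen n) (Gen n) ℂ}
    (hB : Bᴴ * B = 1) (hnorm : ∀ x, ‖∑ y, B x y • leftShift (gen θ y)‖ ≤ 1)
    {s : Equiv.Perm (Fin k)} (hs : ∀ i, n (s i) = n i) (hn : ∀ i, 1 ≤ n i)
    (hbig : ∀ i, 2 ≤ n i → ∀ x : Gen n, x.1 ≠ i → ∀ r, B x ⟨s i, r⟩ = 0)
    (hsmall : ∀ i, n i = 1 → ∀ p r, B ⟨i, p⟩ ⟨s i, r⟩ ≠ 0) (x y : Gen n) (hxy : y.1 ≠ s x.1) :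
    B x y = 0 := by
  classical
  have hB' : B * Bᴴ = 1 := mul_eq_one_comm.mp hB
  have hrow : ∀ x, ∑ y, ‖B x y‖ ^ 2 = 1 := Matrix.sum_norm_sq_row hB'
  obtain ⟨i, p⟩ := x
  have hclean : ∑ r, ‖B ⟨i, p⟩ ⟨s i, r⟩‖ ^ 2 = 1 → B ⟨i, p⟩ y = 0 := by
    intro h1
    have h2 := hrow ⟨i, p⟩
    rw [Fintype.sum_sigma, ← Finset.add_sum_erase _ _ (Finset.mem_univ (s i)), h1,
      add_eq_left, Finset.sum_eq_zero_iff_of_nonneg fun _ _ =>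
        Finset.sum_nonneg fun _ _ => by positivity] at h2
    have h3 := h2 y.1 (Finset.mem_erase.mpr ⟨hxy, Finset.mem_univ _⟩)
    rw [Finset.sum_eq_zero_iff_of_nonneg fun _ _ => by positivity] at h3
    exact norm_eq_zero.mp (pow_eq_zero_iff two_ne_zero |>.mp (h3 y.2 (Finset.mem_univ _)))
  refine hclean ?_
  by_cases hi : 2 ≤ n i
  · let A : Matrix (Fin (n i)) (Fin (n (s i))) ℂ := Matrix.of fun p r => B ⟨i, p⟩ ⟨s i, r⟩
    have hA : Aᴴ * A = 1 := by
      ext r t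
      have h1 := congrFun (congrFun hB ⟨s i, r⟩) ⟨s i, t⟩
      rw [Matrix.mul_apply, Fintype.sum_sigma, Finset.sum_eq_single i] at h1
      · rw [Matrix.mul_apply]
        refine h1.trans ?_
        simp [Matrix.one_apply]
      · intro j _ hj
        exact Finset.sum_eq_zero fun q _ => by rw [hbig i hi ⟨j, q⟩ hj t, mul_zero]
      · exact fun h => absurd (Finset.mem_univ i) h
    have hA' : A * Aᴴ = 1 := (Matrix.mul_eq_one_comm_of_card_eq _ _ _ (by simp [hs])).mp hA
    exact Matrix.sum_norm_sq_row hA' p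
  · have hi1 : n i = 1 := by have := hn i; omega
    have h1 : ∑ y, ‖B ⟨i, p⟩ y‖ ≤ 1 := by
      refine (sum_norm_le_of_isMinimalType hθ fun y hy => ?_).trans (hnorm _)
      obtain ⟨j, r⟩ := y
      obtain ⟨j, rfl⟩ := s.surjective j
      change 2 ≤ n (s j) at hy
      rw [hs] at hy
      exact hbig j hy _ (fun h : i = j => hi (h ▸ hy)) r
    -- The `ℓ¹`- and the `ℓ²`-norm of the row agree, so its entries have modulus `0` or `1`.
    have hle : ∀ y, ‖B ⟨i, p⟩ y‖ ≤ 1 := fun y =>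
      (Finset.single_le_sum (fun _ _ => norm_nonneg _) (Finset.mem_univ y)).trans h1
    have hle' : ∀ y ∈ Finset.univ, ‖B ⟨i, p⟩ y‖ ^ 2 ≤ ‖B ⟨i, p⟩ y‖ := fun y _ => by
      nlinarith [hle y, norm_nonneg (B ⟨i, p⟩ y)]
    have heq := (Finset.sum_eq_sum_iff_of_le hle').mp
      (le_antisymm (Finset.sum_le_sum hle') (by rw [hrow]; exact h1))
    have : Subsingleton (Fin (n (s i))) := Fin.subsingleton_iff_le_one.mpr (by rw [hs, hi1])
    let r : Fin (n (s i)) := ⟨0, hn _⟩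
    rw [Fintype.sum_subsingleton _ r, heq _ (Finset.mem_univ _)]
    have h2 := heq ⟨s i, r⟩ (Finset.mem_univ _)
    have h3 : ‖B ⟨i, p⟩ ⟨s i, r⟩‖ ≠ 0 := norm_ne_zero_iff.mpr (hsmall i hi1 p r)
    rw [sq] at h2
    exact mul_right_cancel₀ h3 (h2.trans (one_mul _).symm)

/-- Continuous automorphisms of the norm closed algebra are determined by the images of the
generators. -/
theorem algEquiv_eq_of_gen {Φ Ψ : normToeplitz (Semigp θ) ≃ₐ[ℂ] normToeplitz (Semigp θ)}
    (hΦ : Continuous Φ) (hΨ : Continuous Ψ)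
    (h : ∀ x, Φ ⟨leftShift (gen θ x), leftShift_mem_normToeplitz _ _⟩ =
      Ψ ⟨leftShift (gen θ x), leftShift_mem_normToeplitz _ _⟩) (X : normToeplitz (Semigp θ)) :
    Φ X = Ψ X := by
  refine normToeplitz_induction (P := fun X => Φ X = Ψ X) (isClosed_eq hΦ hΨ) ?_
    (by rw [map_zero, map_zero]) ?_ ?_ X
  · intro u
    induction u using induction_gen with
    | one =>
      have : (⟨leftShift (1 : Semigp θ), leftShift_mem_normToeplitz _ _⟩ :
          normToeplitz (Semigp θ)) = 1 := Subtype.ext leftShift_one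
      rw [this, map_one, map_one]
    | mul x w ih =>
      have : (⟨leftShift (gen θ x * w), leftShift_mem_normToeplitz _ _⟩ :
          normToeplitz (Semigp θ)) = ⟨leftShift (gen θ x), leftShift_mem_normToeplitz _ _⟩ *
            ⟨leftShift w, leftShift_mem_normToeplitz _ _⟩ := Subtype.ext (leftShift_mul _ _)
      rw [this, map_mul, map_mul, h, ih]
  · intro A B hA hB
    rw [map_add, map_add, hA, hB]
  · intro c A hA
    rw [map_smul, map_smul, hA]

/-- Unitarily implemented automorphisms come from product unitaries: by the absence of constant
coefficients and unitarity of the first order coefficients, the generators are mapped to linear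
combinations of generators. -/
theorem exists_intertwines_of_implements (hmin : IsMinimalType θ) (hn : ∀ i, 1 ≤ n i)
    (htwo : ∃ i j : Fin k, i ≠ j ∧ 2 ≤ n i ∧ 2 ≤ n j)
    (Φ : normToeplitz (Semigp θ) ≃ₐ[ℂ] normToeplitz (Semigp θ))
    {W : FockSpace (Semigp θ) ≃ₗᵢ[ℂ] FockSpace (Semigp θ)} (hW : Implements θ W Φ) :
    ∃ (s : Equiv.Perm (Fin k)) (A : ∀ i : Fin k, Matrix (Fin (n i)) (Fin (n (s i))) ℂ)
      (hA : Intertwines θ θ s A), Implements θ hA.unitary Φ := by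
  classical
  have hcone := relationCone_subset_of_isMinimalType hmin
  have hTop : ∀ T ∈ normToeplitz (Semigp θ), IsToeplitz T := fun T hT =>
    isToeplitz_of_mem_weakToeplitz (normToeplitz_le_weakToeplitz hT)
  have hconj : ∀ X, (Φ X : FockSpace (Semigp θ) →L[ℂ] FockSpace (Semigp θ)) = conjBy W X :=
    fun X => ContinuousLinearMap.ext (hW X)
  have hiso : Isometry Φ := fun X Y => by
    have := isometry_conjBy (U := W) X.1 Y.1
    rw [← hconj, ← hconj] at this
    exact this
  have hdet := det_ne_zero_of_isometry (leftShift_mem_normToeplitz _)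
    (leftShift_mem_normToeplitz _) hTop
    (fun z ψ _ h2 h3 h4 => eq_zero_of_map_gen_mul (z := z) h2 h3 h4) Φ hiso (fun _ _ => rfl)
  have hQ := preservesRelations_of_isometry (leftShift_mem_normToeplitz _) hTop Φ
    (fun _ _ => rfl) hdet
  obtain ⟨s, hs, hbig, hsmall⟩ := hQ.exists_perm hdet hcone hn
  set B : Matrix (Gen n) (Gen n) ℂ := fun x y =>
    (Φ ⟨_, leftShift_mem_normToeplitz _ (gen θ x)⟩ :
      FockSpace (Semigp θ) →L[ℂ] FockSpace (Semigp θ)) (fockVec 1) (gen θ y) with hBdef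
  have hT : ∀ x, IsToeplitz (conjBy W (leftShift (gen θ x))) := fun x => by
    rw [← hconj ⟨_, leftShift_mem_normToeplitz _ (gen θ x)⟩]
    exact hTop _ (Φ _).2
  have hBc : ∀ x y, conjBy W (leftShift (gen θ x)) (fockVec 1) (gen θ y) = B x y := fun x y => by
    rw [hBdef, ← hconj ⟨_, leftShift_mem_normToeplitz _ (gen θ x)⟩]
  have h0 : ∀ x, conjBy W (leftShift (gen θ x)) (fockVec 1) 1 = 0 := by
    rintro ⟨j, q⟩
    obtain ⟨i, hij, hi⟩ : ∃ i, i ≠ j ∧ 2 ≤ n i := by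
      obtain ⟨a, b, hab, ha, hb⟩ := htwo
      by_cases haj : a = j
      · exact ⟨b, fun h => hab (haj.trans h.symm), hb⟩
      · exact ⟨a, haj, ha⟩
    refine eq_zero_of_linearized_relations (θ := θ)
      (z := fun x => conjBy W (leftShift (gen θ x)) (fockVec 1) 1) hcone ?_ hij hi q
    intro v i j h p q
    refine linearized_relations (T := fun x => conjBy W (leftShift (gen θ x))) hT ?_ hBc hdet v h
      p q
    intro i j h p q
    rw [← map_mul, ← map_mul, ← leftShift_mul, ← leftShift_mul, gen_mul_gen]
  have hunit : Bᴴ * B = 1 := conjTranspose_mul_self_of_conjBy hT h0 hBc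
  have hnormT : ∀ x, ‖conjBy W (leftShift (gen θ x))‖ ≤ 1 := fun x => by
    rw [(AddMonoidHomClass.isometry_iff_norm (conjBy W)).mp isometry_conjBy]
    exact norm_leftShift_le _
  have hunit' : B * Bᴴ = 1 := mul_eq_one_comm.mp hunit
  have hlin : ∀ x, conjBy W (leftShift (gen θ x)) = ∑ y, B x y • leftShift (gen θ y) := by
    intro x
    have hmem : IsToeplitz (∑ y, B x y • leftShift (gen θ y)) :=
      hTop _ (Subalgebra.sum_mem _ fun y _ =>
        Subalgebra.smul_mem _ (leftShift_mem_normToeplitz _ _) _)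
    refine (hT x).ext hmem ?_
    rw [eq_sum_gen_of_norm_le_one (f := conjBy W (leftShift (gen θ x)) (fockVec 1))]
    · simp only [hBc, sum_apply, smul_apply, leftShift_fockVec_one]
    · refine (ContinuousLinearMap.le_opNorm _ _).trans ?_
      rw [norm_fockVec, mul_one]
      exact hnormT x
    · simp only [hBc]
      exact Matrix.sum_norm_sq_row hunit' x
  have hclean := eq_zero_of_ne_block hmin hunit (fun x => hlin x ▸ hnormT x) hs hn hbig hsmall
  have hsum : ∀ {M : Type} [AddCommMonoid M] (i : Fin k) (p : Fin (n i)) (F : Gen n → M),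
      (∀ y, B ⟨i, p⟩ y = 0 → F y = 0) → ∑ y, F y = ∑ r, F ⟨s i, r⟩ := by
    intro M _ i p F hF
    rw [Fintype.sum_sigma, Finset.sum_eq_single (s i)]
    · exact fun j _ hj => Finset.sum_eq_zero fun r _ => hF _ (hclean _ _ hj)
    · exact fun h => absurd (Finset.mem_univ _) h
  let A : ∀ i : Fin k, Matrix (Fin (n i)) (Fin (n (s i))) ℂ := fun i =>
    Matrix.of fun p r => B ⟨i, p⟩ ⟨s i, r⟩
  have hA : Intertwines θ θ s A := by
    refine ⟨fun i => ?_, fun i j h => ?_⟩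
    · have h1 : A i * (A i)ᴴ = 1 := by
        ext p q
        have h2 := congrFun (congrFun hunit' ⟨i, p⟩) ⟨i, q⟩
        rw [Matrix.mul_apply, Matrix.one_apply, hsum i p _ fun y hy => by rw [hy, zero_mul]] at h2
        rw [Matrix.mul_apply, Matrix.one_apply]
        refine h2.trans (if_congr ?_ rfl rfl)
        simp
      exact ⟨h1, (Matrix.mul_eq_one_comm_of_card_eq _ _ _ (by simp [hs])).mp h1⟩
    · rw [intertwine_entries_iff h]
      intro p q α β
      exact hQ.intertwine_entries hs hbig h p q α β
  refine ⟨s, A, hA, fun X f => ?_⟩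
  have hauto : Isometry hA.automorphism :=
    isometry_conjByRestrict (map_normToeplitz hA.map_shiftAlgebra)
  rw [algEquiv_eq_of_gen hiso.continuous hauto.continuous (fun x => ?_) X]
  · exact hA.implements X f
  · refine Subtype.ext ?_
    rw [hA.automorphism_leftShift, hconj, hlin]
    obtain ⟨i, p⟩ := x
    exact hsum i p _ fun y hy => by rw [hy, zero_smul]

end PermSet

end

theorem theorem7p3 {k : ℕ} {n : Fin k → ℕ} (hn : ∀ i, 1 ≤ n i) (θ τ : PermSet n)
    [IsCancelMul (PermSet.Semigp θ)] [IsCancelMul (PermSet.Semigp τ)] :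
    (PermSet.IsPurelyCyclic θ → PermSet.IsMinimalType θ) ∧
    (PermSet.IsMinimalType θ → PermSet.IsMinimalType τ →
      [∃ Φ : normToeplitz (PermSet.Semigp θ) ≃ₐ[ℂ] normToeplitz (PermSet.Semigp τ), Isometry Φ,
       ∃ Φ : weakToeplitz (PermSet.Semigp θ) ≃ₐ[ℂ] weakToeplitz (PermSet.Semigp τ), Isometry Φ,
       PermSet.ProductUnitarilyEquivalent θ τ].TFAE) ∧
    (PermSet.IsMinimalType θ → (∃ i j : Fin k, i ≠ j ∧ 2 ≤ n i ∧ 2 ≤ n j) →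
      ∀ Φ : normToeplitz (PermSet.Semigp θ) ≃ₐ[ℂ] normToeplitz (PermSet.Semigp θ),
        (∃ W, PermSet.Implements θ W Φ) →
        ∃ (s : Equiv.Perm (Fin k)) (A : ∀ i : Fin k, Matrix (Fin (n i)) (Fin (n (s i))) ℂ),
          PermSet.Intertwines θ θ s A ∧
          ∃ W, PermSet.IsProductUnitary θ s A W ∧ PermSet.Implements θ W Φ) ∧
    (∀ (s : Equiv.Perm (Fin k)) (A : ∀ i : Fin k, Matrix (Fin (n i)) (Fin (n (s i))) ℂ),
      PermSet.Intertwines θ θ s A →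
        ∃ W, PermSet.IsProductUnitary θ s A W ∧
          ∃ Φ : normToeplitz (PermSet.Semigp θ) ≃ₐ[ℂ] normToeplitz (PermSet.Semigp θ),
            PermSet.Implements θ W Φ) := by
  refine ⟨PermSet.isMinimalType_of_isPurelyCyclic, fun hθ _ => ?_,
    fun hθ htwo Φ ⟨W, hW⟩ => ?_, fun s A hA => ?_⟩
  · have hcone := PermSet.relationCone_subset_of_isMinimalType hθ
    tfae_have 1 → 3 := fun ⟨Φ, hΦ⟩ => PermSet.productUnitarilyEquivalent_of_norm hcone hn Φ hΦ
    tfae_have 2 → 3 := fun ⟨Φ, hΦ⟩ => PermSet.productUnitarilyEquivalent_of_weak hcone hn Φ hΦ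
    tfae_have 3 → 1 := PermSet.exists_norm_of_productUnitarilyEquivalent
    tfae_have 3 → 2 := PermSet.exists_weak_of_productUnitarilyEquivalent
    tfae_finish
  · obtain ⟨s, A, hA, hΦ⟩ := PermSet.exists_intertwines_of_implements hθ hn htwo Φ hW
    exact ⟨s, A, hA, hA.unitary, hA.isProductUnitary, hΦ⟩
  · exact ⟨hA.unitary, hA.isProductUnitary, hA.automorphism, hA.implements⟩
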